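/- Logarithms are natural, "w.h.p." means with probability tending to $1$ as $n\to\infty$, and $a_n\gg b_n$ means $a_n/b_n\to\infty$. For a graph $G=(V,E)$ with edge lengths $\ell:E\to[0,\infty)$, let $d_{v,w}$ be the shortest distance from $v$ to $w$ ($\infty$ if there is no path). A $\lambda$-spanner is a set $E'\subseteq E$ such that the shortest distances $d'_{v,w}$ in $(V,E')$ satisfy $d'_{v,w}\le\lambda d_{v,w}$ for all $v,w\in V$. Let $\theta=\log^{-1/2}n$. A sequence of graphs $G=G_n$ on $[n]$ is in the class $\mathcal G(d)$, $d=d(n)$, if $1\ge d\gg \frac{\log\log n}{\log^{1/2}n}$ and there is $\omega=\omega(n)\to\infty$ such that, with $\psi=\frac{\omega\log\log n}{\log^{1/2}n}$, for all large $n$: $\psi\le d$; all vertex degrees of $G$ lie between $(1-\theta)dn$ and $(1+\theta)dn$; and $|E(S,T)|\ge\psi|S||T|$ for all disjoint $S,T\subseteq[n]$ with $|S|,|T|\ge\theta n$, where $E(S,T)$ is the set of edges with one end in $S$ and the other in $T$. **Theorem.** Let $G\in\mathcal G(d)$, or let $G$ be a $dn$-regular graph on $[n]$ with $d=d(n)>1/2$,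 and let the lengths of the edges of $G$ be independent exponential random variables of mean one. Then the following hold. (a) The minimum size of a $1$-spanner is w.h.p. asymptotically equal to $\frac12n\log n$: for every fixed $\varepsilon>0$, w.h.p. it lies in $(1\pm\varepsilon)\frac12 n\log n$. (b) If $2\le\lambda=\lambda(n)=O(1)$, then w.h.p. every $\lambda$-spanner has at least $\frac{n\log n}{601\lambda}$ edges, and, for those $n$ with $d\ge 1/300$, at least $\frac{n\log n}{601d\lambda}$ edges. The same conclusions (a) and (b), with $d=p$ and with w.h.p. referring to the random graph and the lengths together, hold for the random graph $G_{n,p}$, $p=p(n)\in[0,1]$, with independent mean-one exponential edge lengths, whenever $np\gg\log n$. -/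

import Mathlib

open MeasureTheory ProbabilityTheory Filter Topology
open scoped ENNReal unitInterval

namespace RandomSpanner

/-- The length of a walk: the sum of the lengths of the edges that it uses. Lengths are read in
`[0, ∞]`; the exponential lengths used below are almost surely positive. -/
noncomputable def walkLength {V : Type*} {G : SimpleGraph V} (len : Sym2 V → ℝ) {u v : V}
    (w : G.Walk u v) : ℝ≥0∞ :=
  (w.edges.map fun e => ENNReal.ofReal (len e)).sum

/-- The shortest distance between two vertices (`∞` if no path joins them). Only the lengths
`len e` of edges `e` of `G` matter. -/
noncomputable def shortestDist {V : Type*} (G : SimpleGraph V) (len : Sym2 V → ℝ) (u v : V) :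
    ℝ≥0∞ :=
  ⨅ w : G.Walk u v, walkLength len w

/-- `S` is a `t`-spanner of `G`: a set of edges of `G` such that the distances in the
graph `(V, S)` are at most `t` times the distances in `G`. -/
def IsSpanner {V : Type*} (G : SimpleGraph V) (len : Sym2 V → ℝ) (t : ℝ)
    (S : Finset (Sym2 V)) : Prop :=
  (S : Set (Sym2 V)) ⊆ G.edgeSet ∧
    ∀ u v : V, shortestDist (SimpleGraph.fromEdgeSet (S : Set (Sym2 V))) len u v ≤
      ENNReal.ofReal t * shortestDist G len u v

/-- The minimum number of edges of a `t`-spanner. -/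
noncomputable def minSpannerSize {V : Type*} (G : SimpleGraph V) (len : Sym2 V → ℝ) (t : ℝ) : ℕ :=
  sInf {k : ℕ | ∃ S : Finset (Sym2 V), IsSpanner G len t S ∧ S.card = k}

/-- For `t ≥ 1` the minimum in the definition of `minSpannerSize` is attained. -/
theorem exists_isSpanner_card_eq {V : Type*} [Fintype V] (G : SimpleGraph V) (len : Sym2 V → ℝ)
    {t : ℝ} (ht : 1 ≤ t) :
    ∃ S : Finset (Sym2 V), IsSpanner G len t S ∧ S.card = minSpannerSize G len t := by
  classical
  refine Nat.sInf_mem (s := {k : ℕ | ∃ S : Finset (Sym2 V), IsSpanner G len t S ∧ S.card = k})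
    ⟨_, G.edgeFinset, ⟨by simp, fun u v => ?_⟩, rfl⟩
  rw [SimpleGraph.coe_edgeFinset, SimpleGraph.fromEdgeSet_edgeSet]
  exact le_mul_of_one_le_left (by positivity) (by simpa using ht)

/-- The joint law of independent `Exp(1)` lengths. There is one length for every element of
`Sym2 (Fin n)`; the lengths of the edges of a graph `G` on `Fin n` are those at `e ∈ G.edgeSet`,
and the other coordinates play no role. -/
noncomputable def lengthLaw (n : ℕ) : Measure (Sym2 (Fin n) → ℝ) :=
  Measure.pi fun _ => expMeasure 1

instance (n : ℕ) : IsProbabilityMeasure (lengthLaw n) := by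
  have : IsProbabilityMeasure (expMeasure 1) := isProbabilityMeasure_expMeasure one_pos
  unfold lengthLaw
  infer_instance

/-- The tolerance `θ = (log n)^(-1/2)`. -/
noncomputable def theta (n : ℕ) : ℝ := 1 / √(Real.log n)

/-- The function `log log n / (log n)^(1/2)`. -/
noncomputable def threshold (n : ℕ) : ℝ := Real.log (Real.log n) / √(Real.log n)

open Classical in
/-- `(1 - θ) d n ≤ δ(G) ≤ Δ(G) ≤ (1 + θ) d n`. -/
def AlmostRegular {n : ℕ} (d : ℝ) (G : SimpleGraph (Fin n)) : Prop :=
  ∀ v, (1 - theta n) * (d * n) ≤ G.degree v ∧ (G.degree v : ℝ) ≤ (1 + theta n) * (d * n)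

open Classical in
/-- `|E(S, T)| ≥ ψ |S| |T|` for all disjoint `S`, `T` with at least `θ n` vertices each. -/
def Expanding {n : ℕ} (ψ : ℝ) (G : SimpleGraph (Fin n)) : Prop :=
  ∀ S T : Finset (Fin n), Disjoint S T → theta n * n ≤ S.card → theta n * n ≤ T.card →
    ψ * S.card * T.card ≤ (G.interedges S T).card

/-- The sequence `G n` of graphs lies in the class `𝒢(d)`, where `d = d n`:
`log log n / (log n)^(1/2) ≪ d ≤ 1`, and there is `ω → ∞` such that, for all large `n`,
`ψ = ω log log n / (log n)^(1/2)` is at most `d`, and `G n` is almost regular of degree `d n`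
and expanding with parameter `ψ`. -/
def InClass (d : ℕ → ℝ) (G : ∀ n : ℕ, SimpleGraph (Fin n)) : Prop :=
  (∀ᶠ n in atTop, d n ≤ 1) ∧
  Tendsto (fun n => d n / threshold n) atTop atTop ∧
  ∃ ω : ℕ → ℝ, Tendsto ω atTop atTop ∧
    ∀ᶠ n in atTop, ω n * threshold n ≤ d n ∧ AlmostRegular (d n) (G n) ∧
      Expanding (ω n * threshold n) (G n)

open Classical in
/-- For all large `n` the graph `G n` is `d n`-regular (every degree is `d n * n`), `d n > 1/2`. -/
def DenseRegular (d : ℕ → ℝ) (G : ∀ n : ℕ, SimpleGraph (Fin n)) : Prop :=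
  ∀ᶠ n in atTop, 1 / 2 < d n ∧ ∀ v, ((G n).degree v : ℝ) = d n * n

/-- The minimum size of a `1`-spanner is within a factor `1 ± ε` of `n log n / 2`. -/
def OneSpannerNear {n : ℕ} (ε : ℝ) (G : SimpleGraph (Fin n)) (len : Sym2 (Fin n) → ℝ) : Prop :=
  |(minSpannerSize G len 1 : ℝ) - 1 / 2 * n * Real.log n| ≤ ε * (1 / 2 * n * Real.log n)

/-- Every `t`-spanner has at least `n log n / (601 t)` edges, and at least `n log n / (601 d t)`
edges in case `d ≥ 1 / 300`. -/
def SpannersLarge {n : ℕ} (d t : ℝ) (G : SimpleGraph (Fin n)) (len : Sym2 (Fin n) → ℝ) : Prop :=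
  ∀ S : Finset (Sym2 (Fin n)), IsSpanner G len t S →
    n * Real.log n / (601 * t) ≤ S.card ∧
      (1 / 300 ≤ d → n * Real.log n / (601 * d * t) ≤ S.card)

end RandomSpanner

namespace RandomSpanner

set_option linter.unusedSectionVars false

/-! Put `L = log n / (d n)`. About `d n² y / 2` edges have length at most `y`, which for `y = L` is
`n log n / 2`. On the other hand `L` is the typical distance in this first passage percolation: up
to factors `1 ± ε`, most pairs of adjacent vertices have no detour shorter than `L`, but do have a
path of length about `L`. So a minimum `1`-spanner consists essentially of the edges of length at
most `L`.

Lower bounds. An edge `e` with `λ len e` smaller than every detour lies in every `λ`-spanner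
(`IsSpanner.mem_of_lt`). The expected number of detours shorter than `(1 - η) L` is bounded by a
union bound over trails, with a Chernoff bound for the length of each. Weighting an edge by its
probability times the Laplace transform of its length gives a geometric series over trail lengths
(`EdgeIndep.measure_detour_le`). With a tilt slightly above the maximum expected degree the total is
at most about `n ^ (-η/2) log n`. Hence almost all edges of length at most `(1 - 2 η) L / λ` are
forced (`IsModel.tendsto_card_isSpanner_lt`). This gives almost `n log n / (2 λ)` edges, which is
half of (a) and contains (b).

Upper bound in (a). The edges not longer than their detours form a `1`-spanner
(`isSpanner_tightEdges`). Such an edge is as long as the distance between its ends, so its length is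
at most the diameter, which is `O(L)`. An edge is independent of its detours, so the number of tight
edges longer than `(1 + 3 ε) L` is controlled by how many potential neighbours of a vertex are at
distance at least `(1 + 3 ε) L`. By memorylessness, a ball growing from a vertex through sets with
at least `r k` boundary edges at size `k` has waiting times dominated by independent exponentials of
rates `r k` (`measure_card_ball_lt_le`). It thus remains to find rates with `∑ 1 / r k ≤ (1 + ε) L`,
valid until almost all neighbours are reached (`IsExpanding`).

Fixed graphs and `G_{n,p}` are handled together by `EdgeIndep`; a fixed graph is a point mass with
edge probabilities `0` and `1`. The expansion comes from Chernoff bounds on all cuts for `G_{n,p}`,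
and from degrees together with the edge condition for `𝒢(d)`. For `d n`-regular graphs with `d >
1/2` there is a dichotomy: either all nearly balanced cuts are dense, or a sparse cut splits the
graph into two parts, each of which expands from within and contains almost all neighbours of its
vertices. -/

instance : IsProbabilityMeasure (expMeasure 1) := isProbabilityMeasure_expMeasure one_pos

/-! ### The exponential distribution -/

theorem expMeasure_one_Iic (x : ℝ) :
    expMeasure 1 (Set.Iic x) = ENNReal.ofReal (1 - Real.exp (-max x 0)) := by
  have h := cdf_expMeasure_eq one_pos x
  rw [← ofReal_cdf, h]
  split_ifs with h0
  · simp [max_eq_left h0]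
  · simp [max_eq_right (not_le.1 h0).le]

instance : NullSingletonClass (expMeasure 1) :=
  ⟨fun x => withDensity_absolutelyContinuous volume (gammaPDF 1 1) (measure_singleton x)⟩

theorem expMeasure_one_Ioi (x : ℝ) :
    expMeasure 1 (Set.Ioi x) = ENNReal.ofReal (Real.exp (-max x 0)) := by
  rw [← Set.compl_Iic, prob_compl_eq_one_sub measurableSet_Iic, expMeasure_one_Iic,
    ← ENNReal.ofReal_one, ← ENNReal.ofReal_sub]
  · congr 1; ring
  · simp

theorem expMeasure_one_Ici (x : ℝ) :
    expMeasure 1 (Set.Ici x) = ENNReal.ofReal (Real.exp (-max x 0)) := by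
  rw [← Ioi_ae_eq_Ici.measure_eq, expMeasure_one_Ioi]

theorem expMeasure_one_Ioc {a b : ℝ} (ha : 0 ≤ a) (hab : a ≤ b) :
    expMeasure 1 (Set.Ioc a b) = ENNReal.ofReal (Real.exp (-a) - Real.exp (-b)) := by
  rw [← Set.Ioi_sdiff_Ioi, measure_sdiff (Set.Ioi_subset_Ioi hab)
    measurableSet_Ioi.nullMeasurableSet (measure_ne_top _ _), expMeasure_one_Ioi,
    expMeasure_one_Ioi, max_eq_left ha, max_eq_left (ha.trans hab),
    ENNReal.ofReal_sub _ (Real.exp_nonneg _)]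

/-- The exponential distribution is memoryless. -/
theorem expMeasure_one_restrict_Ici {t : ℝ} (ht : 0 ≤ t) :
    (expMeasure 1).restrict (Set.Ici t) =
      ENNReal.ofReal (Real.exp (-t)) • (expMeasure 1).map (· + t) := by
  refine Measure.ext_of_Ici _ _ fun a => ?_
  rw [Measure.restrict_apply measurableSet_Ici, Measure.smul_apply,
    Measure.map_apply (by fun_prop) measurableSet_Ici, Set.Ici_inter_Ici]
  have : (fun x : ℝ => x + t) ⁻¹' Set.Ici a = Set.Ici (a - t) := by
    ext x; simp
  rw [this, expMeasure_one_Ici, expMeasure_one_Ici, smul_eq_mul,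
    ← ENNReal.ofReal_mul (Real.exp_nonneg _), ← Real.exp_add]
  congr 2
  rcases le_total a t with h | h
  · simp [ht, h]
  · simp [ht.trans h, h]
    ring

theorem expMeasure_one_ae_nonneg : ∀ᵐ x ∂expMeasure 1, 0 ≤ x := by
  rw [ae_iff]
  have : {x : ℝ | ¬ 0 ≤ x} = Set.Iio 0 := by ext; simp
  rw [this, Iio_ae_eq_Iic.measure_eq, expMeasure_one_Iic]
  simp

theorem lintegral_expMeasure_one {f : ℝ → ℝ≥0∞} (hf : Measurable f) :
    ∫⁻ x, f x ∂expMeasure 1 = ∫⁻ x in Set.Ioi 0, ENNReal.ofReal (Real.exp (-x)) * f x := by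
  have h1 : expMeasure 1 = volume.withDensity (exponentialPDF 1) := rfl
  have hm : Measurable (exponentialPDF 1) :=
    (measurable_exponentialPDFReal 1).ennreal_ofReal
  rw [h1, lintegral_withDensity_eq_lintegral_mul _ hm hf, ← setLIntegral_univ,
    ← Set.Iic_union_Ioi (a := (0 : ℝ)), lintegral_union measurableSet_Ioi
    (Set.Iic_disjoint_Ioi le_rfl), ← setLIntegral_congr Iio_ae_eq_Iic]
  rw [setLIntegral_eq_zero measurableSet_Iio, zero_add]
  · refine setLIntegral_congr_fun measurableSet_Ioi fun x hx => ?_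
    simp [exponentialPDF_of_nonneg (r := 1) (le_of_lt hx)]
  · intro x hx
    simp [exponentialPDF_of_neg (r := 1) hx]

theorem setLIntegral_exp_neg_mul {c t : ℝ} (hc : 0 < c) (ht : 0 ≤ t) :
    ∫⁻ x in Set.Ioc 0 t, ENNReal.ofReal (Real.exp (-(c * x))) =
      ENNReal.ofReal ((1 - Real.exp (-(c * t))) / c) := by
  rw [← ofReal_integral_eq_lintegral_ofReal (exp_neg_integrableOn_Ioc hc)
    (Eventually.of_forall fun _ => Real.exp_nonneg _), ← intervalIntegral.integral_of_le ht]
  congr 1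
  rw [intervalIntegral.integral_eq_sub_of_hasDerivAt (f := fun a => -Real.exp (-(c * a)) / c)]
  · simp; ring
  · intro x _
    convert! (hasDerivAt_neg_exp_mul_exp (r := c) (x := x)).div_const c using 1
    field_simp
  · exact (by fun_prop : Continuous fun x => Real.exp (-(c * x))).intervalIntegrable _ _

theorem lintegral_exp_neg_mul_Ioi {c : ℝ} (hc : 0 < c) :
    ∫⁻ x in Set.Ioi 0, ENNReal.ofReal (Real.exp (-(c * x))) = ENNReal.ofReal (1 / c) := by
  have hi : IntegrableOn (fun x => Real.exp (-(c * x))) (Set.Ioi 0) := by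
    simpa only [neg_mul] using exp_neg_integrableOn_Ioi 0 hc
  rw [← ofReal_integral_eq_lintegral_ofReal hi
    (Eventually.of_forall fun _ => Real.exp_nonneg _)]
  congr 1
  simpa [neg_mul] using integral_exp_mul_Ioi (a := -c) (by linarith) 0

/-- The Laplace transform of the exponential distribution. -/
theorem laplace_expMeasure_one {s : ℝ} (hs : 0 ≤ s) :
    ∫⁻ x, ENNReal.ofReal (Real.exp (-(s * max x 0))) ∂expMeasure 1 =
      ENNReal.ofReal (1 / (1 + s)) := by
  rw [lintegral_expMeasure_one (by fun_prop), ← lintegral_exp_neg_mul_Ioi (c := 1 + s)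
    (by linarith)]
  refine setLIntegral_congr_fun measurableSet_Ioi fun x hx => ?_
  rw [Set.mem_Ioi] at hx
  rw [← ENNReal.ofReal_mul (Real.exp_nonneg _), ← Real.exp_add, max_eq_left hx.le]
  congr 2; ring

/-! ### Product measures: resampling one coordinate, memorylessness in several -/

section Pi
variable {ι : Type*} [Fintype ι] [DecidableEq ι]

/-- Resampling one coordinate of a product measure does not change the measure. -/
theorem map_update_prod_pi {α : Type*} [MeasurableSpace α] (μ : Measure α)
    [IsProbabilityMeasure μ] (e : ι) :
    (μ.prod (Measure.pi fun _ : ι => μ)).map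
      (fun p : α × (ι → α) => Function.update p.2 e p.1) = Measure.pi fun _ : ι => μ := by
  have hm : Measurable fun p : α × (ι → α) => Function.update p.2 e p.1 := by
    rw [measurable_pi_iff]
    intro i
    by_cases h : i = e
    · subst h; simpa using measurable_fst
    · simp only [Function.update_of_ne h]; fun_prop
  refine (Measure.pi_eq fun s hs => ?_).symm
  rw [Measure.map_apply hm (MeasurableSet.univ_pi hs)]
  have : (fun p : α × (ι → α) => Function.update p.2 e p.1) ⁻¹' (Set.univ.pi s) =
      s e ×ˢ (Set.univ.pi (Function.update s e Set.univ)) := by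
    ext ⟨a, f⟩
    simp only [Set.mem_preimage, Set.mem_pi, Set.mem_univ, true_imp_iff, Set.mem_prod]
    constructor
    · intro h
      refine ⟨by simpa using h e, fun i => ?_⟩
      by_cases hi : i = e
      · subst hi; simp
      · simpa [hi] using h i
    · rintro ⟨h1, h2⟩ i
      by_cases hi : i = e
      · subst hi; simpa using h1
      · simpa [hi] using h2 i
  rw [this, Measure.prod_prod, Measure.pi_pi, ← Finset.mul_prod_erase _ _ (Finset.mem_univ e),
    ← Finset.mul_prod_erase _ (fun i => μ (s i)) (Finset.mem_univ e)]
  simp only [Function.update_self, measure_univ, one_mul]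
  congr 1
  refine Finset.prod_congr rfl fun i hi => ?_
  rw [Function.update_of_ne (Finset.ne_of_mem_erase hi)]

theorem measurable_update_pair {α : Type*} [MeasurableSpace α] (e : ι) :
    Measurable fun p : α × (ι → α) => Function.update p.2 e p.1 := by
  rw [measurable_pi_iff]
  intro i
  by_cases h : i = e
  · subst h; simpa using measurable_fst
  · simp only [Function.update_of_ne h]; fun_prop

/-- Fubini's theorem with one coordinate singled out. -/
theorem pi_apply_eq_lintegral_update {α : Type*} [MeasurableSpace α] (μ : Measure α)
    [IsProbabilityMeasure μ] (e : ι) {B : Set (ι → α)} (hB : MeasurableSet B) :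
    Measure.pi (fun _ : ι => μ) B =
      ∫⁻ a, Measure.pi (fun _ : ι => μ) {f | Function.update f e a ∈ B} ∂μ := by
  conv_lhs => rw [← map_update_prod_pi μ e]
  rw [Measure.map_apply (measurable_update_pair e) hB,
    Measure.prod_apply (measurable_update_pair e hB)]
  rfl

/-- A coordinate is independent of an event that does not depend on it. -/
theorem pi_inter_eq_mul {α : Type*} [MeasurableSpace α] (μ : Measure α)
    [IsProbabilityMeasure μ] (e : ι) {A : Set α} (hA : MeasurableSet A) {B : Set (ι → α)}
    (hB : MeasurableSet B) (hinv : ∀ f a, Function.update f e a ∈ B ↔ f ∈ B) :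
    Measure.pi (fun _ : ι => μ) {f | f e ∈ A ∧ f ∈ B} = μ A * Measure.pi (fun _ : ι => μ) B := by
  have hm : MeasurableSet {f : ι → α | f e ∈ A ∧ f ∈ B} :=
    ((measurable_pi_apply e) hA).inter hB
  rw [pi_apply_eq_lintegral_update μ e hm]
  simp only [Set.mem_ofPred_eq, Function.update_self, hinv]
  have : ∀ a, Measure.pi (fun _ : ι => μ) {f | a ∈ A ∧ f ∈ B} =
      A.indicator (fun _ => Measure.pi (fun _ : ι => μ) B) a := by
    intro a
    by_cases h : a ∈ A <;> simp [h]
  simp_rw [this]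
  rw [lintegral_indicator_const hA, mul_comm]

/-- The memoryless property for several coordinates at once. -/
theorem pi_expMeasure_one_shift {t : ℝ} (ht : 0 ≤ t) (F : Finset ι) {B : Set (ι → ℝ)}
    (hB : MeasurableSet B) :
    Measure.pi (fun _ : ι => expMeasure 1) {f | (∀ i ∈ F, t ≤ f i) ∧ f ∈ B} =
      ENNReal.ofReal (Real.exp (-(F.card * t))) *
        Measure.pi (fun _ : ι => expMeasure 1)
          {f | (fun i => if i ∈ F then f i + t else f i) ∈ B} := by
  let s : ι → Set ℝ := fun i => if i ∈ F then Set.Ici t else Set.univ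
  let φ : ι → ℝ → ℝ := fun i x => if i ∈ F then x + t else x
  have hφ : ∀ i, Measurable (φ i) := by
    intro i
    by_cases h : i ∈ F <;> simp only [φ, h, if_true, if_false] <;> fun_prop
  have hset : {f : ι → ℝ | (∀ i ∈ F, t ≤ f i) ∧ f ∈ B} = B ∩ Set.univ.pi s := by
    ext f
    simp only [Set.mem_ofPred_eq, Set.mem_inter_iff, Set.mem_pi, Set.mem_univ, true_imp_iff, s]
    rw [and_comm]
    refine and_congr_right fun _ => forall_congr' fun i => ?_
    by_cases h : i ∈ F <;> simp [h]
  have hres : ∀ i, (expMeasure 1).restrict (s i) =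
      (if i ∈ F then ENNReal.ofReal (Real.exp (-t)) else 1) • (expMeasure 1).map (φ i) := by
    intro i
    by_cases h : i ∈ F
    · simp only [s, φ, h, if_true]
      exact expMeasure_one_restrict_Ici ht
    · simp [s, φ, h]
  -- Restricting a product measure to a box restricts each factor, and by memorylessness each
  -- restricted factor is a multiple of a translate.
  have hpi : (Measure.pi fun i : ι => (expMeasure 1).restrict (s i)) =
      ENNReal.ofReal (Real.exp (-(F.card * t))) •
        Measure.pi (fun i : ι => (expMeasure 1).map (φ i)) := by
    have : ∀ i, IsProbabilityMeasure ((expMeasure 1).map (φ i)) := fun i =>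
      Measure.isProbabilityMeasure_map (hφ i).aemeasurable
    refine Measure.pi_eq fun u hu => ?_
    simp_rw [hres, Measure.smul_apply, smul_eq_mul, Measure.pi_pi]
    rw [Finset.prod_mul_distrib]
    congr 1
    rw [Finset.prod_ite_mem, Finset.univ_inter, Finset.prod_const,
      ← ENNReal.ofReal_pow (Real.exp_nonneg _), ← Real.exp_nat_mul]
    congr 2; ring
  rw [hset, ← Measure.restrict_apply hB, Measure.restrict_pi_pi, hpi, Measure.smul_apply,
    smul_eq_mul]
  have : ∀ i, IsProbabilityMeasure ((expMeasure 1).map (φ i)) := fun i =>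
      Measure.isProbabilityMeasure_map (hφ i).aemeasurable
  rw [← Measure.pi_map_pi (fun i => (hφ i).aemeasurable)]
  have hmeas : Measurable fun (x : ι → ℝ) i => φ i (x i) :=
    measurable_pi_iff.2 fun i => (hφ i).comp (measurable_pi_apply i)
  rw [Measure.map_apply hmeas hB]
  have : (fun (x : ι → ℝ) i => φ i (x i)) ⁻¹' B =
      {f | (fun i => if i ∈ F then f i + t else f i) ∈ B} := by
    ext f
    rfl
  rw [this]

/-- Independence for products of functions of one coordinate each. Values in `[0, 1]` make
everything integrable, so the identity passes through the Bochner integral. -/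
theorem lintegral_prod_pi {μ : Measure ℝ} [IsProbabilityMeasure μ] (g : ι → ℝ → ℝ)
    (hg : ∀ i x, 0 ≤ g i x) (hg1 : ∀ i x, g i x ≤ 1) (hm : ∀ i, Measurable (g i)) :
    ∫⁻ f, ENNReal.ofReal (∏ i, g i (f i)) ∂(Measure.pi fun _ : ι => μ) =
      ∏ i, ∫⁻ x, ENNReal.ofReal (g i x) ∂μ := by
  have hint : ∀ i, Integrable (g i) μ := fun i =>
    Integrable.of_bound (hm i).aestronglyMeasurable 1 (Eventually.of_forall fun x => by
      rw [Real.norm_eq_abs, abs_of_nonneg (hg i x)]; exact hg1 i x)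
  rw [← ofReal_integral_eq_lintegral_ofReal (Integrable.fintype_prod hint)
    (Eventually.of_forall fun f => Finset.prod_nonneg fun i _ => hg i _),
    integral_fintype_prod_eq_prod (𝕜 := ℝ),
    ENNReal.ofReal_prod_of_nonneg fun i _ => integral_nonneg (hg i)]
  refine Finset.prod_congr rfl fun i _ => ?_
  rw [ofReal_integral_eq_lintegral_ofReal (hint i) (Eventually.of_forall (hg i))]

end Pi

/-! ### Shortest distances, spanners and detours -/

section Distances
variable {V : Type*} {G H : SimpleGraph V} {len : Sym2 V → ℝ}

@[simp] theorem walkLength_nil (len : Sym2 V → ℝ) (u : V) :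
    walkLength len (SimpleGraph.Walk.nil : G.Walk u u) = 0 := rfl

@[simp] theorem walkLength_cons (len : Sym2 V → ℝ) {u v w : V} (h : G.Adj u v) (p : G.Walk v w) :
    walkLength len (SimpleGraph.Walk.cons h p) = ENNReal.ofReal (len s(u, v)) + walkLength len p := by
  simp [walkLength]

theorem walkLength_append (len : Sym2 V → ℝ) {u v w : V} (p : G.Walk u v) (q : G.Walk v w) :
    walkLength len (p.append q) = walkLength len p + walkLength len q := by
  simp [walkLength]

theorem walkLength_reverse (len : Sym2 V → ℝ) {u v : V} (p : G.Walk u v) :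
    walkLength len p.reverse = walkLength len p := by
  simp [walkLength, List.sum_reverse]

theorem walkLength_mapLe (len : Sym2 V → ℝ) (h : G ≤ H) {u v : V} (p : G.Walk u v) :
    walkLength len (p.mapLe h) = walkLength len p := by
  simp [walkLength]

theorem walkLength_bypass_le [DecidableEq V] (len : Sym2 V → ℝ) {u v : V} (p : G.Walk u v) :
    walkLength len p.bypass ≤ walkLength len p :=
  (p.edges_bypass_sublist_edges.map _).sum_le_sum fun _ _ => zero_le

theorem shortestDist_le_walkLength {u v : V} (p : G.Walk u v) :
    shortestDist G len u v ≤ walkLength len p := iInf_le _ p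

theorem shortestDist_self (u : V) : shortestDist G len u u = 0 :=
  le_antisymm (shortestDist_le_walkLength SimpleGraph.Walk.nil) zero_le

theorem shortestDist_le_of_adj {u v : V} (h : G.Adj u v) :
    shortestDist G len u v ≤ ENNReal.ofReal (len s(u, v)) := by
  simpa using shortestDist_le_walkLength (len := len) (SimpleGraph.Walk.cons h .nil)

theorem shortestDist_comm (G : SimpleGraph V) (len : Sym2 V → ℝ) (u v : V) :
    shortestDist G len u v = shortestDist G len v u := by
  have : ∀ u v : V, shortestDist G len u v ≤ shortestDist G len v u := fun u v =>
    le_iInf fun p => (shortestDist_le_walkLength p.reverse).trans (walkLength_reverse len p).le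
  exact le_antisymm (this u v) (this v u)

theorem shortestDist_triangle (G : SimpleGraph V) (len : Sym2 V → ℝ) (u v w : V) :
    shortestDist G len u w ≤ shortestDist G len u v + shortestDist G len v w := by
  unfold shortestDist
  rw [ENNReal.iInf_add]
  refine le_iInf fun p => ?_
  rw [ENNReal.add_iInf]
  exact le_iInf fun q => (shortestDist_le_walkLength (p.append q)).trans
    (walkLength_append len p q).le

theorem shortestDist_mono (h : G ≤ H) (u v : V) :
    shortestDist H len u v ≤ shortestDist G len u v :=
  le_iInf fun p => (shortestDist_le_walkLength (p.mapLe h)).trans (walkLength_mapLe len h p).le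

/-- The distance between the two ends of `e`. -/
noncomputable def edgeDist (G : SimpleGraph V) (len : Sym2 V → ℝ) (e : Sym2 V) : ℝ≥0∞ :=
  Sym2.lift ⟨shortestDist G len, shortestDist_comm G len⟩ e

@[simp] theorem edgeDist_mk (u v : V) : edgeDist G len s(u, v) = shortestDist G len u v := rfl

/-- An edge that is shorter than every detour lies in every spanner. -/
theorem IsSpanner.mem_of_lt {t : ℝ} {S : Finset (Sym2 V)} (hS : IsSpanner G len t S)
    {e : Sym2 V} (he : e ∈ G.edgeSet)
    (hlt : ENNReal.ofReal t * ENNReal.ofReal (len e) < edgeDist (G.deleteEdges {e}) len e) :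
    e ∈ S := by
  by_contra hne
  induction e using Sym2.ind with
  | _ u v =>
    refine hlt.not_ge ?_
    have hle : SimpleGraph.fromEdgeSet (S : Set (Sym2 V)) ≤ G.deleteEdges {s(u, v)} := by
      intro a b hab
      rw [SimpleGraph.fromEdgeSet_adj] at hab
      rw [SimpleGraph.deleteEdges_adj]
      refine ⟨hS.1 hab.1, ?_⟩
      rw [Set.mem_singleton_iff]
      rintro h
      exact hne (h ▸ hab.1)
    rw [edgeDist_mk]
    refine (shortestDist_mono hle u v).trans ((hS.2 u v).trans ?_)
    gcongr
    exact shortestDist_le_of_adj he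

open Classical in
/-- The edges that are not longer than any detour. -/
noncomputable def tightEdges [Fintype V] (G : SimpleGraph V) (len : Sym2 V → ℝ) :
    Finset (Sym2 V) :=
  {e ∈ G.edgeFinset | ENNReal.ofReal (len e) ≤ edgeDist (G.deleteEdges {e}) len e}

theorem shortestDist_le_of_forall_adj {G H : SimpleGraph V}
    {len : Sym2 V → ℝ} {u v : V} (p : G.Walk u v)
    (h : ∀ x y, s(x, y) ∈ p.edges → shortestDist H len x y ≤ ENNReal.ofReal (len s(x, y))) :
    shortestDist H len u v ≤ walkLength len p := by
  induction p with
  | nil => simp [shortestDist_self]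
  | cons hadj p ih =>
    rw [walkLength_cons]
    refine (shortestDist_triangle H len _ _ _).trans (add_le_add (h _ _ (by simp)) (ih ?_))
    intro x y hxy
    exact h x y (by simp [hxy])

theorem le_walkLength_of_mem_edges {u v : V} (p : G.Walk u v) {e : Sym2 V} (he : e ∈ p.edges) :
    ENNReal.ofReal (len e) ≤ walkLength len p := by
  unfold walkLength
  exact List.single_le_sum (fun _ _ => zero_le) _ (List.mem_map_of_mem he)

/-- Induction on the number of edges shorter than a given edge. If an edge is not tight, it has a
detour of smaller total length, so all edges of the detour are strictly shorter. By induction each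
of them can be replaced by a path of tight edges that is no longer. -/
theorem isSpanner_tightEdges [Fintype V] (G : SimpleGraph V) (len : Sym2 V → ℝ) :
    IsSpanner G len 1 (tightEdges G len) := by
  classical
  have hmem : ∀ {e}, e ∈ tightEdges G len ↔ e ∈ G.edgeSet ∧
      ENNReal.ofReal (len e) ≤ edgeDist (G.deleteEdges {e}) len e := by
    intro e; simp [tightEdges]
  set T := SimpleGraph.fromEdgeSet (tightEdges G len : Set (Sym2 V)) with hT
  have key : ∀ k : ℕ, ∀ x y, G.Adj x y → (G.edgeFinset.filter fun f =>
      ENNReal.ofReal (len f) < ENNReal.ofReal (len s(x, y))).card = k →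
      shortestDist T len x y ≤ ENNReal.ofReal (len s(x, y)) := by
    intro k
    induction k using Nat.strong_induction_on with
    | _ k ih =>
      intro x y hxy hk
      by_cases h : s(x, y) ∈ tightEdges G len
      · refine shortestDist_le_of_adj ?_
        rw [hT, SimpleGraph.fromEdgeSet_adj]
        exact ⟨h, hxy.ne⟩
      · rw [hmem, not_and] at h
        have hlt := not_le.1 (h hxy)
        rw [edgeDist_mk, shortestDist, iInf_lt_iff] at hlt
        obtain ⟨p, hp⟩ := hlt
        refine le_trans ?_ hp.le
        refine shortestDist_le_of_forall_adj p fun a b hab => ?_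
        have hlen := (le_walkLength_of_mem_edges (len := len) p hab).trans_lt hp
        have hadj : G.Adj a b :=
          (SimpleGraph.deleteEdges_le _) (p.adj_of_mem_edges hab)
        refine ih _ ?_ a b hadj rfl
        rw [← hk]
        refine Finset.card_lt_card ?_
        rw [Finset.ssubset_iff_of_subset]
        · exact ⟨s(a, b), by simpa using ⟨hadj, hlen⟩, by simp⟩
        · intro f
          simp only [Finset.mem_filter]
          exact fun hf => ⟨hf.1, hf.2.trans hlen⟩
  refine ⟨fun e he => (hmem.1 he).1, fun u v => ?_⟩
  rw [ENNReal.ofReal_one, one_mul]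
  exact le_iInf fun p => shortestDist_le_of_forall_adj p fun x y hxy =>
    key _ x y (p.adj_of_mem_edges hxy) rfl

theorem minSpannerSize_le [Fintype V] (G : SimpleGraph V) (len : Sym2 V → ℝ) :
    minSpannerSize G len 1 ≤ (tightEdges G len).card :=
  Nat.sInf_le ⟨_, isSpanner_tightEdges G len, rfl⟩

/-- Makes the infimum defining `shortestDist` a countable one, hence a measurable function of the
lengths. -/
instance [Finite V] (G : SimpleGraph V) (u v : V) : Countable (G.Walk u v) :=
  Function.Injective.countable (f := fun p : G.Walk u v => p.support)
    fun _ _ h => SimpleGraph.Walk.ext_support h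

theorem measurable_walkLength {u v : V} (p : G.Walk u v) :
    Measurable fun len : Sym2 V → ℝ => walkLength len p := by
  induction p with
  | nil => simp only [walkLength_nil]; fun_prop
  | cons h p ih => simp only [walkLength_cons]; fun_prop

theorem measurable_shortestDist [Finite V] (G : SimpleGraph V) (u v : V) :
    Measurable fun len : Sym2 V → ℝ => shortestDist G len u v :=
  Measurable.iInf fun p => measurable_walkLength p

theorem measurable_edgeDist [Finite V] (G : SimpleGraph V) (e : Sym2 V) :
    Measurable fun len : Sym2 V → ℝ => edgeDist G len e := by
  induction e using Sym2.ind with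
  | _ u v => exact measurable_shortestDist G u v

/-- The length of `e` does not matter for the distances in a graph without the edge `e`. -/
theorem edgeDist_deleteEdges_update [DecidableEq V] (G : SimpleGraph V) (len : Sym2 V → ℝ)
    (e f : Sym2 V) (a : ℝ) :
    edgeDist (G.deleteEdges {e}) (Function.update len e a) f =
      edgeDist (G.deleteEdges {e}) len f := by
  induction f using Sym2.ind with
  | _ u v =>
    refine iInf_congr fun p => ?_
    unfold walkLength
    congr 1
    refine List.map_congr_left fun g hg => ?_
    have := p.edges_subset_edgeSet hg
    rw [SimpleGraph.edgeSet_deleteEdges] at this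
    rw [Function.update_of_ne this.2]

/-- The distance between the ends of `e` is attained by `e` or by a detour. -/
theorem min_edgeDist_deleteEdges_le [DecidableEq V] (G : SimpleGraph V) (len : Sym2 V → ℝ)
    (e : Sym2 V) :
    min (ENNReal.ofReal (len e)) (edgeDist (G.deleteEdges {e}) len e) ≤ edgeDist G len e := by
  induction e using Sym2.ind with
  | _ u v =>
    refine le_iInf fun p => ?_
    by_cases he : s(u, v) ∈ p.edges
    · exact (min_le_left _ _).trans (le_walkLength_of_mem_edges p he)
    · refine (min_le_right _ _).trans ?_
      have hp : ∀ f ∈ p.edges, f ∈ (G.deleteEdges {s(u, v)}).edgeSet := by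
        intro f hf
        rw [SimpleGraph.edgeSet_deleteEdges]
        exact ⟨p.edges_subset_edgeSet hf, fun h => he (h ▸ hf)⟩
      refine (shortestDist_le_walkLength (p.transfer _ hp)).trans (le_of_eq ?_)
      simp [walkLength]

end Distances

/-! ### Exploration of balls and a Chernoff bound for their growth -/

section Growth
variable {V : Type*} [Fintype V]

open Classical in
/-- The edges of `H` with exactly one end in `S`. -/
noncomputable def edgeBoundary (H : SimpleGraph V) (S : Finset V) : Finset (Sym2 V) :=
  (H.interedges S Sᶜ).image fun x => s(x.1, x.2)

theorem mem_edgeBoundary {H : SimpleGraph V} {S : Finset V} {e : Sym2 V} :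
    e ∈ edgeBoundary H S ↔ ∃ x ∈ S, ∃ y ∉ S, H.Adj x y ∧ s(x, y) = e := by
  classical
  simp only [edgeBoundary, Finset.mem_image, Prod.exists, SimpleGraph.mem_interedges_iff,
    Finset.mem_compl]
  constructor
  · rintro ⟨x, y, ⟨hx, hy, h⟩, rfl⟩; exact ⟨x, hx, y, hy, h, rfl⟩
  · rintro ⟨x, hx, y, hy, h, rfl⟩; exact ⟨x, y, ⟨hx, hy, h⟩, rfl⟩

open Classical in
theorem card_edgeBoundary (H : SimpleGraph V) (S : Finset V) :
    (edgeBoundary H S).card = (H.interedges S Sᶜ).card := by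
  refine Finset.card_image_of_injOn ?_
  rintro ⟨x, y⟩ h ⟨x', y'⟩ h' heq
  rw [Finset.mem_coe, SimpleGraph.mem_interedges_iff, Finset.mem_compl] at h h'
  simp only [Sym2.eq_iff] at heq
  rcases heq with ⟨rfl, rfl⟩ | ⟨h1, h2⟩
  · rfl
  · dsimp only at h h'
    subst h1
    exact absurd h.1 h'.2.1

open Classical in
/-- The vertices at distance at most `t` from `S`. -/
noncomputable def ball (H : SimpleGraph V) (len : Sym2 V → ℝ) (S : Finset V) (t : ℝ) : Finset V :=
  {v | ∃ u ∈ S, ∃ p : H.Walk v u, walkLength len p ≤ ENNReal.ofReal t}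

theorem mem_ball {H : SimpleGraph V} {len : Sym2 V → ℝ} {S : Finset V} {t : ℝ} {v : V} :
    v ∈ ball H len S t ↔ ∃ u ∈ S, ∃ p : H.Walk v u, walkLength len p ≤ ENNReal.ofReal t := by
  simp [ball]

theorem subset_ball (H : SimpleGraph V) (len : Sym2 V → ℝ) (S : Finset V) (t : ℝ) :
    S ⊆ ball H len S t := fun v hv => mem_ball.2 ⟨v, hv, .nil, by simp⟩

theorem measurableSet_card_ball_lt (H : SimpleGraph V) (S : Finset V) (t : ℝ) (m : ℕ) :
    MeasurableSet {len : Sym2 V → ℝ | (ball H len S t).card < m} := by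
  classical
  have hm : Measurable fun len : Sym2 V → ℝ => fun v : V => (v ∈ ball H len S t : Prop) := by
    refine measurable_pi_iff.2 fun v => measurable_to_prop ?_
    have : (fun len : Sym2 V → ℝ => (v ∈ ball H len S t : Prop)) ⁻¹' {True} =
        ⋃ u ∈ S, ⋃ p : H.Walk v u, {len | walkLength len p ≤ ENNReal.ofReal t} := by
      ext len; simp [mem_ball]
    rw [this]
    exact Finset.measurableSet_biUnion _ fun u _ => MeasurableSet.iUnion fun p =>
      measurableSet_le (measurable_walkLength p) measurable_const
  have : {len : Sym2 V → ℝ | (ball H len S t).card < m} =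
      (fun len : Sym2 V → ℝ => fun v : V => (v ∈ ball H len S t : Prop)) ⁻¹'
        {P | (Finset.univ.filter P).card < m} := by
    ext len; simp
  rw [this]
  -- There are only finitely many predicates on `V`, so every set of them is measurable.
  exact hm (Set.toFinite _).measurableSet

/-- One step of the exploration of a ball: after the time `a` at which the first boundary edge
`s(x, y)` is crossed, the exploration restarts from `insert y S` with the residual lengths. -/
theorem ball_insert_subset_ball [DecidableEq V] {H : SimpleGraph V} {S : Finset V} {x y : V}
    (hx : x ∈ S) (hxy : H.Adj x y) {a t : ℝ} (ha : 0 ≤ a) (hat : a ≤ t) (len : Sym2 V → ℝ) :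
    ball H len (insert y S) (t - a) ⊆ ball H (Function.update (fun f =>
      if f ∈ (edgeBoundary H S).erase s(x, y) then len f + a else len f) s(x, y) a) S t := by
  set len' := Function.update (fun f =>
      if f ∈ (edgeBoundary H S).erase s(x, y) then len f + a else len f) s(x, y) a with hlen'
  -- Stop the walk on its first arrival in `insert y S`. If it arrives at `y`, the edge back to `x`
  -- costs `a`; if it arrives in `S`, its last edge is a boundary edge other than `s(x, y)`, whose
  -- length was raised by `a`. Earlier edges avoid `S` and keep their lengths, so the surcharge is
  -- paid at most once.
  have key : ∀ {v u : V} (p : H.Walk v u), u ∈ insert y S → ∃ u' ∈ S, ∃ q : H.Walk v u',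
      walkLength len' q ≤ ENNReal.ofReal a + walkLength len p := by
    have hbase : ∀ v ∈ insert y S, ∃ u' ∈ S, ∃ q : H.Walk v u',
        walkLength len' q ≤ ENNReal.ofReal a := by
      intro v hv
      rw [Finset.mem_insert] at hv
      rcases hv with rfl | hv
      · refine ⟨x, hx, .cons hxy.symm .nil, ?_⟩
        rw [walkLength_cons, Sym2.eq_swap, hlen', Function.update_self]
        simp
      · exact ⟨v, hv, .nil, by simp⟩
    intro v u p hu
    induction p with
    | nil => simpa using hbase _ hu
    | @cons v w u h p ih =>
      by_cases hv : v ∈ insert y S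
      · obtain ⟨u', hu', q, hq⟩ := hbase v hv
        exact ⟨u', hu', q, hq.trans le_self_add⟩
      · rw [Finset.mem_insert, not_or] at hv
        by_cases hw : w ∈ S
        · refine ⟨w, hw, .cons h .nil, ?_⟩
          have hne : s(v, w) ≠ s(x, y) := by
            intro heq
            rw [Sym2.eq_iff] at heq
            rcases heq with ⟨rfl, -⟩ | ⟨rfl, -⟩
            · exact hv.2 hx
            · exact hv.1 rfl
          have hF : s(v, w) ∈ (edgeBoundary H S).erase s(x, y) :=
            Finset.mem_erase.2 ⟨hne, mem_edgeBoundary.2 ⟨w, hw, v, hv.2, h.symm, Sym2.eq_swap⟩⟩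
          rw [walkLength_cons, walkLength_cons, hlen', Function.update_of_ne hne, if_pos hF,
            walkLength_nil, add_zero, add_comm (ENNReal.ofReal a), add_right_comm]
          exact (ENNReal.ofReal_add_le).trans le_self_add
        · obtain ⟨u', hu', q, hq⟩ := ih hu
          refine ⟨u', hu', .cons h q, ?_⟩
          have hnb : s(v, w) ∉ edgeBoundary H S := by
            rw [mem_edgeBoundary]
            rintro ⟨x', hx', y', -, -, heq⟩
            rw [Sym2.eq_iff] at heq
            rcases heq with ⟨rfl, -⟩ | ⟨rfl, -⟩
            · exact hv.2 hx'
            · exact hw hx'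
          have hne : s(v, w) ≠ s(x, y) := by
            intro heq
            rw [Sym2.eq_iff] at heq
            rcases heq with ⟨rfl, -⟩ | ⟨rfl, -⟩
            · exact hv.2 hx
            · exact hv.1 rfl
          rw [walkLength_cons, walkLength_cons, hlen', Function.update_of_ne hne,
            if_neg (fun h => hnb (Finset.mem_of_mem_erase h)), add_left_comm]
          gcongr
  intro v hv
  obtain ⟨u, hu, p, hp⟩ := mem_ball.1 hv
  obtain ⟨u', hu', q, hq⟩ := key p hu
  refine mem_ball.2 ⟨u', hu', q, hq.trans ?_⟩
  refine (add_le_add_right hp _).trans_eq ?_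
  rw [← ENNReal.ofReal_add ha (by linarith)]
  congr 1; ring

/-- The inductive step of the Chernoff bound. With `R` boundary edges the first crossing is at rate
`R`: the first summand is the probability of no crossing before `t`, the second is `∫ R exp(-R a)
exp(-s (t - a)) Q da` over `[0, t]`. With `X = exp(-(R - s) t)` and `Y = R / (R - s) * Q ≥ 1`, the
sum is `exp(-s t) (X + Y (1 - X))`, which is at most `exp(-s t) Y`, and `R / (R - s)` decreases in
`R`. -/
theorem exp_add_mul_div_le {R r s t Q : ℝ} (hs : 0 < s) (hr : s < r) (hR : r ≤ R)
    (hQ : 1 ≤ Q) :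
    Real.exp (-(R * t)) + R * (Real.exp (-(s * t)) * Q * ((1 - Real.exp (-((R - s) * t))) / (R - s)))
      ≤ Real.exp (-(s * t)) * (r / (r - s) * Q) := by
  have h1 : Real.exp (-(R * t)) = Real.exp (-(s * t)) * Real.exp (-((R - s) * t)) := by
    rw [← Real.exp_add]; congr 1; ring
  have h2 : R / (R - s) ≤ r / (r - s) := by
    rw [div_le_div_iff₀ (by linarith) (by linarith)]; nlinarith
  have h3 : 1 ≤ R / (R - s) := by
    rw [le_div_iff₀ (by linarith)]; linarith
  set X := Real.exp (-((R - s) * t)) with hX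
  have hX0 : 0 < X := Real.exp_pos _
  have hE : 0 < Real.exp (-(s * t)) := Real.exp_pos _
  rw [h1]
  have : Real.exp (-(s * t)) * X + R * (Real.exp (-(s * t)) * Q * ((1 - X) / (R - s))) =
      Real.exp (-(s * t)) * (X + R / (R - s) * Q * (1 - X)) := by
    field_simp
  rw [this]
  refine mul_le_mul_of_nonneg_left ?_ hE.le
  have h4 : 1 ≤ R / (R - s) * Q := by nlinarith
  nlinarith [mul_le_mul_of_nonneg_right h2 (by linarith : (0 : ℝ) ≤ Q)]

/-- Chernoff bound for the exploration of a ball: if every nonempty set `S ⊆ A` with fewer than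
`m` vertices has at least `r |S|` boundary edges, then it is unlikely that fewer than `m`
vertices are at distance at most `t` from `S`. -/
theorem measure_card_ball_lt_le {H : SimpleGraph V} {A : Finset V} {r : ℕ → ℝ} {m : ℕ} {s : ℝ}
    (hs : 0 < s) (hA : ∀ v w, H.Adj v w → v ∈ A → w ∈ A)
    (hbd : ∀ S ⊆ A, S.Nonempty → S.card < m → r S.card ≤ (edgeBoundary H S).card)
    (hr : ∀ k, 1 ≤ k → k < m → s < r k) (S : Finset V) (hSA : S ⊆ A) (hS : S.Nonempty)
    {t : ℝ} (ht : 0 ≤ t) :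
    Measure.pi (fun _ : Sym2 V => expMeasure 1) {len | (ball H len S t).card < m} ≤
      ENNReal.ofReal (Real.exp (-(s * t)) * ∏ k ∈ Finset.Ico S.card m, r k / (r k - s)) := by
  classical
  set μ := Measure.pi (fun _ : Sym2 V => expMeasure 1) with hμ
  -- Induction on the number of vertices still missing.
  obtain ⟨j, hj⟩ : ∃ j, m - S.card = j := ⟨_, rfl⟩
  induction j generalizing S t with
  | zero =>
    have : {len : Sym2 V → ℝ | (ball H len S t).card < m} = ∅ := by
      ext len
      simp only [Set.mem_ofPred_eq, Set.mem_empty_iff_false, iff_false, not_lt]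
      exact (Nat.sub_eq_zero_iff_le.1 hj).trans (Finset.card_le_card (subset_ball H len S t))
    rw [this]
    simp
  | succ j ih =>
    have hlt : S.card < m := by omega
    set D := edgeBoundary H S with hD
    set Q := ∏ k ∈ Finset.Ico (S.card + 1) m, r k / (r k - s) with hQ
    have hQ1 : 1 ≤ Q := by
      rw [hQ, ← Finset.prod_const_one (s := Finset.Ico (S.card + 1) m)]
      refine Finset.prod_le_prod (fun _ _ => zero_le_one) fun k hk => ?_
      rw [Finset.mem_Ico] at hk
      have := hr k (by omega) hk.2
      rw [le_div_iff₀ (by linarith)]; linarith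
    have hrS : s < r S.card := hr _ hS.card_pos hlt
    have hRr : r S.card ≤ D.card := hbd S hSA hS hlt
    have hDne : D.Nonempty := by
      rw [← Finset.card_pos]
      have : (0 : ℝ) < D.card := by linarith
      exact_mod_cast this
    set Bad := {len : Sym2 V → ℝ | (ball H len S t).card < m} with hBad
    have hBm : MeasurableSet Bad := measurableSet_card_ball_lt H S t m
    -- `B e`: the exploration fails although the boundary is crossed by time `t`, and `e` is a
    -- shortest boundary edge. Ties only make these events overlap, which a union bound tolerates.
    let B : Sym2 V → Set (Sym2 V → ℝ) := fun e =>
      {len | (len e ≤ t ∧ ∀ f ∈ D.erase e, len e ≤ len f) ∧ len ∈ Bad}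
    have hBmeas : ∀ e, MeasurableSet (B e) := by
      intro e
      refine MeasurableSet.inter (MeasurableSet.inter ?_ ?_) hBm
      · exact measurableSet_le (measurable_pi_apply e) measurable_const
      · have : {len : Sym2 V → ℝ | ∀ f ∈ D.erase e, len e ≤ len f} =
            ⋂ f ∈ D.erase e, {len | len e ≤ len f} := by ext; simp
        rw [show (fun len : Sym2 V → ℝ => ∀ f ∈ D.erase e, len e ≤ len f) =
          {len : Sym2 V → ℝ | ∀ f ∈ D.erase e, len e ≤ len f} from rfl, this]
        exact Finset.measurableSet_biInter _ fun f _ =>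
          measurableSet_le (measurable_pi_apply e) (measurable_pi_apply f)
    have hcover : Bad ⊆ {len | (∀ f ∈ D, t ≤ len f) ∧ len ∈ Set.univ} ∪ ⋃ e ∈ D, B e := by
      intro len hlen
      by_cases h : ∀ f ∈ D, t ≤ len f
      · exact Or.inl ⟨h, trivial⟩
      · right
        push Not at h
        obtain ⟨f, hf, hft⟩ := h
        obtain ⟨e, he, hmin⟩ := D.exists_min_image len hDne
        simp only [Set.mem_iUnion]
        exact ⟨e, he, ⟨(hmin f hf).trans hft.le, fun g hg =>
          hmin g (Finset.mem_of_mem_erase hg)⟩, hlen⟩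
    have hB : ∀ e ∈ D, μ (B e) ≤ ENNReal.ofReal (Real.exp (-(s * t)) * Q *
        ((1 - Real.exp (-((D.card - s) * t))) / (D.card - s))) := by
      intro e he
      obtain ⟨x, hx, y, hy, hxy, rfl⟩ := mem_edgeBoundary.1 he
      -- Given that `e` has length `a`, the other `D.card - 1` boundary edges are at least `a` with
      -- probability `exp(-(D.card - 1) a)`. Their residual lengths are then fresh exponentials, so
      -- induction applies to `insert y S` with remaining time `t - a`.
      let g : ℝ → ℝ≥0∞ := (Set.Iic t).indicator fun a =>
        ENNReal.ofReal (Real.exp (-(((D.card : ℝ) - 1) * a)) * (Real.exp (-(s * (t - a))) * Q))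
      have hg : Measurable g := Measurable.indicator (by fun_prop) measurableSet_Iic
      have h1 : μ (B s(x, y)) ≤ ∫⁻ a, g a ∂expMeasure 1 := by
        rw [hμ, pi_apply_eq_lintegral_update (expMeasure 1) s(x, y) (hBmeas _)]
        refine lintegral_mono_ae ?_
        filter_upwards [expMeasure_one_ae_nonneg] with a ha
        by_cases hat : a ≤ t
        · have hset : {f | Function.update f s(x, y) a ∈ B s(x, y)} =
              {f | (∀ i ∈ D.erase s(x, y), a ≤ f i) ∧
                f ∈ {f | Function.update f s(x, y) a ∈ Bad}} := by
            ext f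
            simp only [B, Set.mem_ofPred_eq, Function.update_self, hat, true_and]
            refine and_congr_left fun _ => forall₂_congr fun i hi => ?_
            rw [Function.update_of_ne (Finset.ne_of_mem_erase hi)]
          have hm : MeasurableSet {f | Function.update f s(x, y) a ∈ Bad} :=
            (measurable_update_pair (α := ℝ) s(x, y)).comp
              (measurable_const (a := a).prodMk measurable_id) hBm
          rw [hset, pi_expMeasure_one_shift ha _ hm]
          simp only [g, Set.indicator_of_mem (Set.mem_Iic.2 hat)]
          rw [ENNReal.ofReal_mul (Real.exp_nonneg _)]
          refine mul_le_mul' (le_of_eq ?_) ?_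
          · rw [Finset.card_erase_of_mem he, Nat.cast_sub (Finset.card_pos.2 ⟨_, he⟩)]
            simp
          · have hyA : y ∈ A := hA x y hxy (hSA hx)
            have hc : (insert y S).card = S.card + 1 := Finset.card_insert_of_notMem hy
            have := ih (insert y S) (Finset.insert_subset hyA hSA) ⟨y, by simp⟩
              (t := t - a) (by linarith) (by omega)
            rw [hc] at this
            refine (measure_mono fun f hf => ?_).trans this
            exact (Finset.card_le_card (ball_insert_subset_ball hx hxy ha hat f)).trans_lt hf
        · have : {f | Function.update f s(x, y) a ∈ B s(x, y)} = ∅ := by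
            ext f
            simp [B, hat]
          rw [this]
          simp
      refine h1.trans (le_of_eq ?_)
      rw [lintegral_expMeasure_one hg]
      have h2 : ∀ a, ENNReal.ofReal (Real.exp (-a)) * g a = (Set.Iic t).indicator (fun a =>
          ENNReal.ofReal (Real.exp (-(s * t)) * Q) *
            ENNReal.ofReal (Real.exp (-((D.card - s) * a)))) a := by
        intro a
        by_cases hat : a ∈ Set.Iic t
        · simp only [g, Set.indicator_of_mem hat]
          rw [← ENNReal.ofReal_mul (Real.exp_nonneg _), ← ENNReal.ofReal_mul (by positivity)]
          congr 1
          have : Real.exp (-(s * t)) * Real.exp (-((D.card - s) * a)) =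
              Real.exp (-a) * (Real.exp (-(((D.card : ℝ) - 1) * a)) * Real.exp (-(s * (t - a)))) := by
            rw [← Real.exp_add, ← Real.exp_add, ← Real.exp_add]
            congr 1; ring
          linear_combination (-Q) * this
        · simp [g, Set.indicator_of_notMem hat]
      simp_rw [h2]
      rw [setLIntegral_indicator measurableSet_Iic, Set.inter_comm, Set.Ioi_inter_Iic,
        lintegral_const_mul _ (by fun_prop), setLIntegral_exp_neg_mul (by linarith) ht,
        ← ENNReal.ofReal_mul (by positivity)]
    have h0 : μ {len | (∀ f ∈ D, t ≤ len f) ∧ len ∈ Set.univ} =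
        ENNReal.ofReal (Real.exp (-(D.card * t))) := by
      rw [hμ, pi_expMeasure_one_shift ht D MeasurableSet.univ]
      simp
    calc μ Bad ≤ μ ({len | (∀ f ∈ D, t ≤ len f) ∧ len ∈ Set.univ} ∪ ⋃ e ∈ D, B e) :=
          measure_mono hcover
      _ ≤ _ := measure_union_le _ _
      _ ≤ ENNReal.ofReal (Real.exp (-(D.card * t))) + ∑ e ∈ D, μ (B e) :=
          add_le_add h0.le (measure_biUnion_finset_le _ _)
      _ ≤ ENNReal.ofReal (Real.exp (-(D.card * t))) + ∑ e ∈ D,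
          ENNReal.ofReal (Real.exp (-(s * t)) * Q *
            ((1 - Real.exp (-((D.card - s) * t))) / (D.card - s))) := by
          gcongr with e he
          exact hB e he
      _ = ENNReal.ofReal (Real.exp (-(D.card * t)) + D.card * (Real.exp (-(s * t)) * Q *
            ((1 - Real.exp (-((D.card - s) * t))) / (D.card - s)))) := by
          have hnn : 0 ≤ Real.exp (-(s * t)) * Q *
            ((1 - Real.exp (-((D.card - s) * t))) / (D.card - s)) := by
            have : Real.exp (-((D.card - s) * t)) ≤ 1 := by
              rw [Real.exp_le_one_iff]
              nlinarith [mul_nonneg (by linarith : (0 : ℝ) ≤ D.card - s) ht]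
            refine mul_nonneg (by positivity) (div_nonneg (by linarith) (by linarith))
          rw [Finset.sum_const, nsmul_eq_mul, ENNReal.ofReal_add (Real.exp_nonneg _)
            (mul_nonneg (by positivity) hnn), ENNReal.ofReal_mul (p := (D.card : ℝ)) (by positivity),
            ENNReal.ofReal_natCast]
      _ ≤ _ := by
          refine ENNReal.ofReal_le_ofReal ?_
          rw [Finset.prod_eq_prod_Ico_succ_bot hlt]
          exact exp_add_mul_div_le hs hrS hRr hQ1

/-- The Chernoff bound in terms of the sum of the expected waiting times. -/
theorem measure_card_ball_lt_le_exp {H : SimpleGraph V} {A : Finset V} {r : ℕ → ℝ} {m : ℕ}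
    {s η T : ℝ} (hs : 0 < s) (hη0 : 0 ≤ η) (hη : η < 1) (hA : ∀ v w, H.Adj v w → v ∈ A → w ∈ A)
    (hbd : ∀ S ⊆ A, S.Nonempty → S.card < m → r S.card ≤ (edgeBoundary H S).card)
    (hr : ∀ k, 1 ≤ k → k < m → s ≤ η * r k) (hT : ∑ k ∈ Finset.Ico 1 m, 1 / r k ≤ T)
    {u : V} (hu : u ∈ A) {t : ℝ} (ht : 0 ≤ t) :
    Measure.pi (fun _ : Sym2 V => expMeasure 1) {len | (ball H len {u} t).card < m} ≤
      ENNReal.ofReal (Real.exp (s * (T / (1 - η) - t))) := by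
  have hrpos : ∀ k, 1 ≤ k → k < m → s < r k ∧ 0 < r k := by
    intro k h1 h2
    have h := hr k h1 h2
    have hr0 : 0 < r k := by
      by_contra hcon
      have := mul_nonpos_of_nonneg_of_nonpos hη0 (not_lt.1 hcon)
      linarith
    exact ⟨by nlinarith, hr0⟩
  refine (measure_card_ball_lt_le hs hA hbd (fun k h1 h2 => (hrpos k h1 h2).1) {u} (by simpa)
    (by simp) ht).trans (ENNReal.ofReal_le_ofReal ?_)
  -- `r / (r - s) = 1 + s / (r - s)`, and `s ≤ η r` gives `r - s ≥ (1 - η) r`.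
  have h1 : ∏ k ∈ Finset.Ico 1 m, r k / (r k - s) ≤
      ∏ k ∈ Finset.Ico 1 m, Real.exp (s / (1 - η) * (1 / r k)) := by
    refine Finset.prod_le_prod (fun k hk => ?_) fun k hk => ?_
    · rw [Finset.mem_Ico] at hk
      obtain ⟨h1, h2⟩ := hrpos k hk.1 hk.2
      exact div_nonneg h2.le (by linarith)
    · rw [Finset.mem_Ico] at hk
      obtain ⟨h1, h2⟩ := hrpos k hk.1 hk.2
      have h3 := hr k hk.1 hk.2
      refine le_trans ?_ (Real.add_one_le_exp _)
      have h4 : r k / (r k - s) = s / (r k - s) + 1 := by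
        rw [div_add_one (by linarith)]; congr 1; ring
      rw [h4, div_mul_div_comm, mul_one]
      exact add_le_add_left (div_le_div_of_nonneg_left hs.le (mul_pos (by linarith) h2)
        (by nlinarith)) 1
  rw [Finset.card_singleton]
  refine (mul_le_mul_of_nonneg_left h1 (Real.exp_nonneg _)).trans ?_
  rw [← Real.exp_sum, ← Real.exp_add, Real.exp_le_exp, ← Finset.mul_sum]
  have : s / (1 - η) * ∑ k ∈ Finset.Ico 1 m, 1 / r k ≤ s / (1 - η) * T :=
    mul_le_mul_of_nonneg_left hT (div_nonneg hs.le (by linarith))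
  calc _ ≤ -(s * t) + s / (1 - η) * T := by linarith
    _ = _ := by ring

end Growth

/-! ### Random graphs with independent edges -/

section GraphLaw
variable {V : Type*} [Fintype V]

instance : MeasurableSingletonClass (SimpleGraph V) :=
  ⟨fun G => by
    have : ({G} : Set (SimpleGraph V)) = SimpleGraph.edgeSet ⁻¹' {G.edgeSet} := by
      ext H; simp
    rw [this]
    exact SimpleGraph.measurable_edgeSet (measurableSet_singleton _)⟩

open Classical in
/-- The law `ν` of a random graph has independent edges, and `e` is an edge with
probability `q e`. -/
def EdgeIndep (ν : Measure (SimpleGraph V)) (q : Sym2 V → ℝ) : Prop :=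
  (∀ e, 0 ≤ q e) ∧ ∀ (e : Sym2 V) (f : SimpleGraph V → ℝ≥0∞),
    ∫⁻ G, (if e ∈ G.edgeSet then f (G.deleteEdges {e}) else 0) ∂ν =
      ENNReal.ofReal (q e) * ∫⁻ G, f (G.deleteEdges {e}) ∂ν

-- A fixed graph is an instance with degenerate probabilities, so that deterministic and random
-- graphs share all later estimates.
open Classical in
theorem edgeIndep_dirac (G : SimpleGraph V) :
    EdgeIndep (Measure.dirac G) fun e => if e ∈ G.edgeSet then 1 else 0 := by
  refine ⟨fun e => by dsimp only; split_ifs <;> norm_num, fun e f => ?_⟩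
  rw [lintegral_dirac, lintegral_dirac]
  by_cases he : e ∈ G.edgeSet <;> simp [he]

/-- The graphs `G` and `G - e` agree off `e`, so conditionally on the rest the edge `e` is present
with probability `p`. In terms of weights this is `p + (1 - p) = 1`. -/
theorem binomialRandom_singleton_insert (p : I) {G : SimpleGraph V} {e : Sym2 V}
    (he : e ∈ G.edgeSet) :
    SimpleGraph.binomialRandom V p {G} = ENNReal.ofReal p *
      (SimpleGraph.binomialRandom V p {G.deleteEdges {e}} +
        SimpleGraph.binomialRandom V p {G}) := by
  classical
  have hc : (G.deleteEdges {e}).edgeSet.ncard + 1 = G.edgeSet.ncard := by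
    rw [SimpleGraph.edgeSet_deleteEdges, Set.ncard_sdiff_singleton_add_one he (Set.toFinite _)]
  have hle : G.edgeSet.ncard ≤ (Nat.card V).choose 2 := by
    rw [← SimpleGraph.coe_edgeFinset, Set.ncard_coe_finset, Nat.card_eq_fintype_card]
    exact SimpleGraph.card_edgeFinset_le_card_choose_two
  simp only [SimpleGraph.binomialRandom_singleton]
  obtain ⟨k, hk⟩ : ∃ k, k = (G.deleteEdges {e}).edgeSet.ncard := ⟨_, rfl⟩
  rw [← hk] at hc ⊢
  rw [← hc] at hle ⊢
  obtain ⟨j, hj⟩ := Nat.exists_eq_add_of_le hle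
  rw [hj, show k + 1 + j - k = j + 1 by omega, show k + 1 + j - (k + 1) = j by omega]
  have hp : ENNReal.ofReal p = (unitInterval.toNNReal p : ℝ≥0∞) := by
    rw [ENNReal.ofReal, ← Real.toNNReal_coe (r := unitInterval.toNNReal p)]
    simp
  have hsum : (unitInterval.toNNReal (σ p) : ℝ≥0∞) + unitInterval.toNNReal p = 1 := by
    rw [← ENNReal.coe_add, ← ENNReal.coe_one]
    congr 1
    ext
    simp
  rw [hp]
  calc _ = (unitInterval.toNNReal p : ℝ≥0∞) ^ (k + 1) * (unitInterval.toNNReal (σ p)) ^ j * 1 := by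
        rw [mul_one]
    _ = _ := by rw [← hsum]; ring

-- Adding and removing `e` is a bijection between the graphs without and with `e`. Summing over
-- these pairs reduces the claim to `binomialRandom_singleton_insert`.
open Classical in
theorem edgeIndep_binomialRandom (p : I) :
    EdgeIndep (SimpleGraph.binomialRandom V p) fun e => if e.IsDiag then 0 else (p : ℝ) := by
  refine ⟨fun e => ?_, fun e f => ?_⟩
  · dsimp only
    split_ifs
    exacts [le_rfl, p.2.1]
  by_cases hd : e.IsDiag
  · have : ∀ G : SimpleGraph V, e ∉ G.edgeSet := fun G he => G.not_isDiag_of_mem_edgeSet he hd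
    simp [this, hd]
  dsimp only
  rw [if_neg hd, lintegral_fintype, lintegral_fintype]
  set ν := SimpleGraph.binomialRandom V p
  have h1 : ∑ G : SimpleGraph V, (if e ∈ G.edgeSet then f (G.deleteEdges {e}) else 0) * ν {G} =
      ∑ G : SimpleGraph V with e ∈ G.edgeSet, f (G.deleteEdges {e}) * ν {G} := by
    rw [Finset.sum_filter]
    refine Finset.sum_congr rfl fun G _ => ?_
    split_ifs <;> simp
  have h2 : ∑ G : SimpleGraph V with e ∉ G.edgeSet, f (G.deleteEdges {e}) * ν {G} =
      ∑ G : SimpleGraph V with e ∈ G.edgeSet, f (G.deleteEdges {e}) * ν {G.deleteEdges {e}} := by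
    refine Finset.sum_nbij' (fun G => G ⊔ SimpleGraph.fromEdgeSet {e})
      (fun G => G.deleteEdges {e}) ?_ ?_ ?_ ?_ ?_
    · intro G _
      simp [SimpleGraph.edgeSet_sup, SimpleGraph.edgeSet_fromEdgeSet, hd]
    · intro G _
      simp [SimpleGraph.edgeSet_deleteEdges]
    · intro G hG
      simp only [Finset.mem_filter, Finset.mem_univ, true_and] at hG
      rw [← SimpleGraph.edgeSet_inj, SimpleGraph.edgeSet_deleteEdges, SimpleGraph.edgeSet_sup,
        SimpleGraph.edgeSet_fromEdgeSet]
      ext x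
      simp only [Set.mem_sdiff, Set.mem_union, Set.mem_singleton_iff]
      constructor
      · rintro ⟨h | h, h'⟩
        exacts [h, absurd h.1 h']
      · exact fun h => ⟨Or.inl h, fun h' => hG (h' ▸ h)⟩
    · intro G hG
      simp only [Finset.mem_filter, Finset.mem_univ, true_and] at hG
      rw [← SimpleGraph.edgeSet_inj, SimpleGraph.edgeSet_sup, SimpleGraph.edgeSet_deleteEdges,
        SimpleGraph.edgeSet_fromEdgeSet]
      ext x
      simp only [Set.mem_sdiff, Set.mem_union, Set.mem_singleton_iff]
      constructor
      · rintro (h | h)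
        exacts [h.1, h.1 ▸ hG]
      · intro h
        by_cases hx : x = e
        · exact Or.inr ⟨hx, by simpa [hx] using hd⟩
        · exact Or.inl ⟨h, hx⟩
    · intro G hG
      simp only [Finset.mem_filter, Finset.mem_univ, true_and] at hG
      have h3 : (G ⊔ SimpleGraph.fromEdgeSet {e}).deleteEdges {e} = G := by
        rw [← SimpleGraph.edgeSet_inj, SimpleGraph.edgeSet_deleteEdges, SimpleGraph.edgeSet_sup,
          SimpleGraph.edgeSet_fromEdgeSet]
        ext x
        simp only [Set.mem_sdiff, Set.mem_union, Set.mem_singleton_iff]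
        constructor
        · rintro ⟨h | h, h'⟩
          exacts [h, absurd h.1 h']
        · exact fun h => ⟨Or.inl h, fun h' => hG (h' ▸ h)⟩
      have h4 : G.deleteEdges {e} = G := by
        rw [SimpleGraph.deleteEdges_eq_self]
        simpa using hG
      rw [h3, h4]
  rw [h1, ← Finset.sum_filter_add_sum_filter_not Finset.univ (fun G => e ∈ G.edgeSet), h2,
    ← Finset.sum_add_distrib, Finset.mul_sum]
  refine Finset.sum_congr rfl fun G hG => ?_
  simp only [Finset.mem_filter, Finset.mem_univ, true_and] at hG
  rw [← mul_add]
  conv_lhs => rw [binomialRandom_singleton_insert p hG]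
  rw [add_comm (ν {G.deleteEdges {e}})]
  ring

namespace EdgeIndep
variable {ν : Measure (SimpleGraph V)} {q : Sym2 V → ℝ}

theorem measure_subset_edgeSet [IsProbabilityMeasure ν] (h : EdgeIndep ν q)
    (F : Finset (Sym2 V)) :
    ν {G | (F : Set (Sym2 V)) ⊆ G.edgeSet} = ENNReal.ofReal (∏ e ∈ F, q e) := by
  classical
  induction F using Finset.induction_on with
  | empty => simp
  | insert e F he ih =>
    have h1 := h.2 e (fun G => if (F : Set (Sym2 V)) ⊆ G.edgeSet then 1 else 0)
    have h2 : ∀ G : SimpleGraph V, (F : Set (Sym2 V)) ⊆ (G.deleteEdges {e}).edgeSet ↔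
        (F : Set (Sym2 V)) ⊆ G.edgeSet := by
      intro G
      rw [SimpleGraph.edgeSet_deleteEdges, Set.subset_sdiff, and_iff_left]
      simpa using he
    simp only [h2] at h1
    have h3 : ∀ s : Set (SimpleGraph V), ∫⁻ G, (if G ∈ s then 1 else 0) ∂ν = ν s := by
      intro s
      rw [← lintegral_indicator_one MeasurableSet.of_discrete]
      rfl
    have h4 := h3 {G | (F : Set (Sym2 V)) ⊆ G.edgeSet}
    have h5 := h3 {G | ((insert e F : Finset _) : Set (Sym2 V)) ⊆ G.edgeSet}
    simp only [Set.mem_ofPred_eq] at h4 h5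
    rw [h4, ih] at h1
    rw [Finset.prod_insert he, ENNReal.ofReal_mul (h.1 e), ← h1, ← h5]
    refine lintegral_congr fun G => ?_
    by_cases h6 : e ∈ G.edgeSet <;> by_cases h7 : (F : Set (Sym2 V)) ⊆ G.edgeSet <;>
      simp [Set.insert_subset_iff, h6, h7]

theorem measure_mem_edgeSet [IsProbabilityMeasure ν] (h : EdgeIndep ν q) (e : Sym2 V) :
    ν {G | e ∈ G.edgeSet} = ENNReal.ofReal (q e) := by
  simpa using h.measure_subset_edgeSet {e}

theorem le_one [IsProbabilityMeasure ν] (h : EdgeIndep ν q) (e : Sym2 V) : q e ≤ 1 := by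
  have := prob_le_one (μ := ν) (s := {G | e ∈ G.edgeSet})
  rw [h.measure_mem_edgeSet e] at this
  simpa using this

open Classical in
/-- The Laplace transform of the number of edges of the random graph in a given set. -/
theorem laplace [IsProbabilityMeasure ν] (h : EdgeIndep ν q) (F : Finset (Sym2 V)) {a : ℝ}
    (ha : 0 ≤ a) :
    ∫⁻ G, ENNReal.ofReal (Real.exp (-(a * (F.filter fun e => e ∈ G.edgeSet).card))) ∂ν ≤
      ENNReal.ofReal (Real.exp (-((1 - Real.exp (-a)) * ∑ e ∈ F, q e))) := by
  induction F using Finset.induction_on with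
  | empty => simp
  | insert e F he ih =>
    set g : SimpleGraph V → ℝ≥0∞ := fun G =>
      ENNReal.ofReal (Real.exp (-(a * (F.filter fun e => e ∈ G.edgeSet).card))) with hg
    have hgd : ∀ G, g (G.deleteEdges {e}) = g G := by
      intro G
      simp only [hg]
      congr 6
      ext x
      simp only [Finset.mem_filter]
      rw [SimpleGraph.edgeSet_deleteEdges, Set.mem_sdiff]
      refine and_congr_right fun hx => and_iff_left ?_
      rintro rfl
      exact he hx
    have h1 := h.2 e g
    simp only [hgd] at h1
    set A := ∫⁻ G, g G ∂ν with hA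
    have hAtop : A ≠ ∞ := ne_top_of_le_ne_top ENNReal.ofReal_ne_top ih
    have hea : Real.exp (-a) ≤ 1 := by simpa using ha
    -- An edge contributes `exp(-a 1_e) = 1 - (1 - exp(-a)) 1_e`. The identity is written additively
    -- because subtraction in `ℝ≥0∞` is truncated.
    have key : ∫⁻ G, ENNReal.ofReal (Real.exp (-(a * ((insert e F).filter
        fun e => e ∈ G.edgeSet).card))) ∂ν +
        ENNReal.ofReal (1 - Real.exp (-a)) * (ENNReal.ofReal (q e) * A) = A := by
      rw [← h1, ← lintegral_const_mul _ Measurable.of_discrete,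
        ← lintegral_add_left Measurable.of_discrete, hA]
      refine lintegral_congr fun G => ?_
      rw [Finset.filter_insert]
      by_cases heG : e ∈ G.edgeSet
      · rw [if_pos heG, if_pos heG, Finset.card_insert_of_notMem (by simp [he])]
        simp only [hg]
        rw [← ENNReal.ofReal_mul (by linarith), ← ENNReal.ofReal_add (Real.exp_nonneg _)
          (mul_nonneg (by linarith) (Real.exp_nonneg _))]
        congr 1
        push_cast
        rw [mul_add, neg_add, Real.exp_add, mul_one]
        ring
      · rw [if_neg heG, if_neg heG, mul_zero, add_zero]
    have hq := h.le_one e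
    have hq0 := h.1 e
    have hx : 0 ≤ (1 - Real.exp (-a)) * q e := mul_nonneg (by linarith) hq0
    have hx1 : (1 - Real.exp (-a)) * q e ≤ 1 := by
      have := Real.exp_pos (-a)
      nlinarith
    have key2 : ∫⁻ G, ENNReal.ofReal (Real.exp (-(a * ((insert e F).filter
        fun e => e ∈ G.edgeSet).card))) ∂ν =
        ENNReal.ofReal (1 - (1 - Real.exp (-a)) * q e) * A := by
      rw [← mul_assoc, ← ENNReal.ofReal_mul (by linarith)] at key
      rw [ENNReal.ofReal_sub _ hx, ENNReal.ofReal_one, ENNReal.sub_mul (fun _ _ => hAtop), one_mul]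
      exact ENNReal.eq_sub_of_add_eq (ENNReal.mul_ne_top ENNReal.ofReal_ne_top hAtop) key
    rw [key2, Finset.sum_insert he, mul_add, neg_add, Real.exp_add,
      ENNReal.ofReal_mul (Real.exp_nonneg _)]
    refine mul_le_mul' (ENNReal.ofReal_le_ofReal ?_) ih
    have := Real.add_one_le_exp (-((1 - Real.exp (-a)) * q e))
    linarith

end EdgeIndep
end GraphLaw

/-! ### First and second moment methods -/

section Moments
variable {Ω ι : Type*} [MeasurableSpace Ω] [Fintype ι] {P : Measure Ω} {B : ι → Set Ω}

open Classical in
theorem natCast_card_filter_mem_eq_sum {R : Type*} [NonAssocSemiring R] (B : ι → Set Ω) (ω : Ω) :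
    ((Finset.univ.filter fun i => ω ∈ B i).card : R) =
      ∑ i, (B i).indicator (fun _ => (1 : R)) ω := by
  simp only [Finset.card_filter, Nat.cast_sum, Set.indicator_apply, Nat.cast_ite, Nat.cast_one,
    Nat.cast_zero]

open Classical in
/-- The first moment method. -/
theorem measure_le_card_filter_le (hB : ∀ i, MeasurableSet (B i)) {z : ℝ} (hz : 0 < z) :
    P {ω | z ≤ (Finset.univ.filter fun i => ω ∈ B i).card} ≤ (∑ i, P (B i)) / ENNReal.ofReal z := by
  have h1 : ∫⁻ ω, ((Finset.univ.filter fun i => ω ∈ B i).card : ℝ≥0∞) ∂P = ∑ i, P (B i) := by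
    simp_rw [natCast_card_filter_mem_eq_sum]
    rw [lintegral_finsetSum _ fun i _ => measurable_const.indicator (hB i)]
    exact Finset.sum_congr rfl fun i _ => lintegral_indicator_one (hB i)
  have hm : AEMeasurable (fun ω => ((Finset.univ.filter fun i => ω ∈ B i).card : ℝ≥0∞)) P := by
    simp_rw [natCast_card_filter_mem_eq_sum]
    exact (Finset.measurable_sum _ fun i _ => measurable_const.indicator (hB i)).aemeasurable
  have h2 := meas_ge_le_lintegral_div hm (ε := ENNReal.ofReal z) (by simpa using hz) (by simp)
  rw [h1] at h2
  refine (measure_mono fun ω hω => ?_).trans h2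
  rw [Set.mem_ofPred_eq] at hω ⊢
  rw [← ENNReal.ofReal_natCast]
  exact ENNReal.ofReal_le_ofReal hω

open Classical in
/-- The second moment method for pairwise nonpositively correlated events. -/
theorem measure_le_abs_card_filter_sub_le [IsProbabilityMeasure P]
    (hB : ∀ i, MeasurableSet (B i))
    (hpair : ∀ i j, i ≠ j → P.real (B i ∩ B j) ≤ P.real (B i) * P.real (B j)) {t : ℝ}
    (ht : 0 < t) :
    P {ω | t ≤ |((Finset.univ.filter fun i => ω ∈ B i).card : ℝ) - ∑ i, P.real (B i)|} ≤
      ENNReal.ofReal ((∑ i, P.real (B i)) / t ^ 2) := by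
  set m := ∑ i, P.real (B i) with hm
  let X : ι → Ω → ℝ := fun i => (B i).indicator fun _ => 1
  have hXX : ∀ i j ω, X i ω * X j ω = (B i ∩ B j).indicator (fun _ => (1 : ℝ)) ω := by
    intro i j ω
    simp only [X, Set.indicator_apply, Set.mem_inter_iff]
    split_ifs <;> simp_all
  have hint : ∀ i, Integrable (X i) P := fun i => (integrable_const 1).indicator (hB i)
  have hint2 : ∀ i j, Integrable (fun ω => X i ω * X j ω) P := fun i j => by
    simp_rw [hXX]
    exact (integrable_const 1).indicator ((hB i).inter (hB j))
  have hEX : ∀ i, ∫ ω, X i ω ∂P = P.real (B i) := fun i => by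
    simp [X, integral_indicator (hB i)]
  have hEXX : ∀ i j, ∫ ω, X i ω * X j ω ∂P = P.real (B i ∩ B j) := fun i j => by
    simp_rw [hXX]
    simp [integral_indicator ((hB i).inter (hB j))]
  have hsq : ∀ ω, (∑ i, X i ω - m) ^ 2 =
      (∑ i, ∑ j, X i ω * X j ω) - 2 * m * ∑ i, X i ω + m ^ 2 := by
    intro ω
    rw [← Finset.sum_mul_sum]
    ring
  have hI1 : Integrable (fun ω => ∑ i, ∑ j, X i ω * X j ω) P :=
    integrable_finsetSum _ fun i _ => integrable_finsetSum _ fun j _ => hint2 i j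
  have hI2 : Integrable (fun ω => 2 * m * ∑ i, X i ω) P :=
    (integrable_finsetSum _ fun i _ => hint i).const_mul _
  have hvar : ∫ ω, (∑ i, X i ω - m) ^ 2 ∂P ≤ m := by
    simp_rw [hsq]
    rw [integral_add (f := fun ω => (∑ i, ∑ j, X i ω * X j ω) - 2 * m * ∑ i, X i ω)
      (hI1.sub hI2) (integrable_const _), integral_sub hI1 hI2,
      integral_finsetSum _ fun i _ => integrable_finsetSum _ fun j _ => hint2 i j,
      integral_const_mul, integral_finsetSum _ fun i _ => hint i]
    simp_rw [integral_finsetSum _ fun j _ => hint2 _ j, hEX, hEXX]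
    -- Only the diagonal exceeds the product of probabilities, so the variance is at most the mean
    -- `m`.
    have h1 : ∀ i, ∑ j, P.real (B i ∩ B j) ≤ P.real (B i) + P.real (B i) * m := by
      intro i
      rw [← Finset.add_sum_erase _ _ (Finset.mem_univ i), Set.inter_self]
      refine add_le_add_right ?_ _
      rw [hm, Finset.mul_sum]
      refine (Finset.sum_le_sum fun j hj => hpair i j (Finset.ne_of_mem_erase hj).symm).trans ?_
      exact Finset.sum_le_sum_of_subset_of_nonneg (Finset.subset_univ _) fun j _ _ => by positivity
    have h2 : ∑ i, ∑ j, P.real (B i ∩ B j) ≤ m + m * m := by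
      refine (Finset.sum_le_sum fun i _ => h1 i).trans_eq ?_
      rw [Finset.sum_add_distrib, ← Finset.sum_mul]
    simp only [integral_const, probReal_univ, smul_eq_mul, one_mul]
    rw [← hm]
    nlinarith
  have hI3 : Integrable (fun ω => (∑ i, X i ω - m) ^ 2) P := by
    simp_rw [hsq]
    exact (hI1.sub hI2).add (integrable_const _)
  have hM := mul_meas_ge_le_integral_of_nonneg (μ := P)
    (Eventually.of_forall fun ω => sq_nonneg (∑ i, X i ω - m)) hI3 (t ^ 2)
  have hset : {ω | t ≤ |((Finset.univ.filter fun i => ω ∈ B i).card : ℝ) - m|} =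
      {ω | t ^ 2 ≤ (∑ i, X i ω - m) ^ 2} := by
    ext ω
    simp only [Set.mem_ofPred_eq, natCast_card_filter_mem_eq_sum]
    rw [sq_le_sq, abs_of_pos ht]
  rw [hset, ← ofReal_measureReal]
  refine ENNReal.ofReal_le_ofReal ?_
  rw [le_div_iff₀ (by positivity), mul_comm]
  exact hM.trans hvar

end Moments

/-! ### Events of a random graph and random lengths together -/

section JointLaw
variable {V : Type*} [Fintype V] {Ω : Type*} [MeasurableSpace Ω]

theorem measurableSet_graph_prod {B : SimpleGraph V → Set Ω} (hB : ∀ G, MeasurableSet (B G)) :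
    MeasurableSet {x : SimpleGraph V × Ω | x.2 ∈ B x.1} := by
  have : {x : SimpleGraph V × Ω | x.2 ∈ B x.1} = ⋃ G, {G} ×ˢ B G := by
    ext ⟨G, ω⟩; simp
  rw [this]
  exact MeasurableSet.iUnion fun G => (measurableSet_singleton G).prod (hB G)

theorem graph_prod_apply (ν : Measure (SimpleGraph V)) (μ : Measure Ω) [SFinite μ]
    {B : SimpleGraph V → Set Ω} (hB : ∀ G, MeasurableSet (B G)) :
    (ν.prod μ) {x : SimpleGraph V × Ω | x.2 ∈ B x.1} = ∫⁻ G, μ (B G) ∂ν := by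
  rw [Measure.prod_apply (measurableSet_graph_prod hB)]
  rfl

end JointLaw

/-! ### Long edges without a short detour -/

section LongEdges
variable {V : Type*} [Fintype V] [DecidableEq V] {ν : Measure (SimpleGraph V)} {q : Sym2 V → ℝ}

theorem measurableSet_le_edgeDist (G : SimpleGraph V) (e : Sym2 V) (c : ℝ≥0∞) :
    MeasurableSet {len : Sym2 V → ℝ | c ≤ edgeDist G len e} :=
  measurableSet_le measurable_const (measurable_edgeDist G e)

/-- The probability that `e` is an edge with length in `(a, b]` without a detour shorter
than `a`. -/
theorem EdgeIndep.measure_long_edge_le [IsProbabilityMeasure ν] (h : EdgeIndep ν q)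
    (e : Sym2 V) {a b : ℝ} (ha : 0 ≤ a) (hab : a ≤ b) :
    (ν.prod (Measure.pi fun _ : Sym2 V => expMeasure 1)) {x | x.1 ∈ {G | e ∈ G.edgeSet} ∧
        (x.2 e ∈ Set.Ioc a b ∧ ENNReal.ofReal a ≤ edgeDist (x.1.deleteEdges {e}) x.2 e)} ≤
      ENNReal.ofReal (q e * (b - a)) * ∫⁻ G, (Measure.pi fun _ : Sym2 V => expMeasure 1)
          {len | ENNReal.ofReal a ≤ edgeDist G len e} ∂ν := by
  classical
  set μ := Measure.pi fun _ : Sym2 V => expMeasure 1 with hμ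
  let B : SimpleGraph V → Set (Sym2 V → ℝ) := fun G => {len | ENNReal.ofReal a ≤ edgeDist G len e}
  have hBm : ∀ G, MeasurableSet (B G) := fun G => measurableSet_le_edgeDist G e _
  have hinv : ∀ (G : SimpleGraph V) (f : Sym2 V → ℝ) (c : ℝ),
      Function.update f e c ∈ B (G.deleteEdges {e}) ↔ f ∈ B (G.deleteEdges {e}) := by
    intro G f c
    simp only [B, Set.mem_ofPred_eq, edgeDist_deleteEdges_update]
  let C : SimpleGraph V → Set (Sym2 V → ℝ) := fun G => if e ∈ G.edgeSet then
    {len | len e ∈ Set.Ioc a b ∧ len ∈ B (G.deleteEdges {e})} else ∅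
  have hCm : ∀ G, MeasurableSet (C G) := by
    intro G
    simp only [C]
    split_ifs
    · exact ((measurable_pi_apply e) measurableSet_Ioc).inter (hBm _)
    · exact MeasurableSet.empty
  have hset : {x : SimpleGraph V × (Sym2 V → ℝ) | x.1 ∈ {G | e ∈ G.edgeSet} ∧
      (x.2 e ∈ Set.Ioc a b ∧ ENNReal.ofReal a ≤ edgeDist (x.1.deleteEdges {e}) x.2 e)} =
      {x | x.2 ∈ C x.1} := by
    ext ⟨G, len⟩
    by_cases he : e ∈ G.edgeSet <;> simp [C, B, he]
  rw [hset, graph_prod_apply ν μ hCm]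
  have h1 : ∀ G, μ (C G) = if e ∈ G.edgeSet then
      expMeasure 1 (Set.Ioc a b) * μ (B (G.deleteEdges {e})) else 0 := by
    intro G
    by_cases he : e ∈ G.edgeSet
    · simp only [C, he, if_true]
      exact pi_inter_eq_mul (expMeasure 1) e measurableSet_Ioc (hBm _) (hinv G)
    · simp [C, he]
  -- Putting `e` back: if neither `e` nor any detour is shorter than `a`, the distance in `G` is at
  -- least `a`. The cost `exp(-a)` of a long `e` is cancelled by the same factor in the probability
  -- that its length lies in `(a, b]`.
  have h2 : ∀ G, ENNReal.ofReal (Real.exp (-a)) * μ (B (G.deleteEdges {e})) ≤ μ (B G) := by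
    intro G
    have h3 := pi_inter_eq_mul (expMeasure 1) e (measurableSet_Ici (a := a)) (hBm _) (hinv G)
    rw [expMeasure_one_Ici, max_eq_left ha] at h3
    rw [← h3]
    refine measure_mono fun len hlen => ?_
    refine le_trans ?_ (min_edgeDist_deleteEdges_le G len e)
    exact le_min (ENNReal.ofReal_le_ofReal hlen.1) hlen.2
  simp_rw [h1]
  -- The event for `G - e` does not see `e`, so its presence only contributes the factor `q e`.
  rw [h.2 e fun H => expMeasure 1 (Set.Ioc a b) * μ (B H), ENNReal.ofReal_mul (h.1 e), mul_assoc]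
  refine mul_le_mul_right ?_ _
  rw [← lintegral_const_mul _ Measurable.of_discrete]
  refine lintegral_mono fun G => ?_
  have h4 : expMeasure 1 (Set.Ioc a b) ≤
      ENNReal.ofReal (b - a) * ENNReal.ofReal (Real.exp (-a)) := by
    rw [expMeasure_one_Ioc ha hab, ← ENNReal.ofReal_mul (by linarith)]
    refine ENNReal.ofReal_le_ofReal ?_
    have h5 : Real.exp (-b) = Real.exp (-a) * Real.exp (-(b - a)) := by
      rw [← Real.exp_add]; congr 1; ring
    have h6 := Real.add_one_le_exp (-(b - a))
    have h7 := Real.exp_pos (-a)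
    rw [h5]
    nlinarith
  calc _ ≤ ENNReal.ofReal (b - a) * ENNReal.ofReal (Real.exp (-a)) * μ (B (G.deleteEdges {e})) :=
        mul_le_mul_left h4 _
    _ ≤ _ := by
        rw [mul_assoc]
        exact mul_le_mul_right (h2 G) _

end LongEdges

/-! ### Short detours: a union bound over trails -/

section Detours
variable {V : Type*} [Fintype V] [DecidableEq V] {ν : Measure (SimpleGraph V)} {q : Sym2 V → ℝ}

/-- The sum of the weights of all walks of length `k + 1` between two vertices. -/
theorem sum_finsetWalkLength_prod_le (M : Sym2 V → ℝ) (hM : ∀ e, 0 ≤ M e) {ρ κ : ℝ} (hρ : 0 ≤ ρ)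
    (hrow : ∀ u, ∑ v, M s(u, v) ≤ ρ) (hκ : ∀ e, M e ≤ κ) (k : ℕ) (u v : V) :
    ∑ w ∈ (⊤ : SimpleGraph V).finsetWalkLength (k + 1) u v, (w.edges.map M).prod ≤ κ * ρ ^ k := by
  have hκ0 : 0 ≤ κ := (hM s(u, v)).trans (hκ _)
  have hsub : ∀ (u : V) (f : V → ℝ), (∀ x, 0 ≤ f x) →
      ∑ x : (⊤ : SimpleGraph V).neighborSet u, f x ≤ ∑ x, f x := by
    intro u f hf
    have := Finset.sum_map Finset.univ
      (Function.Embedding.subtype fun x => x ∈ (⊤ : SimpleGraph V).neighborSet u) f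
    exact this.symm.trans_le (Finset.sum_le_univ_sum_of_nonneg hf)
  have hstep : ∀ (k : ℕ) (u : V), ∑ w ∈ (⊤ : SimpleGraph V).finsetWalkLength (k + 1) u v,
      (w.edges.map M).prod = ∑ x : (⊤ : SimpleGraph V).neighborSet u, M s(u, x) *
        ∑ w ∈ (⊤ : SimpleGraph V).finsetWalkLength k x v, (w.edges.map M).prod := by
    intro k u
    rw [SimpleGraph.finsetWalkLength, Finset.sum_biUnion]
    · refine Finset.sum_congr rfl fun x _ => ?_
      rw [Finset.sum_map, Finset.mul_sum]
      refine Finset.sum_congr rfl fun w _ => ?_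
      have hx : (⊤ : SimpleGraph V).Adj u x := x.2
      change (List.map M (SimpleGraph.Walk.cons hx w).edges).prod = _
      rw [SimpleGraph.Walk.edges_cons, List.map_cons, List.prod_cons]
    · intro x _ y _ hxy
      rw [Function.onFun, Finset.disjoint_left]
      simp only [Finset.mem_map]
      rintro w ⟨p, -, hp⟩ ⟨p', -, hp'⟩
      have hx : (⊤ : SimpleGraph V).Adj u x := x.2
      have hy : (⊤ : SimpleGraph V).Adj u y := y.2
      have h : SimpleGraph.Walk.cons hx p = SimpleGraph.Walk.cons hy p' := hp.trans hp'.symm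
      exact hxy (Subtype.ext (SimpleGraph.Walk.cons.inj h).1)
  -- Each free step costs a row sum `ρ`; the last edge has both ends prescribed and costs `κ`.
  induction k generalizing u with
  | zero =>
    rw [hstep, pow_zero, mul_one]
    have h0 : ∀ x : V, ∑ w ∈ (⊤ : SimpleGraph V).finsetWalkLength 0 x v,
        (w.edges.map M).prod = if x = v then 1 else 0 := by
      intro x
      rw [SimpleGraph.finsetWalkLength]
      split_ifs with h
      · subst h; simp
      · simp
    simp_rw [h0]
    calc ∑ x : (⊤ : SimpleGraph V).neighborSet u, M s(u, x) * (if (x : V) = v then 1 else 0)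
        ≤ ∑ x : V, M s(u, x) * (if x = v then 1 else 0) :=
          hsub u (fun x => M s(u, x) * (if x = v then 1 else 0)) fun x =>
            mul_nonneg (hM _) (by split_ifs <;> norm_num)
      _ = M s(u, v) := by simp
      _ ≤ κ := hκ _
  | succ k ih =>
    rw [hstep]
    calc _ ≤ ∑ x : (⊤ : SimpleGraph V).neighborSet u, M s(u, x) * (κ * ρ ^ k) :=
          Finset.sum_le_sum fun x _ => mul_le_mul_of_nonneg_left (ih _) (hM _)
      _ = (∑ x : (⊤ : SimpleGraph V).neighborSet u, M s(u, x)) * (κ * ρ ^ k) := by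
          rw [Finset.sum_mul]
      _ ≤ ρ * (κ * ρ ^ k) := by
          refine mul_le_mul_of_nonneg_right (le_trans ?_ (hrow u)) (by positivity)
          exact hsub u (fun x => M s(u, x)) fun x => hM _
      _ = _ := by ring

end Detours

section Detours
variable {V : Type*} [Fintype V] [DecidableEq V] {ν : Measure (SimpleGraph V)} {q : Sym2 V → ℝ}

theorem walkLength_eq_ofReal_sum {G : SimpleGraph V} (len : Sym2 V → ℝ) {u v : V} {w : G.Walk u v}
    (hw : w.edges.Nodup) :
    walkLength len w = ENNReal.ofReal (∑ f ∈ w.edges.toFinset, max (len f) 0) := by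
  rw [ENNReal.ofReal_sum_of_nonneg fun _ _ => le_max_right _ _, List.sum_toFinset _ hw]
  unfold walkLength
  congr 1
  refine List.map_congr_left fun f _ => ?_
  rw [ENNReal.ofReal_max, ENNReal.ofReal_zero, max_eq_left zero_le]

/-- Chernoff bound for the length of a trail that avoids `e`. -/
theorem measure_walkLength_lt_le {G : SimpleGraph V} {u v : V} {w : G.Walk u v}
    (hw : w.edges.Nodup) {e : Sym2 V} (he : e ∉ w.edges) {s x y : ℝ} (hs : 0 ≤ s) (hy : 0 ≤ y) :
    Measure.pi (fun _ : Sym2 V => expMeasure 1)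
        {len | len e ≤ y ∧ walkLength len w < ENNReal.ofReal x} ≤
      ENNReal.ofReal (y * Real.exp (s * x) * (1 / (1 + s)) ^ w.edges.toFinset.card) := by
  set F := w.edges.toFinset with hF
  have heF : e ∉ F := by simpa [hF] using he
  -- An indicator at `e` and an exponential tilt on the trail. Since `e` is not on the trail, the
  -- product factorizes over coordinates, and `exp(s x)` times it dominates the indicator of the
  -- event.
  let g : Sym2 V → ℝ → ℝ := fun f z => if f = e then (Set.Iic y).indicator (fun _ => 1) z else
    if f ∈ F then Real.exp (-(s * max z 0)) else 1
  have hg0 : ∀ f z, 0 ≤ g f z := by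
    intro f z
    simp only [g]
    split_ifs
    · exact Set.indicator_nonneg (fun _ _ => zero_le_one) z
    · positivity
    · exact zero_le_one
  have hg1 : ∀ f z, g f z ≤ 1 := by
    intro f z
    simp only [g]
    split_ifs
    · exact Set.indicator_le_self' (fun _ _ => zero_le_one) z
    · rw [Real.exp_le_one_iff]
      have : 0 ≤ s * max z 0 := mul_nonneg hs (le_max_right _ _)
      linarith
    · exact le_rfl
  have hgm : ∀ f, Measurable (g f) := by
    intro f
    simp only [g]
    split_ifs
    · exact measurable_const.indicator measurableSet_Iic
    · fun_prop
    · fun_prop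
  have hprod := lintegral_prod_pi (μ := expMeasure 1) g hg0 hg1 hgm
  have hval : ∀ f, ∫⁻ z, ENNReal.ofReal (g f z) ∂expMeasure 1 = if f = e then
      expMeasure 1 (Set.Iic y) else if f ∈ F then ENNReal.ofReal (1 / (1 + s)) else 1 := by
    intro f
    simp only [g]
    split_ifs
    · rw [← lintegral_indicator_one measurableSet_Iic]
      refine lintegral_congr fun z => ?_
      by_cases hz : z ∈ Set.Iic y <;> simp [hz]
    · exact laplace_expMeasure_one hs
    · simp
  have hprodval : ∏ f, ∫⁻ z, ENNReal.ofReal (g f z) ∂expMeasure 1 =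
      expMeasure 1 (Set.Iic y) * ENNReal.ofReal (1 / (1 + s)) ^ F.card := by
    simp_rw [hval]
    rw [← Finset.mul_prod_erase _ _ (Finset.mem_univ e), if_pos rfl]
    congr 1
    have : ∏ f ∈ Finset.univ.erase e, (if f = e then expMeasure 1 (Set.Iic y) else
        if f ∈ F then ENNReal.ofReal (1 / (1 + s)) else 1) =
        ∏ f ∈ Finset.univ.erase e, if f ∈ F then ENNReal.ofReal (1 / (1 + s)) else 1 := by
      refine Finset.prod_congr rfl fun f hf => ?_
      rw [if_neg (Finset.ne_of_mem_erase hf)]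
    rw [this, Finset.prod_ite_mem, Finset.prod_const]
    congr 2
    ext f
    simp only [Finset.mem_inter, Finset.mem_erase, Finset.mem_univ, and_true]
    refine and_iff_right_of_imp fun hf => ?_
    rintro rfl
    exact heF hf
  have hy1 : expMeasure 1 (Set.Iic y) ≤ ENNReal.ofReal y := by
    rw [expMeasure_one_Iic, max_eq_left hy]
    refine ENNReal.ofReal_le_ofReal ?_
    have := Real.add_one_le_exp (-y)
    linarith
  set μ := Measure.pi fun _ : Sym2 V => expMeasure 1 with hμ
  have hm : MeasurableSet {len : Sym2 V → ℝ | len e ≤ y ∧ walkLength len w < ENNReal.ofReal x} :=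
    (measurableSet_le (measurable_pi_apply e) measurable_const).inter
      (measurableSet_lt (measurable_walkLength w) measurable_const)
  calc μ {len | len e ≤ y ∧ walkLength len w < ENNReal.ofReal x}
      = ∫⁻ len, Set.indicator {len : Sym2 V → ℝ | len e ≤ y ∧
          walkLength len w < ENNReal.ofReal x} 1 len ∂μ := (lintegral_indicator_one hm).symm
    _ ≤ ∫⁻ len, ENNReal.ofReal (Real.exp (s * x)) * ENNReal.ofReal (∏ f, g f (len f)) ∂μ := by
        refine lintegral_mono fun len => ?_
        by_cases hlen : len ∈ {len : Sym2 V → ℝ | len e ≤ y ∧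
          walkLength len w < ENNReal.ofReal x}
        swap
        · rw [Set.indicator_of_notMem hlen]
          exact zero_le
        rw [Set.indicator_of_mem hlen]
        obtain ⟨h1, h2⟩ := hlen
        rw [walkLength_eq_ofReal_sum len hw, ← hF] at h2
        have h3 : ∑ f ∈ F, max (len f) 0 < x := (ENNReal.ofReal_lt_ofReal_iff_of_nonneg
          (Finset.sum_nonneg fun _ _ => le_max_right _ _)).1 h2
        rw [← ENNReal.ofReal_mul (Real.exp_nonneg _), Pi.one_apply, ← ENNReal.ofReal_one]
        refine ENNReal.ofReal_le_ofReal ?_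
        have h4 : ∏ f, g f (len f) = Real.exp (-(s * ∑ f ∈ F, max (len f) 0)) := by
          have h5 : ∀ f, g f (len f) = if f ∈ F then Real.exp (-(s * max (len f) 0)) else 1 := by
            intro f
            simp only [g]
            by_cases hfe : f = e
            · subst hfe
              simp [heF, h1]
            · simp [hfe]
          simp_rw [h5]
          rw [Finset.prod_ite_mem, Finset.univ_inter, ← Real.exp_sum, Finset.mul_sum,
            Finset.sum_neg_distrib]
        rw [h4, ← Real.exp_add, Real.one_le_exp_iff]
        nlinarith
    _ = ENNReal.ofReal (Real.exp (s * x)) *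
          (expMeasure 1 (Set.Iic y) * ENNReal.ofReal (1 / (1 + s)) ^ F.card) := by
        rw [lintegral_const_mul, hprod, hprodval]
        exact (Finset.measurable_prod _ fun f _ =>
          (hgm f).comp (measurable_pi_apply f)).ennreal_ofReal
    _ ≤ ENNReal.ofReal (Real.exp (s * x)) *
          (ENNReal.ofReal y * ENNReal.ofReal (1 / (1 + s)) ^ F.card) := by gcongr
    _ = _ := by
        rw [← ENNReal.ofReal_pow (by positivity), ← ENNReal.ofReal_mul hy,
          ← ENNReal.ofReal_mul (Real.exp_nonneg _)]
        congr 1; ring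

/-- The probability that `e` is an edge of length at most `y` with a detour shorter than `x`. -/
theorem EdgeIndep.measure_detour_le [IsProbabilityMeasure ν] (h : EdgeIndep ν q) {Δ κ s x y : ℝ}
    (hrow : ∀ u, ∑ v, q s(u, v) ≤ Δ) (hκ : ∀ e, q e ≤ κ) (hs : 0 ≤ s) (hΔ0 : 0 ≤ Δ)
    (hΔ : Δ < 1 + s) (hy : 0 ≤ y) (e : Sym2 V) :
    (ν.prod (Measure.pi fun _ : Sym2 V => expMeasure 1)) {z | z.1 ∈ {G | e ∈ G.edgeSet} ∧
        (z.2 e ≤ y ∧ edgeDist (z.1.deleteEdges {e}) z.2 e < ENNReal.ofReal x)} ≤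
      ENNReal.ofReal (q e * y * (Real.exp (s * x) * (κ / (1 + s - Δ)))) := by
  set μ := Measure.pi fun _ : Sym2 V => expMeasure 1 with hμ
  induction e using Sym2.ind with
  | _ u v =>
    by_cases huv : u = v
    · subst huv
      simp
    -- The weight of an edge: the probability that it is present times the Laplace transform `1 / (1
    -- + s)` of its length.
    let M : Sym2 V → ℝ := fun f => q f / (1 + s)
    have hM : ∀ f, 0 ≤ M f := fun f => div_nonneg (h.1 f) (by linarith)
    have hMrow : ∀ u, ∑ v, M s(u, v) ≤ Δ / (1 + s) := by
      intro u
      simp only [M, ← Finset.sum_div]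
      exact div_le_div_of_nonneg_right (hrow u) (by linarith)
    have hMκ : ∀ f, M f ≤ κ / (1 + s) := fun f =>
      div_le_div_of_nonneg_right (hκ f) (by linarith)
    let N := Fintype.card V
    let good : ∀ k, Finset ((⊤ : SimpleGraph V).Walk u v) := fun k =>
      {w ∈ (⊤ : SimpleGraph V).finsetWalkLength (k + 1) u v | w.edges.Nodup ∧ s(u, v) ∉ w.edges}
    let E : (⊤ : SimpleGraph V).Walk u v → Set (SimpleGraph V × (Sym2 V → ℝ)) := fun w =>
      {G | ((insert s(u, v) w.edges.toFinset : Finset _) : Set (Sym2 V)) ⊆ G.edgeSet} ×ˢ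
        {len | len s(u, v) ≤ y ∧ walkLength len w < ENNReal.ofReal x}
    -- A short detour can be shortened to a path, hence to a trail with fewer than `N` edges. It is
    -- viewed as a walk in the complete graph, so that the index set does not depend on the random
    -- graph.
    have hcover : {z : SimpleGraph V × (Sym2 V → ℝ) | z.1 ∈ {G | s(u, v) ∈ G.edgeSet} ∧
        (z.2 s(u, v) ≤ y ∧ edgeDist (z.1.deleteEdges {s(u, v)}) z.2 s(u, v) <
          ENNReal.ofReal x)} ⊆ ⋃ k ∈ Finset.range N, ⋃ w ∈ good k, E w := by
      rintro ⟨G, len⟩ ⟨h1, h2, h3⟩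
      dsimp only at h1 h2 h3
      rw [edgeDist_mk, shortestDist, iInf_lt_iff] at h3
      obtain ⟨p, hp⟩ := h3
      have hpath := p.bypass_isPath
      set p' := p.bypass.mapLe (le_top : G.deleteEdges {s(u, v)} ≤ ⊤) with hp'
      have hedges : p'.edges = p.bypass.edges := by simp [hp']
      have hlen : p'.length = p.bypass.length := by simp [hp']
      have hpos : 0 < p'.length := by
        rw [Nat.pos_iff_ne_zero]
        exact fun h0 => huv (SimpleGraph.Walk.eq_of_length_eq_zero h0)
      have hlt : p'.length < N := by
        rw [hlen]
        exact hpath.length_lt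
      have hmem : ∀ f ∈ p'.edges, f ∈ G.edgeSet ∧ f ≠ s(u, v) := by
        intro f hf
        rw [hedges] at hf
        have := p.bypass.edges_subset_edgeSet hf
        rw [SimpleGraph.edgeSet_deleteEdges] at this
        exact ⟨this.1, this.2⟩
      simp only [Set.mem_iUnion, Finset.mem_range]
      refine ⟨p'.length - 1, by omega, p', ?_, ?_⟩
      · simp only [good, Finset.mem_filter, SimpleGraph.mem_finsetWalkLength_iff]
        refine ⟨by omega, ?_, fun hf => (hmem _ hf).2 rfl⟩
        rw [hedges]
        exact hpath.isTrail.edges_nodup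
      · refine ⟨?_, h2, ?_⟩
        · simp only [Set.mem_ofPred_eq, Finset.coe_insert, List.coe_toFinset, Set.insert_subset_iff]
          exact ⟨h1, fun f hf => (hmem f hf).1⟩
        · rw [hp', walkLength_mapLe]
          exact (walkLength_bypass_le len p).trans_lt hp
    have hE : ∀ k, ∀ w ∈ good k, (ν.prod μ) (E w) ≤ ENNReal.ofReal
        (q s(u, v) * y * Real.exp (s * x) * (w.edges.map M).prod) := by
      intro k w hw
      simp only [good, Finset.mem_filter] at hw
      have hnd := hw.2.1
      have hne := hw.2.2
      rw [Measure.prod_prod, h.measure_subset_edgeSet, Finset.prod_insert (by simpa using hne)]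
      refine (mul_le_mul_right (measure_walkLength_lt_le hnd hne hs hy) _).trans (le_of_eq ?_)
      rw [← ENNReal.ofReal_mul (mul_nonneg (h.1 _) (Finset.prod_nonneg fun _ _ => h.1 _))]
      congr 1
      rw [← List.prod_toFinset _ hnd]
      simp only [M]
      simp_rw [div_eq_mul_one_div (q _) (1 + s)]
      rw [Finset.prod_mul_distrib, Finset.prod_const]
      ring
    have hnn : 0 ≤ q s(u, v) * y * Real.exp (s * x) :=
      mul_nonneg (mul_nonneg (h.1 _) hy) (Real.exp_nonneg _)
    have hwalk : ∀ k, ∑ w ∈ good k, (w.edges.map M).prod ≤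
        κ / (1 + s) * (Δ / (1 + s)) ^ k := by
      intro k
      refine le_trans ?_ (sum_finsetWalkLength_prod_le M hM (div_nonneg hΔ0 (by linarith)) hMrow
        hMκ k u v)
      refine Finset.sum_le_sum_of_subset_of_nonneg (Finset.filter_subset _ _) fun w _ _ => ?_
      refine List.prod_nonneg fun a ha => ?_
      obtain ⟨f, -, rfl⟩ := List.mem_map.1 ha
      exact hM f
    have hκ0 : 0 ≤ κ := (h.1 s(u, v)).trans (hκ _)
    have hρ : Δ / (1 + s) < 1 := by rw [div_lt_one (by linarith)]; exact hΔ
    calc _ ≤ (ν.prod μ) (⋃ k ∈ Finset.range N, ⋃ w ∈ good k, E w) := measure_mono hcover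
      _ ≤ ∑ k ∈ Finset.range N, ∑ w ∈ good k, (ν.prod μ) (E w) :=
          (measure_biUnion_finset_le _ _).trans (Finset.sum_le_sum fun k _ =>
            measure_biUnion_finset_le _ _)
      _ ≤ ∑ k ∈ Finset.range N, ENNReal.ofReal (q s(u, v) * y * Real.exp (s * x) *
            (κ / (1 + s) * (Δ / (1 + s)) ^ k)) := by
          refine Finset.sum_le_sum fun k _ => ?_
          refine (Finset.sum_le_sum (hE k)).trans ?_
          rw [← ENNReal.ofReal_sum_of_nonneg]
          · refine ENNReal.ofReal_le_ofReal ?_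
            rw [← Finset.mul_sum]
            exact mul_le_mul_of_nonneg_left (hwalk k) hnn
          · intro w _
            refine mul_nonneg hnn (List.prod_nonneg fun a ha => ?_)
            obtain ⟨f, -, rfl⟩ := List.mem_map.1 ha
            exact hM f
      _ = ENNReal.ofReal (q s(u, v) * y * Real.exp (s * x) *
            (κ / (1 + s) * ∑ k ∈ Finset.range N, (Δ / (1 + s)) ^ k)) := by
          rw [← ENNReal.ofReal_sum_of_nonneg]
          · rw [Finset.mul_sum, Finset.mul_sum]
          · intro k _
            refine mul_nonneg hnn ?_
            have : 0 ≤ 1 + s := by linarith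
            positivity
      _ ≤ _ := by
          refine ENNReal.ofReal_le_ofReal ?_
          have h1s : 0 < 1 + s := by linarith
          -- A geometric series with ratio `Δ / (1 + s) < 1`; times `κ / (1 + s)` it sums to `κ / (1
          -- + s - Δ)`.
          have hgeo : ∑ k ∈ Finset.range N, (Δ / (1 + s)) ^ k ≤ (1 - Δ / (1 + s))⁻¹ :=
            ((summable_geometric_of_lt_one (by positivity) hρ).sum_le_tsum _
              fun _ _ => by positivity).trans_eq (tsum_geometric_of_lt_one (by positivity) hρ)
          rw [mul_assoc (q s(u, v) * y)]
          refine mul_le_mul_of_nonneg_left ?_ (mul_nonneg (h.1 _) hy)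
          refine mul_le_mul_of_nonneg_left ?_ (Real.exp_nonneg _)
          refine (mul_le_mul_of_nonneg_left hgeo (by positivity)).trans_eq ?_
          rw [one_sub_div h1s.ne', inv_div, div_mul_div_cancel₀ h1s.ne']

end Detours

/-! ### Sequences of models and the lower bound on spanners -/

section Model

/-- A sequence of random graphs with independent edges and edge density `d n`. -/
structure IsModel (d : ℕ → ℝ) (ν : ∀ n, Measure (SimpleGraph (Fin n)))
    (q : ∀ n, Sym2 (Fin n) → ℝ) : Prop where
  prob : ∀ n, IsProbabilityMeasure (ν n)
  indep : ∀ n, EdgeIndep (ν n) (q n)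
  row : ∀ δ : ℝ, 0 < δ → ∀ᶠ n in atTop, ∀ u, ∑ v, q n s(u, v) ≤ (1 + δ) * (d n * n)
  le : ∀ᶠ n in atTop, ∀ e, q n e ≤ d n * Real.log n
  sum : ∀ δ : ℝ, 0 < δ → ∀ᶠ n in atTop,
    |∑ e, q n e - d n * n ^ 2 / 2| ≤ δ * (d n * n ^ 2 / 2)
  dense : Tendsto (fun n => d n * n / Real.log n) atTop atTop

/-- The joint law of the graph and the lengths. -/
noncomputable def jointLaw {n : ℕ} (ν : Measure (SimpleGraph (Fin n))) :
    Measure (SimpleGraph (Fin n) × (Sym2 (Fin n) → ℝ)) :=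
  ν.prod (Measure.pi fun _ : Sym2 (Fin n) => expMeasure 1)

instance {n : ℕ} (ν : Measure (SimpleGraph (Fin n))) [IsProbabilityMeasure ν] :
    IsProbabilityMeasure (jointLaw ν) := by
  unfold jointLaw
  infer_instance

theorem measurableSet_mem_edgeSet_and {V : Type*} [Fintype V] (e : Sym2 V)
    {B : SimpleGraph V → Set (Sym2 V → ℝ)} (hB : ∀ G, MeasurableSet (B G)) :
    MeasurableSet {x : SimpleGraph V × (Sym2 V → ℝ) | x.1 ∈ {G | e ∈ G.edgeSet} ∧ x.2 ∈ B x.1} :=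
  (measurable_fst (MeasurableSet.of_discrete (s := {G : SimpleGraph V | e ∈ G.edgeSet}))).inter
    (measurableSet_graph_prod hB)

/-- The event that `e` is an edge of length at most `y`. -/
def shortEvent {n : ℕ} (y : ℝ) (e : Sym2 (Fin n)) :
    Set (SimpleGraph (Fin n) × (Sym2 (Fin n) → ℝ)) :=
  {x | x.1 ∈ {G | e ∈ G.edgeSet} ∧ x.2 e ≤ y}

theorem measurableSet_shortEvent {n : ℕ} (y : ℝ) (e : Sym2 (Fin n)) :
    MeasurableSet (shortEvent y e) :=
  measurableSet_mem_edgeSet_and e (B := fun _ => {len | len e ≤ y}) fun _ =>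
    measurableSet_le (measurable_pi_apply e) measurable_const

theorem shortEvent_eq_prod {n : ℕ} (y : ℝ) (e : Sym2 (Fin n)) :
    shortEvent y e = {G | e ∈ G.edgeSet} ×ˢ {len | len e ≤ y} := rfl

theorem pi_setOf_le {ι : Type*} [Fintype ι] [DecidableEq ι] (y : ℝ) (e : ι) :
    Measure.pi (fun _ : ι => expMeasure 1) {len | len e ≤ y} = expMeasure 1 (Set.Iic y) := by
  have := pi_inter_eq_mul (ι := ι) (expMeasure 1) e (measurableSet_Iic (a := y))
    MeasurableSet.univ (by simp)
  simpa using this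

theorem jointLaw_real_shortEvent {n : ℕ} {ν : Measure (SimpleGraph (Fin n))}
    [IsProbabilityMeasure ν] {q : Sym2 (Fin n) → ℝ} (h : EdgeIndep ν q) {y : ℝ} (hy : 0 ≤ y)
    (e : Sym2 (Fin n)) :
    (jointLaw ν).real (shortEvent y e) = q e * (1 - Real.exp (-y)) := by
  have hexp : Real.exp (-y) ≤ 1 := by simpa using hy
  rw [measureReal_def, jointLaw, shortEvent_eq_prod, Measure.prod_prod, h.measure_mem_edgeSet,
    pi_setOf_le, expMeasure_one_Iic, max_eq_left hy, ← ENNReal.ofReal_mul (h.1 e),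
    ENNReal.toReal_ofReal (mul_nonneg (h.1 e) (by linarith))]

theorem jointLaw_real_shortEvent_inter {n : ℕ} {ν : Measure (SimpleGraph (Fin n))}
    [IsProbabilityMeasure ν] {q : Sym2 (Fin n) → ℝ} (h : EdgeIndep ν q) {y : ℝ} (hy : 0 ≤ y)
    {e f : Sym2 (Fin n)} (hef : e ≠ f) :
    (jointLaw ν).real (shortEvent y e ∩ shortEvent y f) =
      (jointLaw ν).real (shortEvent y e) * (jointLaw ν).real (shortEvent y f) := by
  have hexp : Real.exp (-y) ≤ 1 := by simpa using hy
  rw [jointLaw_real_shortEvent h hy, jointLaw_real_shortEvent h hy, measureReal_def, jointLaw,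
    shortEvent_eq_prod, shortEvent_eq_prod, Set.prod_inter_prod, Measure.prod_prod]
  have h1 : ({G : SimpleGraph (Fin n) | e ∈ G.edgeSet} ∩ {G | f ∈ G.edgeSet}) =
      {G | (({e, f} : Finset _) : Set (Sym2 (Fin n))) ⊆ G.edgeSet} := by
    ext G; simp [Set.insert_subset_iff]
  have h2 := pi_inter_eq_mul (ι := Sym2 (Fin n)) (expMeasure 1) e (measurableSet_Iic (a := y))
    (B := {len | len f ≤ y}) (measurableSet_le (measurable_pi_apply f) measurable_const)
    (by intro g a; simp [Function.update_of_ne hef.symm])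
  have h3 : ({len : Sym2 (Fin n) → ℝ | len e ≤ y} ∩ {len | len f ≤ y}) =
      {g | g e ∈ Set.Iic y ∧ g ∈ {len : Sym2 (Fin n) → ℝ | len f ≤ y}} := rfl
  rw [h1, h.measure_subset_edgeSet, Finset.prod_pair hef, h3, h2, pi_setOf_le,
    expMeasure_one_Iic, max_eq_left hy, ← ENNReal.ofReal_mul (by linarith),
    ← ENNReal.ofReal_mul (mul_nonneg (h.1 _) (h.1 _)), ENNReal.toReal_ofReal]
  · ring
  · exact mul_nonneg (mul_nonneg (h.1 _) (h.1 _)) (mul_nonneg (by linarith) (by linarith))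

theorem mul_one_sub_le_one_sub_exp_neg {y : ℝ} (hy : 0 ≤ y) : y * (1 - y) ≤ 1 - Real.exp (-y) := by
  have h1 := Real.add_one_le_exp y
  have h2 : Real.exp (-y) * Real.exp y = 1 := by rw [← Real.exp_add]; simp
  have h3 := Real.exp_pos (-y)
  have h4 : Real.exp (-y) * (1 + y) ≤ 1 := by nlinarith
  nlinarith [mul_nonneg hy hy, mul_nonneg (mul_nonneg hy hy) hy]

namespace IsModel
variable {d : ℕ → ℝ} {ν : ∀ n, Measure (SimpleGraph (Fin n))} {q : ∀ n, Sym2 (Fin n) → ℝ}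

theorem eventually_pos (h : IsModel d ν q) :
    ∀ᶠ n : ℕ in atTop, 0 < d n ∧ 1 < Real.log n ∧ 0 < (n : ℝ) := by
  have h1 : ∀ᶠ n : ℕ in atTop, 1 < Real.log n :=
    (Real.tendsto_log_atTop.comp tendsto_natCast_atTop_atTop).eventually_gt_atTop 1
  filter_upwards [h.dense.eventually_gt_atTop 0, h1, eventually_gt_atTop 0] with n hn hlog hn0
  have hn0' : (0 : ℝ) < n := by exact_mod_cast hn0
  refine ⟨?_, hlog, hn0'⟩
  rw [lt_div_iff₀ (by linarith), zero_mul] at hn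
  exact pos_of_mul_pos_left hn hn0'.le

open Classical in
/-- The number of edges of length at most `y` is concentrated around `d n² y / 2`. -/
theorem tendsto_shortEvent (h : IsModel d ν q) {y : ℕ → ℝ} (hy : ∀ᶠ n in atTop, 0 < y n)
    (hy0 : Tendsto y atTop (𝓝 0))
    (hM : Tendsto (fun n => d n * (n : ℝ) ^ 2 / 2 * y n) atTop atTop) {ε : ℝ} (hε : 0 < ε) :
    Tendsto (fun n => jointLaw (ν n) {x | ε * (d n * (n : ℝ) ^ 2 / 2 * y n) ≤
      |((Finset.univ.filter fun e => x ∈ shortEvent (y n) e).card : ℝ) -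
        d n * (n : ℝ) ^ 2 / 2 * y n|}) atTop (𝓝 0) := by
  -- Errors of order `δ` in `∑ q` and in `1 - exp(-y) ≈ y` keep the mean within `2 δ M ≤ ε M / 2` of
  -- `M`. Chebyshev's inequality gets the other `ε M / 2`.
  set δ := min (ε / 8) (1 / 2) with hδ
  have hδ0 : 0 < δ := lt_min (by linarith) (by norm_num)
  have hδ1 : δ ≤ ε / 8 := min_le_left _ _
  have hδ2 : δ ≤ 1 / 2 := min_le_right _ _
  have hlim : Tendsto (fun n => ENNReal.ofReal (8 / ε ^ 2 / (d n * (n : ℝ) ^ 2 / 2 * y n))) atTop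
      (𝓝 0) := by
    rw [← ENNReal.ofReal_zero]
    exact ENNReal.tendsto_ofReal (hM.const_div_atTop _)
  refine tendsto_of_tendsto_of_tendsto_of_le_of_le' tendsto_const_nhds hlim
    (Eventually.of_forall fun _ => zero_le) ?_
  filter_upwards [hy, hy0.eventually_lt_const hδ0, hM.eventually_gt_atTop 0, h.sum δ hδ0,
    h.eventually_pos] with n hy hyδ hM hsum hpos
  have := h.prob n
  set M := d n * (n : ℝ) ^ 2 / 2 * y n with hMdef
  set D := d n * (n : ℝ) ^ 2 / 2 with hD
  have hD0 : 0 < D := by have := hpos.1; have := hpos.2.2; positivity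
  set m := ∑ e, (jointLaw (ν n)).real (shortEvent (y n) e) with hm
  have hm' : m = (∑ e, q n e) * (1 - Real.exp (-y n)) := by
    rw [hm, Finset.sum_mul]
    exact Finset.sum_congr rfl fun e _ => jointLaw_real_shortEvent (h.indep n) hy.le e
  have hE1 := mul_one_sub_le_one_sub_exp_neg hy.le
  have hE2 : 1 - Real.exp (-y n) ≤ y n := by linarith [Real.add_one_le_exp (-y n)]
  rw [abs_le] at hsum
  have hq1 : (1 - δ) * D ≤ ∑ e, q n e := by linarith
  have hq2 : ∑ e, q n e ≤ (1 + δ) * D := by linarith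
  have hm1 : m ≤ (1 + δ) * M := by
    rw [hm', hMdef, ← mul_assoc]
    exact mul_le_mul hq2 hE2 (by nlinarith) (by positivity)
  have hm2 : (1 - 2 * δ) * M ≤ m := by
    rw [hm', hMdef]
    calc (1 - 2 * δ) * (D * y n) ≤ ((1 - δ) * D) * (y n * (1 - y n)) := by
          have : 1 - 2 * δ ≤ (1 - δ) * (1 - y n) := by nlinarith
          have h2 := mul_le_mul_of_nonneg_right this (mul_pos hD0 hy).le
          linarith
      _ ≤ _ := by
          refine mul_le_mul hq1 hE1 (mul_nonneg hy.le (by linarith)) ?_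
          refine le_trans ?_ hq1
          exact mul_nonneg (by linarith) hD0.le
  have hcheb := measure_le_abs_card_filter_sub_le (P := jointLaw (ν n))
    (B := fun e => shortEvent (y n) e) (measurableSet_shortEvent (y n))
    (fun i j hij => (jointLaw_real_shortEvent_inter (h.indep n) hy.le hij).le)
    (t := ε / 2 * M) (by positivity)
  refine (measure_mono fun x hx => ?_).trans (hcheb.trans (ENNReal.ofReal_le_ofReal ?_))
  · rw [Set.mem_ofPred_eq] at hx ⊢
    rw [← hm]
    set N := ((Finset.univ.filter fun e => x ∈ shortEvent (y n) e).card : ℝ)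
    have h1 : |N - M| ≤ |N - m| + |m - M| := abs_sub_le _ _ _
    have h2 : |m - M| ≤ ε / 2 * M := by
      rw [abs_le]; constructor <;> nlinarith
    linarith
  · rw [← hm, div_le_div_iff₀ (by positivity) hM]
    have h3 : m ≤ 2 * M := by nlinarith
    have h4 : 8 / ε ^ 2 * (ε / 2 * M) ^ 2 = 2 * M * M := by field_simp; ring
    rw [h4]
    exact mul_le_mul_of_nonneg_right h3 hM.le

/-- The event that `e` is an edge of length at most `y` with a detour shorter than `x`. -/
def _root_.RandomSpanner.detourEvent {n : ℕ} (y x : ℝ) (e : Sym2 (Fin n)) :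
    Set (SimpleGraph (Fin n) × (Sym2 (Fin n) → ℝ)) :=
  {z | z.1 ∈ {G | e ∈ G.edgeSet} ∧
    (z.2 e ≤ y ∧ edgeDist (z.1.deleteEdges {e}) z.2 e < ENNReal.ofReal x)}

theorem _root_.RandomSpanner.measurableSet_detourEvent {n : ℕ} (y x : ℝ) (e : Sym2 (Fin n)) :
    MeasurableSet (detourEvent y x e) :=
  measurableSet_mem_edgeSet_and e (B := fun G : SimpleGraph (Fin n) => {len : Sym2 (Fin n) → ℝ | len e ≤ y ∧
    edgeDist (G.deleteEdges {e}) len e < ENNReal.ofReal x}) fun _ =>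
      (measurableSet_le (measurable_pi_apply e) measurable_const).inter
        (measurableSet_lt (measurable_edgeDist _ e) measurable_const)

theorem _root_.RandomSpanner.tendsto_log_mul_rpow_neg {η : ℝ} (hη : 0 < η) :
    Tendsto (fun n : ℕ => Real.log n * Real.exp (-(η * Real.log n))) atTop (𝓝 0) := by
  have h1 := tendsto_rpow_mul_exp_neg_mul_atTop_nhds_zero 1 η hη
  have h2 := h1.comp (Real.tendsto_log_atTop.comp tendsto_natCast_atTop_atTop)
  refine h2.congr fun n => ?_
  simp [neg_mul]

open Classical in
/-- Only few short edges have a detour shorter than `(1 - η) log n / (d n)`. -/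
theorem tendsto_detourEvent (h : IsModel d ν q) {y : ℕ → ℝ} (hy : ∀ᶠ n in atTop, 0 < y n)
    {η ε : ℝ} (hη : 0 < η) (hη1 : η < 1) (hε : 0 < ε) :
    Tendsto (fun n => jointLaw (ν n) {z | ε * (d n * (n : ℝ) ^ 2 / 2 * y n) ≤
      (Finset.univ.filter fun e =>
        z ∈ detourEvent (y n) ((1 - η) * (Real.log n / (d n * n))) e).card}) atTop (𝓝 0) := by
  set δ := η / 8 with hδ
  have hδ0 : 0 < δ := by positivity
  have hlim : Tendsto (fun n : ℕ => ENNReal.ofReal (4 / (δ * ε) *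
      (Real.log n * Real.exp (-(η / 2 * Real.log n))))) atTop (𝓝 0) := by
    rw [← ENNReal.ofReal_zero]
    refine ENNReal.tendsto_ofReal ?_
    simpa using (tendsto_log_mul_rpow_neg (η := η / 2) (by positivity)).const_mul (4 / (δ * ε))
  refine tendsto_of_tendsto_of_tendsto_of_le_of_le' tendsto_const_nhds hlim
    (Eventually.of_forall fun _ => zero_le) ?_
  filter_upwards [hy, h.sum 1 one_pos, h.eventually_pos, h.row δ hδ0, h.le]
    with n hy hsum ⟨hd, hlog, hn⟩ hrow hle
  have := h.prob n
  have hdn : 0 < d n * n := by positivity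
  set M := d n * (n : ℝ) ^ 2 / 2 * y n with hMdef
  have hM : 0 < M := by positivity
  set Δ := (1 + δ) * (d n * n) with hΔ
  have hΔ0 : 0 < Δ := by positivity
  -- The tilt is just above the row bound `Δ`. Then `s x ≤ (1 - η / 2) log n`, while `1 + s - Δ` is
  -- still at least `δ d n`, so that the expected number of detours is `O(n ^ (-η/2) log n)`.
  set s := (1 + δ) * Δ with hs
  have hs0 : 0 < s := by positivity
  set x := (1 - η) * (Real.log n / (d n * n)) with hx
  set κ := d n * Real.log n with hκ
  have hden : 0 < 1 + s - Δ := by nlinarith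
  have hterm : ∀ e, jointLaw (ν n) (detourEvent (y n) x e) ≤ _ := fun e =>
    (h.indep n).measure_detour_le hrow hle hs0.le hΔ0.le (by nlinarith) hy.le e (x := x)
  refine (measure_le_card_filter_le (measurableSet_detourEvent (y n) x)
    (by positivity : 0 < ε * M)).trans ?_
  have hK : 0 ≤ Real.exp (s * x) * (κ / (1 + s - Δ)) := by positivity
  have hsumle : ∑ e, jointLaw (ν n) (detourEvent (y n) x e) ≤
      ENNReal.ofReal (2 * M * (Real.exp (s * x) * (κ / (1 + s - Δ)))) := by
    refine (Finset.sum_le_sum fun e _ => hterm e).trans ?_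
    rw [← ENNReal.ofReal_sum_of_nonneg fun e _ =>
      mul_nonneg (mul_nonneg ((h.indep n).1 e) hy.le) hK]
    refine ENNReal.ofReal_le_ofReal ?_
    rw [← Finset.sum_mul, ← Finset.sum_mul]
    refine mul_le_mul_of_nonneg_right ?_ hK
    rw [abs_le] at hsum
    rw [hMdef, ← mul_assoc]
    exact mul_le_mul_of_nonneg_right (by linarith) hy.le
  refine (ENNReal.div_le_div_right hsumle _).trans ?_
  rw [← ENNReal.ofReal_div_of_pos (by positivity)]
  refine ENNReal.ofReal_le_ofReal ?_
  have hsx : s * x ≤ Real.log n - η / 2 * Real.log n := by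
    have h1 : s * x = (1 + δ) ^ 2 * (1 - η) * Real.log n := by
      rw [hs, hΔ, hx]
      field_simp
    have h2 : (1 + δ) ^ 2 * (1 - η) ≤ 1 - η / 2 := by
      have h3 : (1 + δ) ^ 2 ≤ 1 + 3 * δ := by nlinarith
      have h4 : (1 + δ) ^ 2 * (1 - η) ≤ (1 + 3 * δ) * (1 - η) :=
        mul_le_mul_of_nonneg_right h3 (by linarith)
      nlinarith
    rw [h1]
    nlinarith
  have hexp : Real.exp (s * x) ≤ n * Real.exp (-(η / 2 * Real.log n)) := by
    refine (Real.exp_le_exp.2 hsx).trans_eq ?_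
    rw [sub_eq_add_neg, Real.exp_add, Real.exp_log hn]
  have hdenle : δ * (d n * n) ≤ 1 + s - Δ := by nlinarith
  calc 2 * M * (Real.exp (s * x) * (κ / (1 + s - Δ))) / (ε * M)
      = 2 / ε * (Real.exp (s * x) * (κ / (1 + s - Δ))) := by field_simp
    _ ≤ 2 / ε * ((n * Real.exp (-(η / 2 * Real.log n))) * (κ / (δ * (d n * n)))) := by
        gcongr
    _ = 2 / (δ * ε) * (Real.log n * Real.exp (-(η / 2 * Real.log n))) := by
        rw [hκ]; field_simp
    _ ≤ _ := by gcongr; norm_num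

/-- With high probability every `lam n`-spanner has almost `n log n / (2 lam n)` edges. -/
theorem tendsto_card_isSpanner_lt (h : IsModel d ν q) {lam : ℕ → ℝ} {C : ℝ}
    (hlam : ∀ᶠ n in atTop, 1 ≤ lam n ∧ lam n ≤ C) {ε : ℝ} (hε : 0 < ε) :
    Tendsto (fun n => jointLaw (ν n) {x | ∃ S, IsSpanner x.1 x.2 (lam n) S ∧
      (S.card : ℝ) < (1 / 2 - ε) * (n * Real.log n / lam n)}) atTop (𝓝 0) := by
  classical
  set η := min (ε / 2) (1 / 4) with hη
  have hη0 : 0 < η := lt_min (by linarith) (by norm_num)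
  have hη1 : η ≤ ε / 2 := min_le_left _ _
  have hη2 : η ≤ 1 / 4 := min_le_right _ _
  -- Edges of length at most `y` have `lam * len ≤ (1 - 2 η) L`, strictly below the detour bound `(1
  -- - η) L`.
  let y : ℕ → ℝ := fun n => (1 - 2 * η) * (Real.log n / (d n * n)) / lam n
  have hy : ∀ᶠ n in atTop, 0 < y n := by
    filter_upwards [h.eventually_pos, hlam] with n ⟨hd, hlog, hn⟩ hl
    have : 0 < lam n := by linarith
    have : 0 < 1 - 2 * η := by linarith
    simp only [y]
    positivity
  have hL : Tendsto (fun n : ℕ => Real.log n / (d n * n)) atTop (𝓝 0) :=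
    h.dense.inv_tendsto_atTop.congr fun n => by simp
  have hy0 : Tendsto y atTop (𝓝 0) := by
    refine tendsto_of_tendsto_of_tendsto_of_le_of_le' tendsto_const_nhds hL
      (hy.mono fun _ h => h.le) ?_
    filter_upwards [h.eventually_pos, hlam] with n ⟨hd, hlog, hn⟩ hl
    have hL0 : 0 < Real.log n / (d n * n) := by positivity
    simp only [y]
    rw [div_le_iff₀ (by linarith)]
    nlinarith
  have hMval : ∀ᶠ n : ℕ in atTop, d n * (n : ℝ) ^ 2 / 2 * y n =
      (1 - 2 * η) / 2 * (n * Real.log n / lam n) := by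
    filter_upwards [h.eventually_pos, hlam] with n ⟨hd, hlog, hn⟩ hl
    have : 0 < lam n := by linarith
    simp only [y]
    field_simp
  have hM : Tendsto (fun n => d n * (n : ℝ) ^ 2 / 2 * y n) atTop atTop := by
    have h1 : Tendsto (fun n : ℕ => (1 - 2 * η) / 2 / C * (n : ℝ)) atTop atTop := by
      refine Tendsto.const_mul_atTop ?_ tendsto_natCast_atTop_atTop
      obtain ⟨n, hn⟩ := hlam.exists
      have : 0 < C := by linarith
      have : 0 < 1 - 2 * η := by linarith
      positivity
    refine tendsto_atTop_mono' _ ?_ h1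
    filter_upwards [h.eventually_pos, hlam, hMval] with n ⟨hd, hlog, hn⟩ hl hv
    rw [hv, div_mul_eq_mul_div, mul_div_assoc]
    have : 0 < lam n := by linarith
    refine mul_le_mul_of_nonneg_left ?_ (by linarith)
    refine div_le_div₀ (by positivity) ?_ this hl.2
    nlinarith
  have hA := h.tendsto_shortEvent hy hy0 hM hη0
  have hB := h.tendsto_detourEvent hy hη0 (by linarith) hη0
  have hAB := hA.add hB
  rw [add_zero] at hAB
  refine tendsto_of_tendsto_of_tendsto_of_le_of_le' tendsto_const_nhds hAB
    (Eventually.of_forall fun _ => zero_le) ?_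
  filter_upwards [h.eventually_pos, hlam, hMval, hy] with n ⟨hd, hlog, hn⟩ hl hv hyn
  refine (measure_mono ?_).trans (measure_union_le _ _)
  rintro ⟨G, len⟩ ⟨S, hS, hlt⟩
  by_contra hcon
  simp only [Set.mem_union, Set.mem_ofPred_eq, not_or, not_le] at hcon
  obtain ⟨h1, h2⟩ := hcon
  set M := d n * (n : ℝ) ^ 2 / 2 * y n with hMdef
  set N := Finset.univ.filter fun e => (G, len) ∈ shortEvent (y n) e with hN
  set Z := Finset.univ.filter fun e =>
    (G, len) ∈ detourEvent (y n) ((1 - η) * (Real.log n / (d n * n))) e with hZ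
  -- A short edge without a short detour is forced into every spanner.
  have hsub : N \ Z ⊆ S := by
    intro e he
    rw [Finset.mem_sdiff, hN, hZ, Finset.mem_filter, Finset.mem_filter] at he
    obtain ⟨⟨-, he1, he2⟩, he3⟩ := he
    have he4 := not_lt.1 fun hlt' => he3 ⟨Finset.mem_univ _, he1, he2, hlt'⟩
    refine hS.mem_of_lt he1 (lt_of_lt_of_le ?_ he4)
    rw [← ENNReal.ofReal_mul (by linarith)]
    refine (ENNReal.ofReal_lt_ofReal_iff ?_).2 ?_
    · have : 0 < 1 - η := by linarith
      positivity
    · calc lam n * len e ≤ lam n * y n := mul_le_mul_of_nonneg_left he2 (by linarith)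
        _ = (1 - 2 * η) * (Real.log n / (d n * n)) := by
            simp only [y]
            rw [mul_div_cancel₀ _ (by linarith)]
        _ < _ := by
            refine mul_lt_mul_of_pos_right (by linarith) (by positivity)
  have hcard : (N.card : ℝ) ≤ Z.card + S.card := by
    have h3 : N.card ≤ (N \ Z).card + Z.card := by
      rw [← Finset.card_union_of_disjoint Finset.sdiff_disjoint, Finset.sdiff_union_self_eq_union]
      exact Finset.card_le_card Finset.subset_union_left
    have h4 := Finset.card_le_card hsub
    have : N.card ≤ Z.card + S.card := by omega
    exact_mod_cast this
  rw [abs_lt] at h1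
  have h5 : (1 - 2 * η) * M ≤ S.card := by linarith [h1.1]
  have hX : 0 < n * Real.log n / lam n := by
    have : 0 < lam n := by linarith
    positivity
  rw [hv] at h5
  -- One factor `1 - 2 η` comes from fluctuations and discarded edges (`η M` each), the other from
  -- the choice of `y`.
  have h6 : 1 / 2 - ε ≤ (1 - 2 * η) * ((1 - 2 * η) / 2) := by nlinarith
  nlinarith

end IsModel
end Model

/-! ### Expansion conditions and growth inside a vertex set -/

section Expansion
variable {V : Type*} [Fintype V]

open Classical in
/-- Every nonempty set `S ⊆ A` with fewer than `m` vertices sends at least `r |S|` edges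
to `A \ S`. -/
def Grows (G : SimpleGraph V) (A : Finset V) (m : ℕ) (r : ℕ → ℝ) : Prop :=
  ∀ S ⊆ A, S.Nonempty → S.card < m → r S.card ≤ (G.interedges S (A \ S)).card

/-- The graph of the edges of `G` with both ends in `A`. -/
def restrictTo (G : SimpleGraph V) (A : Finset V) : SimpleGraph V where
  Adj x y := G.Adj x y ∧ x ∈ A ∧ y ∈ A
  symm := ⟨fun _ _ h => ⟨h.1.symm, h.2.2, h.2.1⟩⟩
  loopless := ⟨fun _ h => G.irrefl h.1⟩

theorem restrictTo_le (G : SimpleGraph V) (A : Finset V) : restrictTo G A ≤ G := fun _ _ h => h.1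

-- Exploring `restrictTo G A` keeps the ball inside `A`. This equality lets `Grows` feed the
-- Chernoff bound.
open Classical in
theorem card_edgeBoundary_restrictTo (G : SimpleGraph V) {A S : Finset V} (hS : S ⊆ A) :
    (edgeBoundary (restrictTo G A) S).card = (G.interedges S (A \ S)).card := by
  rw [card_edgeBoundary]
  congr 1
  ext ⟨x, y⟩
  rw [SimpleGraph.mem_interedges_iff, SimpleGraph.mem_interedges_iff, Finset.mem_compl,
    Finset.mem_sdiff]
  constructor
  · rintro ⟨hx, hy, h, -, hyA⟩; exact ⟨hx, ⟨hyA, hy⟩, h⟩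
  · rintro ⟨hx, ⟨hyA, hy⟩, h⟩; exact ⟨hx, hy, h, hS hx, hyA⟩

theorem ball_restrictTo_subset (G : SimpleGraph V) {A : Finset V} {u : V} (hu : u ∈ A)
    (len : Sym2 V → ℝ) (t : ℝ) : ball (restrictTo G A) len {u} t ⊆ A := by
  intro v hv
  obtain ⟨u', hu', p, -⟩ := mem_ball.1 hv
  rw [Finset.mem_singleton] at hu'
  subst hu'
  cases p with
  | nil => exact hu
  | cons h p => exact h.2.1

theorem shortestDist_le_of_mem_ball {G : SimpleGraph V} {len : Sym2 V → ℝ} {u v : V} {t : ℝ}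
    (hv : v ∈ ball G len {u} t) : shortestDist G len u v ≤ ENNReal.ofReal t := by
  obtain ⟨u', hu', p, hp⟩ := mem_ball.1 hv
  rw [Finset.mem_singleton] at hu'
  subst hu'
  rw [shortestDist_comm]
  exact (shortestDist_le_walkLength p).trans hp

/-- The expected total waiting time for the rates `r` is at most `κ log n / D`, and the rates
are at least `c D`. -/
def RateBound (n : ℕ) (D c κ : ℝ) (m : ℕ) (r : ℕ → ℝ) : Prop :=
  (∀ k, 1 ≤ k → k < m → c * D ≤ r k) ∧ ∑ k ∈ Finset.Ico 1 m, 1 / r k ≤ κ * (Real.log n / D)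

/-- The tilt `s = η c D` is admissible because all rates are at least `c D`. The bound is a power of
`n`, with negative exponent as soon as `τ > κ / (1 - η)`. -/
theorem measure_card_ball_restrictTo_lt_le {G : SimpleGraph V} {A : Finset V} {m : ℕ}
    {r : ℕ → ℝ} (hG : Grows G A m r) {n : ℕ} {D c κ η : ℝ} (hr : RateBound n D c κ m r)
    (hD : 0 < D) (hc : 0 < c) (hη0 : 0 < η) (hη : η < 1) {u : V} (hu : u ∈ A) {τ : ℝ}
    (hτ : 0 ≤ τ * (Real.log n / D)) :
    Measure.pi (fun _ : Sym2 V => expMeasure 1)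
        {len | (ball (restrictTo G A) len {u} (τ * (Real.log n / D))).card < m} ≤
      ENNReal.ofReal (Real.exp (η * c * (κ / (1 - η) - τ) * Real.log n)) := by
  have h := measure_card_ball_lt_le_exp (H := restrictTo G A) (A := A) (r := r) (m := m)
    (s := η * (c * D)) (η := η) (T := κ * (Real.log n / D)) (by positivity) hη0.le hη
    (fun v w hvw _ => hvw.2.2) (fun S hS hne hlt => by
      rw [card_edgeBoundary_restrictTo G hS]
      exact hG S hS hne hlt)
    (fun k h1 h2 => mul_le_mul_of_nonneg_left (hr.1 k h1 h2) hη0.le) hr.2 hu hτ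
  refine h.trans_eq ?_
  congr 2
  field_simp

end Expansion

/-- With high probability the random graphs expand so well that the ball of radius
`κ log n / (d n)` around a vertex contains more than half of the vertices for some constant `κ`,
and, for most vertices, almost all neighbours for each `κ > 1`. -/
structure IsExpanding (d : ℕ → ℝ) (ν : ∀ n, Measure (SimpleGraph (Fin n)))
    (q : ∀ n, Sym2 (Fin n) → ℝ) : Prop where
  half : ∃ C c : ℝ, 0 < C ∧ 0 < c ∧ ∃ r : ∀ _ : ℕ, ℕ → ℝ,
    (∀ᶠ n : ℕ in atTop, RateBound n (d n * n) c C (n / 2 + 1) (r n)) ∧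
    Tendsto (fun n => ν n {G | Grows G Finset.univ (n / 2 + 1) (r n)}ᶜ) atTop (𝓝 0)
  most : ∀ ε : ℝ, 0 < ε → ∃ c : ℝ, 0 < c ∧ ∃ good : ∀ n, Set (SimpleGraph (Fin n)),
    Tendsto (fun n => ν n (good n)ᶜ) atTop (𝓝 0) ∧
    ∀ᶠ n : ℕ in atTop, ∃ U : Finset (Fin n), (U.card : ℝ) ≤ ε * n ∧ ∀ u ∉ U,
      ∃ (A : Finset (Fin n)) (m : ℕ) (r : ℕ → ℝ) (κ : ℝ), u ∈ A ∧
        ∑ v ∈ Aᶜ, q n s(u, v) ≤ ε * (d n * n) ∧ (∀ e, q n e ≤ κ) ∧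
        (A.card - m) * κ ≤ ε * (d n * n) ∧ RateBound n (d n * n) c (1 + ε) m r ∧
        ∀ G ∈ good n, Grows G A m r

/-! ### The diameter and the upper bound on tight edges -/

namespace IsModel
variable {d : ℕ → ℝ} {ν : ∀ n, Measure (SimpleGraph (Fin n))} {q : ∀ n, Sym2 (Fin n) → ℝ}

/-- With high probability the diameter is `O(log n / (d n))`. -/
theorem exists_tendsto_diam (h : IsModel d ν q) (hexp : IsExpanding d ν q) :
    ∃ K : ℝ, 0 < K ∧ Tendsto (fun n : ℕ => jointLaw (ν n) {x | ¬ ∀ u v,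
      shortestDist x.1 x.2 u v ≤ ENNReal.ofReal (K * (Real.log n / (d n * n)))}) atTop (𝓝 0) := by
  classical
  obtain ⟨C, c, hC, hc, r, hr, hgood⟩ := hexp.half
  -- With `η = 1/2` the exponent `(c / 2) (2 C - τ)` equals `-2`, which beats the union bound over
  -- `n` vertices.
  set τ := 2 * C + 4 / c with hτ
  have hτ0 : 0 < τ := by positivity
  refine ⟨2 * τ, by positivity, ?_⟩
  have hlim : Tendsto (fun n : ℕ => ν n {G | Grows G Finset.univ (n / 2 + 1) (r n)}ᶜ +
      ENNReal.ofReal (1 / (n : ℝ))) atTop (𝓝 0) := by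
    rw [← add_zero (0 : ℝ≥0∞)]
    refine hgood.add ?_
    rw [← ENNReal.ofReal_zero]
    exact ENNReal.tendsto_ofReal tendsto_one_div_atTop_nhds_zero_nat
  refine tendsto_of_tendsto_of_tendsto_of_le_of_le' tendsto_const_nhds hlim
    (Eventually.of_forall fun _ => zero_le) ?_
  filter_upwards [h.eventually_pos, hr] with n ⟨hd, hlog, hn⟩ hr
  have := h.prob n
  have hD : 0 < d n * n := by positivity
  set t := τ * (Real.log n / (d n * n)) with ht
  have ht0 : 0 ≤ t := by positivity
  set good := {G : SimpleGraph (Fin n) | Grows G Finset.univ (n / 2 + 1) (r n)} with hgoodn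
  let B : Fin n → SimpleGraph (Fin n) → Set (Sym2 (Fin n) → ℝ) := fun u G =>
    if Grows G Finset.univ (n / 2 + 1) (r n) then
      {len | (ball (restrictTo G Finset.univ) len {u} t).card < n / 2 + 1} else ∅
  have hBm : ∀ u G, MeasurableSet (B u G) := by
    intro u G
    simp only [B]
    split_ifs
    · exact measurableSet_card_ball_lt _ _ _ _
    · exact MeasurableSet.empty
  have hB : ∀ u G, Measure.pi (fun _ : Sym2 (Fin n) => expMeasure 1) (B u G) ≤
      ENNReal.ofReal (1 / (n : ℝ) ^ 2) := by
    intro u G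
    simp only [B]
    split_ifs with hG
    · refine (measure_card_ball_restrictTo_lt_le hG hr hD hc (η := 1 / 2) (by norm_num)
        (by norm_num) (Finset.mem_univ u) ht0).trans (ENNReal.ofReal_le_ofReal (le_of_eq ?_))
      have : (1 / 2 : ℝ) * c * (C / (1 - 1 / 2) - τ) * Real.log n = -(Real.log (n ^ 2)) := by
        rw [Real.log_pow, hτ]
        field_simp
        push_cast
        ring
      rw [this, Real.exp_neg, Real.exp_log (by positivity), one_div]
    · simp
  have hcover : {x : SimpleGraph (Fin n) × (Sym2 (Fin n) → ℝ) | ¬ ∀ u v, shortestDist x.1 x.2 u v ≤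
      ENNReal.ofReal (2 * τ * (Real.log n / (d n * n)))} ⊆
      (goodᶜ ×ˢ Set.univ) ∪ ⋃ u, {x | x.2 ∈ B u x.1} := by
    rintro ⟨G, len⟩ hx
    by_contra hcon
    simp only [Set.mem_union, Set.mem_prod, Set.mem_compl_iff, Set.mem_univ, and_true,
      Set.mem_iUnion, not_or, not_not, not_exists] at hcon
    obtain ⟨hG, hball⟩ := hcon
    refine hx fun u v => ?_
    have hcard : ∀ u, n / 2 + 1 ≤ (ball (restrictTo G Finset.univ) len {u} t).card := by
      intro u
      have := hball u
      have hG' : Grows G Finset.univ (n / 2 + 1) (r n) := hG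
      simp only [B, Set.mem_ofPred_eq, if_pos hG', not_lt] at this
      exact this
    -- Two balls with more than `n / 2` vertices each must meet.
    have hint : ¬ Disjoint (ball (restrictTo G Finset.univ) len {u} t)
        (ball (restrictTo G Finset.univ) len {v} t) := by
      intro hdis
      have h1 := Finset.card_union_of_disjoint hdis
      have h2 := Finset.card_le_univ (ball (restrictTo G Finset.univ) len {u} t ∪
        ball (restrictTo G Finset.univ) len {v} t)
      rw [Fintype.card_fin] at h2
      have := hcard u
      have := hcard v
      omega
    obtain ⟨w, hw1, hw2⟩ := Finset.not_disjoint_iff.1 hint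
    have h1 := shortestDist_le_of_mem_ball hw1
    have h2 := shortestDist_le_of_mem_ball hw2
    refine (shortestDist_mono (restrictTo_le G Finset.univ) u v).trans ?_
    refine (shortestDist_triangle _ len u w v).trans ?_
    rw [shortestDist_comm _ _ w v]
    refine (add_le_add h1 h2).trans_eq ?_
    rw [← ENNReal.ofReal_add ht0 ht0, ht]
    congr 1; ring
  refine (measure_mono hcover).trans ((measure_union_le _ _).trans (add_le_add ?_ ?_))
  · rw [jointLaw, Measure.prod_prod, measure_univ, mul_one]
  · refine (measure_iUnion_fintype_le _ _).trans ?_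
    have hu : ∀ u, jointLaw (ν n) {x | x.2 ∈ B u x.1} ≤ ENNReal.ofReal (1 / (n : ℝ) ^ 2) := by
      intro u
      rw [jointLaw, graph_prod_apply _ _ (hBm u)]
      refine (lintegral_mono (hB u)).trans ?_
      simp
    refine (Finset.sum_le_sum fun u _ => hu u).trans_eq ?_
    rw [Finset.sum_const, Finset.card_univ, Fintype.card_fin, nsmul_eq_mul,
      ← ENNReal.ofReal_natCast, ← ENNReal.ofReal_mul hn.le]
    congr 1
    field_simp

/-- The event that `e` is an edge with length in `(a, b]` without a detour shorter than `a`. -/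
def _root_.RandomSpanner.longEvent {n : ℕ} (a b : ℝ) (e : Sym2 (Fin n)) :
    Set (SimpleGraph (Fin n) × (Sym2 (Fin n) → ℝ)) :=
  {x | x.1 ∈ {G | e ∈ G.edgeSet} ∧
    (x.2 e ∈ Set.Ioc a b ∧ ENNReal.ofReal a ≤ edgeDist (x.1.deleteEdges {e}) x.2 e)}

theorem _root_.RandomSpanner.measurableSet_longEvent {n : ℕ} (a b : ℝ) (e : Sym2 (Fin n)) :
    MeasurableSet (longEvent a b e) :=
  measurableSet_mem_edgeSet_and e (B := fun G : SimpleGraph (Fin n) =>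
    {len : Sym2 (Fin n) → ℝ | len e ∈ Set.Ioc a b ∧
      ENNReal.ofReal a ≤ edgeDist (G.deleteEdges {e}) len e}) fun _ =>
      ((measurable_pi_apply e) measurableSet_Ioc).inter
        (measurableSet_le measurable_const (measurable_edgeDist _ e))

theorem _root_.RandomSpanner.sum_sym2_le_sum_sum {n : ℕ} (f : Sym2 (Fin n) → ℝ≥0∞) :
    ∑ e, f e ≤ ∑ u, ∑ v, f s(u, v) := by
  classical
  rw [← Finset.sum_product', Finset.univ_product_univ]
  have h1 : (Finset.univ : Finset (Sym2 (Fin n))) =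
      (Finset.univ : Finset (Fin n × Fin n)).image fun x => s(x.1, x.2) := by
    ext e
    simp only [Finset.mem_univ, Finset.mem_image, true_and, Prod.exists, true_iff]
    induction e using Sym2.ind with
    | _ u v => exact ⟨u, v, rfl⟩
  rw [h1]
  exact Finset.sum_image_le_of_nonneg fun _ _ => zero_le

/-- The expected number of vertices near `u` that are not reached quickly, weighted with the
probability of an edge to `u`. -/
theorem _root_.RandomSpanner.sum_mul_measure_le {n : ℕ} {G : SimpleGraph (Fin n)}
    {q : Sym2 (Fin n) → ℝ} (hq : ∀ e, 0 ≤ q e) {A : Finset (Fin n)} {m : ℕ} {u : Fin n}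
    (hu : u ∈ A) {κ ρ R π a t : ℝ} (hκ : ∀ e, q e ≤ κ) (hout : ∑ v ∈ Aᶜ, q s(u, v) ≤ ρ)
    (hin : (A.card - m) * κ ≤ ρ) (hR : ∑ v, q s(u, v) ≤ R) (hta : t < a) (ha : 0 < a)
    (hball : Measure.pi (fun _ : Sym2 (Fin n) => expMeasure 1)
      {len | (ball (restrictTo G A) len {u} t).card < m} ≤ ENNReal.ofReal π) :
    ∑ v, ENNReal.ofReal (q s(u, v)) * Measure.pi (fun _ : Sym2 (Fin n) => expMeasure 1)
        {len | ENNReal.ofReal a ≤ shortestDist G len u v} ≤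
      ENNReal.ofReal (2 * ρ) + ENNReal.ofReal R * ENNReal.ofReal π := by
  classical
  set μ := Measure.pi fun _ : Sym2 (Fin n) => expMeasure 1 with hμ
  have hmeas : ∀ v, MeasurableSet {len : Sym2 (Fin n) → ℝ |
      ENNReal.ofReal a ≤ shortestDist G len u v} := fun v =>
    measurableSet_le measurable_const (measurable_shortestDist G u v)
  have h1 : ∑ v, ENNReal.ofReal (q s(u, v)) * μ {len | ENNReal.ofReal a ≤ shortestDist G len u v} =
      ∫⁻ len, ∑ v, ENNReal.ofReal (q s(u, v)) *
        Set.indicator {len | ENNReal.ofReal a ≤ shortestDist G len u v} 1 len ∂μ := by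
    rw [lintegral_finsetSum _ fun v _ => (measurable_one.indicator (hmeas v)).const_mul _]
    refine Finset.sum_congr rfl fun v _ => ?_
    rw [lintegral_const_mul _ (measurable_one.indicator (hmeas v)),
      lintegral_indicator_one (hmeas v)]
  have hBm : MeasurableSet {len : Sym2 (Fin n) → ℝ |
      (ball (restrictTo G A) len {u} t).card < m} := measurableSet_card_ball_lt _ _ _ _
  rw [h1]
  calc _ ≤ ∫⁻ len, (ENNReal.ofReal (2 * ρ) + ENNReal.ofReal R *
        Set.indicator {len | (ball (restrictTo G A) len {u} t).card < m} 1 len) ∂μ := by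
        refine lintegral_mono fun len => ?_
        by_cases hlen : (ball (restrictTo G A) len {u} t).card < m
        · have hlen' : len ∈ {len : Sym2 (Fin n) → ℝ |
            (ball (restrictTo G A) len {u} t).card < m} := hlen
          rw [Set.indicator_of_mem hlen', Pi.one_apply, mul_one]
          refine le_trans ?_ le_add_self
          refine (Finset.sum_le_sum (g := fun v => ENNReal.ofReal (q s(u, v))) fun v _ => ?_).trans ?_
          · refine mul_le_of_le_one_right' ?_
            exact Set.indicator_le_self' (fun _ _ => zero_le) len
          · rw [← ENNReal.ofReal_sum_of_nonneg fun v _ => hq _]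
            exact ENNReal.ofReal_le_ofReal hR
        · refine le_trans ?_ le_self_add
          have h2 : ∀ v, ENNReal.ofReal (q s(u, v)) *
              Set.indicator {len | ENNReal.ofReal a ≤ shortestDist G len u v} 1 len ≤
              if v ∉ ball (restrictTo G A) len {u} t then ENNReal.ofReal (q s(u, v)) else 0 := by
            intro v
            by_cases hv : v ∈ ball (restrictTo G A) len {u} t
            · have h3 : shortestDist G len u v < ENNReal.ofReal a :=
                (shortestDist_mono (restrictTo_le G A) u v).trans_lt
                  ((shortestDist_le_of_mem_ball hv).trans_lt
                    ((ENNReal.ofReal_lt_ofReal_iff ha).2 hta))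
              rw [Set.indicator_of_notMem (by simpa using h3)]
              simp
            · rw [if_pos hv]
              refine mul_le_of_le_one_right' ?_
              exact Set.indicator_le_self' (fun _ _ => zero_le) len
          refine (Finset.sum_le_sum fun v _ => h2 v).trans ?_
          rw [← Finset.sum_filter, ← ENNReal.ofReal_sum_of_nonneg fun v _ => hq _]
          refine ENNReal.ofReal_le_ofReal ?_
          set B := ball (restrictTo G A) len {u} t with hB
          have hBA : B ⊆ A := ball_restrictTo_subset G hu len t
          -- Vertices not reached are outside `A`, or among the at most `A.card - m` missed ones in
          -- `A`; each group has weight at most `ρ`.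
          have h4 : (Finset.univ.filter fun v => v ∉ B) = Aᶜ ∪ (A \ B) := by
            ext v
            simp only [Finset.mem_filter, Finset.mem_univ, true_and, Finset.mem_union,
              Finset.mem_compl, Finset.mem_sdiff]
            constructor
            · intro hv; by_cases hvA : v ∈ A <;> simp [hv, hvA]
            · rintro (hv | hv)
              exacts [fun hvB => hv (hBA hvB), hv.2]
          rw [h4]
          rw [Finset.sum_union (Finset.disjoint_left.2 fun v hv hv' =>
            (Finset.mem_compl.1 hv) (Finset.mem_sdiff.1 hv').1)]
          have h5 : ∑ v ∈ A \ B, q s(u, v) ≤ (A.card - B.card) * κ := by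
            refine (Finset.sum_le_card_nsmul _ _ κ fun v _ => hκ _).trans_eq ?_
            rw [nsmul_eq_mul, Finset.card_sdiff_of_subset hBA,
              Nat.cast_sub (Finset.card_le_card hBA)]
          have h6 : (m : ℝ) ≤ B.card := by exact_mod_cast not_lt.1 hlen
          have hκ0 : 0 ≤ κ := (hq s(u, u)).trans (hκ _)
          nlinarith
    _ = ENNReal.ofReal (2 * ρ) + ENNReal.ofReal R *
        μ {len | (ball (restrictTo G A) len {u} t).card < m} := by
        rw [lintegral_add_left measurable_const, lintegral_const, measure_univ, mul_one,
          lintegral_const_mul _ (measurable_one.indicator hBm), lintegral_indicator_one hBm]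
    _ ≤ _ := by gcongr

end IsModel

namespace IsModel
variable {d : ℕ → ℝ} {ν : ∀ n, Measure (SimpleGraph (Fin n))} {q : ∀ n, Sym2 (Fin n) → ℝ}

/-- The expected number of edges that are longer than `(1 + 3 ε) log n / (d n)`, but not longer
than their shortest detour. -/
theorem eventually_sum_longEvent_le (h : IsModel d ν q) (hexp : IsExpanding d ν q) {K ε : ℝ}
    (hK : 4 ≤ K) (hε : 0 < ε) (hε1 : ε ≤ 1) :
    ∀ᶠ n : ℕ in atTop, ∑ e, jointLaw (ν n) (longEvent ((1 + 3 * ε) * (Real.log n / (d n * n)))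
      (K * (Real.log n / (d n * n))) e) ≤ ENNReal.ofReal (8 * K * ε * (n * Real.log n)) := by
  classical
  obtain ⟨c, hc, good, hgood, hmost⟩ := hexp.most ε hε
  -- Makes `(1 + ε) / (1 - η) ≤ 1 + 3/2 ε`, below the exploration radius `1 + 2 ε`, which in turn is
  -- below the edge length `1 + 3 ε` (in units of `L`).
  set η := ε / 8 with hη
  have hη0 : 0 < η := by positivity
  have hη1 : η < 1 := by linarith
  have hrate : (1 + ε) / (1 - η) ≤ 1 + 3 / 2 * ε := by
    rw [div_le_iff₀ (by linarith)]
    nlinarith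
  have hπ : Tendsto (fun n : ℕ => Real.exp (η * c * ((1 + ε) / (1 - η) - (1 + 2 * ε)) *
      Real.log n)) atTop (𝓝 0) := by
    refine Real.tendsto_exp_atBot.comp (Tendsto.const_mul_atTop_of_neg ?_
      (Real.tendsto_log_atTop.comp tendsto_natCast_atTop_atTop))
    exact mul_neg_of_pos_of_neg (by positivity) (by linarith)
  have hgoodε : ∀ᶠ n in atTop, ν n (good n)ᶜ ≤ ENNReal.ofReal ε :=
    hgood.eventually_le_const (by simpa using hε)
  filter_upwards [h.eventually_pos, hmost, hgoodε, hπ.eventually_le_const hε, h.row 1 one_pos]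
    with n ⟨hd, hlog, hn⟩ ⟨U, hU, hmost⟩ hgoodn hπn hrow
  have := h.prob n
  have hind := h.indep n
  set D := d n * n with hD
  have hD0 : 0 < D := by positivity
  have hrow' : ∀ u, ∑ v, q n s(u, v) ≤ 2 * D := fun u => (hrow u).trans_eq (by ring)
  set L := Real.log n / D with hL
  have hL0 : 0 < L := by positivity
  set a := (1 + 3 * ε) * L with ha
  have ha0 : 0 < a := by positivity
  set π := Real.exp (η * c * ((1 + ε) / (1 - η) - (1 + 2 * ε)) * Real.log n) with hπdef
  have hab : a ≤ K * L := mul_le_mul_of_nonneg_right (by linarith) hL0.le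
  set μ := Measure.pi fun _ : Sym2 (Fin n) => expMeasure 1 with hμ
  let F : SimpleGraph (Fin n) → ℝ≥0∞ := fun G => ∑ u, ∑ v, ENNReal.ofReal (q n s(u, v)) *
    μ {len | ENNReal.ofReal a ≤ shortestDist G len u v}
  have hsum : ∑ e, jointLaw (ν n) (longEvent a (K * L) e) ≤
      ENNReal.ofReal (K * L) * ∫⁻ G, F G ∂ν n := by
    calc _ ≤ ∑ e, ENNReal.ofReal (K * L) * ∫⁻ G, ENNReal.ofReal (q n e) *
          μ {len | ENNReal.ofReal a ≤ edgeDist G len e} ∂ν n := by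
          refine Finset.sum_le_sum fun e _ => ?_
          refine (hind.measure_long_edge_le e ha0.le hab).trans ?_
          rw [lintegral_const_mul _ Measurable.of_discrete, ← mul_assoc,
            ← ENNReal.ofReal_mul (by positivity), mul_comm (K * L)]
          refine mul_le_mul_left (ENNReal.ofReal_le_ofReal ?_) _
          exact mul_le_mul_of_nonneg_left (by linarith) (hind.1 e)
      _ = ENNReal.ofReal (K * L) * ∫⁻ G, ∑ e, ENNReal.ofReal (q n e) *
          μ {len | ENNReal.ofReal a ≤ edgeDist G len e} ∂ν n := by
          rw [lintegral_finsetSum _ fun e _ => Measurable.of_discrete, Finset.mul_sum]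
      _ ≤ _ := by
          refine mul_le_mul_right (lintegral_mono fun G => ?_) _
          exact sum_sym2_le_sum_sum fun e => ENNReal.ofReal (q n e) *
            μ {len | ENNReal.ofReal a ≤ edgeDist G len e}
  have hvertex : ∀ G u, ∑ v, ENNReal.ofReal (q n s(u, v)) *
      μ {len | ENNReal.ofReal a ≤ shortestDist G len u v} ≤ ENNReal.ofReal (2 * D) := by
    intro G u
    refine (Finset.sum_le_sum fun v _ => mul_le_of_le_one_right' prob_le_one).trans ?_
    rw [← ENNReal.ofReal_sum_of_nonneg fun v _ => hind.1 _]
    exact ENNReal.ofReal_le_ofReal (hrow' u)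
  have hFall : ∀ G, F G ≤ ENNReal.ofReal (2 * (n * D)) := by
    intro G
    refine (Finset.sum_le_sum fun u _ => hvertex G u).trans_eq ?_
    rw [Finset.sum_const, Finset.card_univ, Fintype.card_fin, nsmul_eq_mul,
      ← ENNReal.ofReal_natCast, ← ENNReal.ofReal_mul hn.le]
    congr 1; ring
  -- `2 ε D` from the vertices that a successful exploration misses, and at most `2 D · ε` from
  -- failed explorations.
  have hgoodu : ∀ G ∈ good n, ∀ u ∉ U, ∑ v, ENNReal.ofReal (q n s(u, v)) *
      μ {len | ENNReal.ofReal a ≤ shortestDist G len u v} ≤ ENNReal.ofReal (4 * ε * D) := by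
    intro G hG u hu
    obtain ⟨A, m, r, κ, huA, hout, hκ, hin, hr, hgrow⟩ := hmost u hu
    have hball := measure_card_ball_restrictTo_lt_le (hgrow G hG) hr hD0 hc hη0 hη1 huA
      (τ := 1 + 2 * ε) (by positivity)
    refine (sum_mul_measure_le hind.1 huA hκ hout hin (hrow' u) (a := a)
      (t := (1 + 2 * ε) * L) (mul_lt_mul_of_pos_right (by linarith) hL0) ha0 hball).trans ?_
    rw [← ENNReal.ofReal_mul (by positivity), ← ENNReal.ofReal_add (by positivity) (by positivity)]
    refine ENNReal.ofReal_le_ofReal ?_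
    nlinarith
  -- The exceptional vertices add `ε n · 2 D` to `n · 4 ε D`. The bad graphs below contribute
  -- another `2 n D · ε`.
  have hFgood : ∀ G ∈ good n, F G ≤ ENNReal.ofReal (6 * ε * (n * D)) := by
    intro G hG
    simp only [F]
    rw [← Finset.sum_add_sum_compl U]
    calc _ ≤ ∑ u ∈ U, ENNReal.ofReal (2 * D) + ∑ u ∈ Uᶜ, ENNReal.ofReal (4 * ε * D) :=
          add_le_add (Finset.sum_le_sum fun u _ => hvertex G u)
            (Finset.sum_le_sum fun u hu => hgoodu G hG u (Finset.mem_compl.1 hu))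
      _ = ENNReal.ofReal (U.card * (2 * D) + Uᶜ.card * (4 * ε * D)) := by
          rw [Finset.sum_const, Finset.sum_const, nsmul_eq_mul, nsmul_eq_mul,
            ← ENNReal.ofReal_natCast, ← ENNReal.ofReal_natCast, ← ENNReal.ofReal_mul (by positivity),
            ← ENNReal.ofReal_mul (by positivity), ENNReal.ofReal_add (by positivity) (by positivity)]
      _ ≤ _ := by
          refine ENNReal.ofReal_le_ofReal ?_
          have h1 : (Uᶜ.card : ℝ) ≤ n := by
            have := Finset.card_le_univ Uᶜ
            rw [Fintype.card_fin] at this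
            exact_mod_cast this
          have h2 := mul_le_mul_of_nonneg_right hU (by positivity : 0 ≤ 2 * D)
          have h3 := mul_le_mul_of_nonneg_right h1 (by positivity : 0 ≤ 4 * ε * D)
          linarith
  have hF : ∫⁻ G, F G ∂ν n ≤ ENNReal.ofReal (8 * ε * (n * D)) := by
    calc ∫⁻ G, F G ∂ν n ≤ ∫⁻ G, (ENNReal.ofReal (6 * ε * (n * D)) + ENNReal.ofReal (2 * (n * D)) *
          Set.indicator (good n)ᶜ 1 G) ∂ν n := by
          refine lintegral_mono fun G => ?_
          by_cases hG : G ∈ good n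
          · exact (hFgood G hG).trans le_self_add
          · rw [Set.indicator_of_mem (by exact hG), Pi.one_apply, mul_one]
            exact (hFall G).trans le_add_self
      _ = ENNReal.ofReal (6 * ε * (n * D)) + ENNReal.ofReal (2 * (n * D)) * ν n (good n)ᶜ := by
          rw [lintegral_add_left measurable_const, lintegral_const, measure_univ, mul_one,
            lintegral_const_mul _ Measurable.of_discrete,
            lintegral_indicator_one MeasurableSet.of_discrete]
      _ ≤ ENNReal.ofReal (6 * ε * (n * D)) + ENNReal.ofReal (2 * (n * D)) * ENNReal.ofReal ε := by
          gcongr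
      _ = _ := by
          rw [← ENNReal.ofReal_mul (by positivity), ← ENNReal.ofReal_add (by positivity)
            (by positivity)]
          congr 1; ring
  refine hsum.trans ((mul_le_mul_right hF _).trans_eq ?_)
  rw [← ENNReal.ofReal_mul (by positivity)]
  congr 1
  rw [hL]
  field_simp

/-- With high probability at most about `n log n / 2` edges are not longer than their
detours. -/
theorem tendsto_lt_card_tightEdges (h : IsModel d ν q) (hexp : IsExpanding d ν q) {ε : ℝ}
    (hε : 0 < ε) :
    Tendsto (fun n : ℕ => jointLaw (ν n) {x | (1 / 2 + ε) * (n * Real.log n) <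
      (tightEdges x.1 x.2).card}) atTop (𝓝 0) := by
  classical
  obtain ⟨K₀, hK₀, hdiam⟩ := h.exists_tendsto_diam hexp
  -- At least `4`, so that the interval from `(1 + 3 ζ) L` to `K L` is not reversed for `ζ ≤ 1`.
  set K := max K₀ 4 with hK
  have hK4 : 4 ≤ K := le_max_right _ _
  rw [ENNReal.tendsto_nhds_zero]
  intro τ' hτ'
  obtain ⟨τ, hτ0, hττ'⟩ : ∃ τ : ℝ, 0 < τ ∧ ENNReal.ofReal τ ≤ τ' := by
    refine ⟨(min τ' 1).toReal, ?_, ?_⟩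
    · exact ENNReal.toReal_pos (by simp [hτ'.ne']) (by simp)
    · rw [ENNReal.ofReal_toReal (by simp)]
      exact min_le_left _ _
  -- The bound `ε / 8` serves the count of short edges. The last one makes Markov's bound `8 K ζ /
  -- (ε / 4)` for the long edges at most `τ / 3`.
  set ζ := min 1 (min (ε / 8) (τ * ε / (96 * K))) with hζ
  have hζ0 : 0 < ζ := by
    have : 0 < K := by linarith
    exact lt_min one_pos (lt_min (by positivity) (by positivity))
  have hζ1 : ζ ≤ 1 := min_le_left _ _
  have hζ2 : ζ ≤ ε / 8 := (min_le_right _ _).trans (min_le_left _ _)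
  have hζ3 : ζ ≤ τ * ε / (96 * K) := (min_le_right _ _).trans (min_le_right _ _)
  let y : ℕ → ℝ := fun n => (1 + 3 * ζ) * (Real.log n / (d n * n))
  have hy : ∀ᶠ n in atTop, 0 < y n := by
    filter_upwards [h.eventually_pos] with n ⟨hd, hlog, hn⟩
    simp only [y]
    positivity
  have hL : Tendsto (fun n : ℕ => Real.log n / (d n * n)) atTop (𝓝 0) :=
    h.dense.inv_tendsto_atTop.congr fun n => by simp
  have hy0 : Tendsto y atTop (𝓝 0) := by simpa using hL.const_mul (1 + 3 * ζ)
  have hMval : ∀ᶠ n : ℕ in atTop, d n * (n : ℝ) ^ 2 / 2 * y n =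
      (1 + 3 * ζ) / 2 * (n * Real.log n) := by
    filter_upwards [h.eventually_pos] with n ⟨hd, hlog, hn⟩
    simp only [y]
    field_simp
  have hM : Tendsto (fun n => d n * (n : ℝ) ^ 2 / 2 * y n) atTop atTop := by
    have h1 : Tendsto (fun n : ℕ => (1 + 3 * ζ) / 2 * (n : ℝ)) atTop atTop :=
      Tendsto.const_mul_atTop (by positivity) tendsto_natCast_atTop_atTop
    refine tendsto_atTop_mono' _ ?_ h1
    filter_upwards [h.eventually_pos, hMval] with n ⟨hd, hlog, hn⟩ hv
    rw [hv]
    refine mul_le_mul_of_nonneg_left ?_ (by positivity)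
    nlinarith
  have hA := h.tendsto_shortEvent hy hy0 hM hζ0
  have hτ3 : (0 : ℝ≥0∞) < ENNReal.ofReal (τ / 3) := by simpa using hτ0
  filter_upwards [h.eventually_pos, hMval, hA.eventually_le_const hτ3,
    hdiam.eventually_le_const hτ3, h.eventually_sum_longEvent_le hexp hK4 hζ0 hζ1]
    with n ⟨hd, hlog, hn⟩ hv hA hdiam hlong
  have := h.prob n
  set X := (n : ℝ) * Real.log n with hX
  have hX0 : 0 < X := by positivity
  set b := K * (Real.log n / (d n * n)) with hb
  have hLpos : 0 < Real.log n / (d n * n) := by positivity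
  have hlong' := measure_le_card_filter_le (P := jointLaw (ν n))
    (measurableSet_longEvent (n := n) (y n) b) (z := ε / 4 * X) (by positivity)
  have hlong'' : jointLaw (ν n) {x | ε / 4 * X ≤
      (Finset.univ.filter fun e => x ∈ longEvent (y n) b e).card} ≤ ENNReal.ofReal (τ / 3) := by
    refine hlong'.trans ?_
    refine (ENNReal.div_le_div_right hlong _).trans ?_
    rw [← ENNReal.ofReal_div_of_pos (by positivity)]
    refine ENNReal.ofReal_le_ofReal ?_
    rw [div_le_iff₀ (by positivity)]
    rw [le_div_iff₀ (by linarith)] at hζ3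
    nlinarith
  refine le_trans ?_ hττ'
  have hcover : {x : SimpleGraph (Fin n) × (Sym2 (Fin n) → ℝ) |
      (1 / 2 + ε) * X < (tightEdges x.1 x.2).card} ⊆
      ({x | ζ * (d n * (n : ℝ) ^ 2 / 2 * y n) ≤
      |((Finset.univ.filter fun e => x ∈ shortEvent (y n) e).card : ℝ) -
        d n * (n : ℝ) ^ 2 / 2 * y n|} ∪ {x | ¬ ∀ u v,
      shortestDist x.1 x.2 u v ≤ ENNReal.ofReal (K₀ * (Real.log n / (d n * n)))}) ∪
      {x | ε / 4 * X ≤ (Finset.univ.filter fun e => x ∈ longEvent (y n) b e).card} := by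
    rintro ⟨G, len⟩ hlt
    by_contra hcon
    simp only [Set.mem_union, Set.mem_ofPred_eq, not_or, not_le, not_not] at hcon hlt
    obtain ⟨⟨h1, h2⟩, h3⟩ := hcon
    set N := Finset.univ.filter fun e => (G, len) ∈ shortEvent (y n) e with hN
    set Z := Finset.univ.filter fun e => (G, len) ∈ longEvent (y n) b e with hZ
    -- A tight edge longer than `y` realizes the distance between its ends, so the diameter bound
    -- puts its length below `b`, and none of its detours is shorter than `y`.
    have hsub : tightEdges G len ⊆ N ∪ Z := by
      intro e he
      simp only [tightEdges, Finset.mem_filter, SimpleGraph.mem_edgeFinset] at he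
      obtain ⟨he1, he2⟩ := he
      rw [Finset.mem_union, hN, hZ, Finset.mem_filter, Finset.mem_filter]
      rcases le_or_gt (len e) (y n) with hle | hgt
      · exact Or.inl ⟨Finset.mem_univ _, he1, hle⟩
      · refine Or.inr ⟨Finset.mem_univ _, he1, ⟨hgt, ?_⟩,
          (ENNReal.ofReal_le_ofReal hgt.le).trans he2⟩
        have h4 : ENNReal.ofReal (len e) ≤ edgeDist G len e := by
          have := min_edgeDist_deleteEdges_le G len e
          rwa [min_eq_left he2] at this
        have h5 : edgeDist G len e ≤ ENNReal.ofReal (K₀ * (Real.log n / (d n * n))) := by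
          induction e using Sym2.ind with
          | _ u v => exact h2 u v
        have h6 := (ENNReal.ofReal_le_ofReal_iff (by positivity)).1 (h4.trans h5)
        exact h6.trans (mul_le_mul_of_nonneg_right (le_max_left _ _) hLpos.le)
    have hcard : ((tightEdges G len).card : ℝ) ≤ N.card + Z.card := by
      exact_mod_cast (Finset.card_le_card hsub).trans (Finset.card_union_le _ _)
    rw [abs_lt, hv] at h1
    have h8 : (1 + ζ) * ((1 + 3 * ζ) / 2) ≤ 1 / 2 + 3 / 4 * ε := by nlinarith
    have h9 := mul_le_mul_of_nonneg_right h8 hX0.le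
    linarith [h1.2]
  refine (measure_mono hcover).trans ((measure_union_le _ _).trans
    ((add_le_add ((measure_union_le _ _).trans (add_le_add hA hdiam)) hlong'').trans_eq ?_))
  rw [← ENNReal.ofReal_add (by positivity) (by positivity),
    ← ENNReal.ofReal_add (by positivity) (by positivity)]
  congr 1; ring

end IsModel

/-- The conclusions of the theorem for a model. -/
theorem IsModel.tendsto_oneSpannerNear {d : ℕ → ℝ} {ν : ∀ n, Measure (SimpleGraph (Fin n))}
    {q : ∀ n, Sym2 (Fin n) → ℝ} (h : IsModel d ν q) (hexp : IsExpanding d ν q) {ε : ℝ}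
    (hε : 0 < ε) :
    Tendsto (fun n => (ν n).prod (lengthLaw n) {x | OneSpannerNear ε x.1 x.2}) atTop (𝓝 1) := by
  have h1 := (h.tendsto_card_isSpanner_lt (lam := fun _ => 1) (C := 1)
    (Eventually.of_forall fun _ => ⟨le_rfl, le_rfl⟩) (ε := ε / 2) (by positivity)).add
    (h.tendsto_lt_card_tightEdges hexp (ε := ε / 2) (by positivity))
  rw [add_zero] at h1
  have h2 : Tendsto (fun n => 1 - jointLaw (ν n) {x | OneSpannerNear ε x.1 x.2}ᶜ) atTop (𝓝 1) := by
    have h3 : Tendsto (fun n => jointLaw (ν n) {x | OneSpannerNear ε x.1 x.2}ᶜ) atTop (𝓝 0) := by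
      refine tendsto_of_tendsto_of_tendsto_of_le_of_le' tendsto_const_nhds h1
        (Eventually.of_forall fun _ => zero_le) (Eventually.of_forall fun n => ?_)
      refine (measure_mono ?_).trans (measure_union_le _ _)
      rintro ⟨G, len⟩ hx
      by_contra hcon
      simp only [Set.mem_union, Set.mem_ofPred_eq, not_or, not_exists, not_and, not_lt] at hcon
      obtain ⟨h4, h5⟩ := hcon
      apply hx
      obtain ⟨S, hS, hcard⟩ := exists_isSpanner_card_eq G len le_rfl
      have h6 := h4 S hS
      rw [hcard, div_one] at h6
      have h7 : (minSpannerSize G len 1 : ℝ) ≤ (tightEdges G len).card := by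
        exact_mod_cast minSpannerSize_le G len
      rw [Set.mem_ofPred_eq, OneSpannerNear, abs_le]
      constructor <;> linarith
    have := ENNReal.Tendsto.sub (tendsto_const_nhds (x := (1 : ℝ≥0∞))) h3 (Or.inl (by simp))
    simpa using this
  refine tendsto_of_tendsto_of_tendsto_of_le_of_le h2 tendsto_const_nhds (fun n => ?_) fun n => ?_
  · have := h.prob n
    -- Subadditivity bounds the probability below by one minus that of the complement without
    -- measurability of the event.
    rw [tsub_le_iff_right, ← measure_univ (μ := jointLaw (ν n)),
      ← Set.union_compl_self {x | OneSpannerNear ε x.1 x.2}]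
    exact measure_union_le _ _
  · have := h.prob n
    exact prob_le_one

/-- The lower bound with constant `300 / 601 < 1 / 2` gives both claims, since `1 / (601 d) ≤ 300 /
601` exactly when `d ≥ 1 / 300`. No expansion is needed. -/
theorem IsModel.tendsto_spannersLarge {d : ℕ → ℝ} {ν : ∀ n, Measure (SimpleGraph (Fin n))}
    {q : ∀ n, Sym2 (Fin n) → ℝ} (h : IsModel d ν q) {lam : ℕ → ℝ} {C : ℝ}
    (hlam : ∀ᶠ n in atTop, 2 ≤ lam n ∧ lam n ≤ C) :
    Tendsto (fun n => (ν n).prod (lengthLaw n) {x | SpannersLarge (d n) (lam n) x.1 x.2})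
      atTop (𝓝 1) := by
  have h1 := h.tendsto_card_isSpanner_lt (lam := lam) (C := C)
    (hlam.mono fun _ h => ⟨by linarith [h.1], h.2⟩) (ε := 1 / 2 - 300 / 601) (by norm_num)
  have h2 : Tendsto (fun n => 1 - jointLaw (ν n) {x | SpannersLarge (d n) (lam n) x.1 x.2}ᶜ) atTop
      (𝓝 1) := by
    have h3 : Tendsto (fun n => jointLaw (ν n) {x | SpannersLarge (d n) (lam n) x.1 x.2}ᶜ) atTop
        (𝓝 0) := by
      refine tendsto_of_tendsto_of_tendsto_of_le_of_le' tendsto_const_nhds h1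
        (Eventually.of_forall fun _ => zero_le) ?_
      filter_upwards [hlam, h.eventually_pos] with n hl ⟨hd, hlog, hn⟩
      refine measure_mono ?_
      rintro ⟨G, len⟩ hx
      by_contra hcon
      simp only [Set.mem_ofPred_eq, not_exists, not_and, not_lt] at hcon
      refine hx fun S hS => ?_
      have h4 := hcon S hS
      have hl0 : 0 < lam n := by linarith
      have hX : 0 < n * Real.log n / lam n := by positivity
      refine ⟨?_, fun hd' => ?_⟩
      · calc n * Real.log n / (601 * lam n) = 1 / 601 * (n * Real.log n / lam n) := by field_simp
          _ ≤ _ := by linarith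
      · calc n * Real.log n / (601 * d n * lam n)
            = 1 / (601 * d n) * (n * Real.log n / lam n) := by field_simp
          _ ≤ 300 / 601 * (n * Real.log n / lam n) := by
              refine mul_le_mul_of_nonneg_right ?_ hX.le
              rw [div_le_div_iff₀ (by positivity) (by norm_num)]
              linarith
          _ ≤ _ := by linarith
    have := ENNReal.Tendsto.sub (tendsto_const_nhds (x := (1 : ℝ≥0∞))) h3 (Or.inl (by simp))
    simpa using this
  refine tendsto_of_tendsto_of_tendsto_of_le_of_le h2 tendsto_const_nhds (fun n => ?_) fun n => ?_
  · have := h.prob n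
    rw [tsub_le_iff_right, ← measure_univ (μ := jointLaw (ν n)),
      ← Set.union_compl_self {x | SpannersLarge (d n) (lam n) x.1 x.2}]
    exact measure_union_le _ _
  · have := h.prob n
    exact prob_le_one

theorem sum_Ico_one_div_le {m n : ℕ} (hm : m ≤ n + 1) :
    ∑ k ∈ Finset.Ico 1 m, 1 / (k : ℝ) ≤ 1 + Real.log n := by
  refine le_trans ?_ (harmonic_le_one_add_log n)
  rw [harmonic_eq_sum_Icc]
  push_cast
  simp only [one_div]
  refine Finset.sum_le_sum_of_subset_of_nonneg (fun k hk => ?_) fun _ _ _ => by positivity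
  rw [Finset.mem_Ico] at hk
  rw [Finset.mem_Icc]
  omega

/-! ### Edge boundaries -/

section Boundary
variable {V : Type*} [Fintype V]

theorem edgeBoundary_compl [DecidableEq V] (G : SimpleGraph V) (S : Finset V) :
    edgeBoundary G Sᶜ = edgeBoundary G S := by
  ext e
  simp only [mem_edgeBoundary, Finset.mem_compl, not_not]
  constructor
  · rintro ⟨x, hx, y, hy, h, rfl⟩; exact ⟨y, hy, x, hx, h.symm, Sym2.eq_swap⟩
  · rintro ⟨x, hx, y, hy, h, rfl⟩; exact ⟨y, hy, x, hx, h.symm, Sym2.eq_swap⟩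

theorem edgeBoundary_eq_filter_top (G : SimpleGraph V) (S : Finset V)
    [DecidablePred fun e => e ∈ G.edgeSet] :
    edgeBoundary G S = (edgeBoundary ⊤ S).filter fun e => e ∈ G.edgeSet := by
  ext e
  simp only [mem_edgeBoundary, Finset.mem_filter]
  constructor
  · rintro ⟨x, hx, y, hy, h, rfl⟩; exact ⟨⟨x, hx, y, hy, h.ne, rfl⟩, h⟩
  · rintro ⟨⟨x, hx, y, hy, -, rfl⟩, h⟩; exact ⟨x, hx, y, hy, h, rfl⟩

theorem card_edgeBoundary_top (S : Finset V) :
    (edgeBoundary (⊤ : SimpleGraph V) S).card = S.card * (Fintype.card V - S.card) := by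
  classical
  rw [card_edgeBoundary, ← Finset.card_compl, ← Finset.card_product]
  congr 1
  ext ⟨x, y⟩
  simp only [SimpleGraph.mem_interedges_iff, Finset.mem_product, Finset.mem_compl,
    SimpleGraph.top_adj]
  constructor
  · rintro ⟨hx, hy, -⟩; exact ⟨hx, hy⟩
  · rintro ⟨hx, hy⟩; exact ⟨hx, hy, fun h => hy (h ▸ hx)⟩

theorem grows_univ_of_forall {G : SimpleGraph V} {m : ℕ} {r : ℕ → ℝ}
    (h : ∀ S : Finset V, S.Nonempty → S.card < m → r S.card ≤ (edgeBoundary G S).card) :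
    Grows G Finset.univ m r := by
  classical
  intro S _ hS hm
  have := h S hS hm
  rw [card_edgeBoundary, Finset.compl_eq_univ_sdiff] at this
  convert! this

end Boundary

/-! ### The binomial random graph -/

section Binomial

open Classical in
/-- The probability that a pair of vertices is an edge of the binomial random graph. -/
noncomputable def binomialProb (p : ℝ) {n : ℕ} (e : Sym2 (Fin n)) : ℝ := if e.IsDiag then 0 else p

theorem sum_binomialProb (p : ℝ) (n : ℕ) :
    ∑ e : Sym2 (Fin n), binomialProb p e = p * (n * (n - 1) / 2) := by
  classical
  have h1 : ∑ e : Sym2 (Fin n), binomialProb p e =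
      ∑ e : Sym2 (Fin n) with ¬ e.IsDiag, p := by
    rw [Finset.sum_filter]
    refine Finset.sum_congr rfl fun e _ => ?_
    unfold binomialProb
    split_ifs <;> rfl
  rw [h1, Finset.sum_const, nsmul_eq_mul, ← Fintype.card_subtype, Sym2.card_subtype_not_diag,
    Fintype.card_fin, Nat.cast_choose_two, mul_comm]

theorem binomialProb_le {p : ℝ} (hp : 0 ≤ p) {n : ℕ} (e : Sym2 (Fin n)) : binomialProb p e ≤ p := by
  unfold binomialProb
  split_ifs
  exacts [hp, le_rfl]

theorem edgeIndep_binomialProb (p : I) (n : ℕ) :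
    EdgeIndep (SimpleGraph.binomialRandom (Fin n) p) fun e => binomialProb (p : ℝ) e := by
  have := edgeIndep_binomialRandom (V := Fin n) p
  unfold binomialProb
  convert! this

variable {p : ℕ → I}

theorem tendsto_mul_binomial (hp : Tendsto (fun n : ℕ => n * (p n : ℝ) / Real.log n) atTop atTop) :
    Tendsto (fun n : ℕ => (p n : ℝ) * n / Real.log n) atTop atTop := by
  simpa only [mul_comm] using hp

theorem isModel_binomialRandom
    (hp : Tendsto (fun n : ℕ => n * (p n : ℝ) / Real.log n) atTop atTop) :
    IsModel (fun n => (p n : ℝ)) (fun n => SimpleGraph.binomialRandom (Fin n) (p n))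
      (fun n => binomialProb (p n)) where
  prob n := inferInstance
  indep n := edgeIndep_binomialProb (p n) n
  row δ hδ := Eventually.of_forall fun n u => by
    refine (Finset.sum_le_sum fun v _ => binomialProb_le (p n).2.1 _).trans ?_
    rw [Finset.sum_const, Finset.card_univ, Fintype.card_fin, nsmul_eq_mul]
    nlinarith [mul_nonneg (p n).2.1 (Nat.cast_nonneg (α := ℝ) n)]
  le := by
    have h1 : ∀ᶠ n : ℕ in atTop, 1 < Real.log n :=
      (Real.tendsto_log_atTop.comp tendsto_natCast_atTop_atTop).eventually_gt_atTop 1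
    filter_upwards [h1] with n hn e
    have := (p n).2.1
    refine (binomialProb_le this e).trans ?_
    nlinarith
  sum δ hδ := by
    filter_upwards [(tendsto_natCast_atTop_atTop (R := ℝ)).eventually_ge_atTop (1 / δ)] with n hn
    rw [sum_binomialProb]
    have h1 : (p n : ℝ) * (n * (n - 1) / 2) - (p n : ℝ) * n ^ 2 / 2 = -((p n : ℝ) * n / 2) := by ring
    rw [h1, abs_neg, abs_of_nonneg (div_nonneg (mul_nonneg (p n).2.1 (Nat.cast_nonneg n)) (by norm_num))]
    rw [div_le_iff₀ hδ] at hn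
    have h2 := mul_nonneg (p n).2.1 (Nat.cast_nonneg (α := ℝ) n)
    nlinarith
  dense := tendsto_mul_binomial hp

/-- The graphs in which every cut has almost the expected number of edges. -/
def goodCuts (n : ℕ) (p δ : ℝ) : Set (SimpleGraph (Fin n)) :=
  {G | ∀ S : Finset (Fin n), (1 - δ) * p * (S.card * (n - S.card)) ≤ (edgeBoundary G S).card}

/-- Chernoff bound with tilt `δ / 2`: the exponent is `-δ² p M / 4` with `M = |S| (n - |S|) ≥ |S| n
/ 2`, and the assumption on `p n` turns this into at most `-2 |S| log n`. -/
theorem measure_cut_lt_le {n : ℕ} (p : I) {δ : ℝ} (hδ0 : 0 < δ)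
    (hpn : 16 / δ ^ 2 * Real.log n ≤ p * n) {S : Finset (Fin n)} (hS : 2 * S.card ≤ n)
    (hne : S.Nonempty) :
    SimpleGraph.binomialRandom (Fin n) p {G | (edgeBoundary G S).card <
        (1 - δ) * p * (S.card * (n - S.card))} ≤
      ENNReal.ofReal ((1 / (n : ℝ) ^ 2) ^ S.card) := by
  classical
  set ν := SimpleGraph.binomialRandom (Fin n) p
  have hind := edgeIndep_binomialProb p n
  set F := edgeBoundary (⊤ : SimpleGraph (Fin n)) S with hF
  have hSn : S.card ≤ n := by omega
  have hn : 0 < n := by have := hne.card_pos; omega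
  set M : ℝ := S.card * (n - S.card) with hM
  have hFM : (F.card : ℝ) = M := by
    rw [hF, card_edgeBoundary_top, Fintype.card_fin, Nat.cast_mul, Nat.cast_sub hSn]
  have hsum : ∑ e ∈ F, binomialProb (p : ℝ) e = p * M := by
    rw [← hFM, mul_comm, ← nsmul_eq_mul, ← Finset.sum_const]
    refine Finset.sum_congr rfl fun e he => ?_
    obtain ⟨x, -, y, -, hxy, rfl⟩ := mem_edgeBoundary.1 he
    have hxy' : x ≠ y := hxy
    simp [binomialProb, hxy']
  set a := δ / 2 with ha
  have ha0 : 0 < a := by positivity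
  have hlap := hind.laplace F ha0.le
  rw [hsum] at hlap
  set y := Real.exp (-(a * ((1 - δ) * p * M))) with hy
  have hy0 : 0 < y := Real.exp_pos _
  have hmarkov := meas_ge_le_lintegral_div (μ := ν) (f := fun G => ENNReal.ofReal
    (Real.exp (-(a * (F.filter fun e => e ∈ G.edgeSet).card))))
    Measurable.of_discrete.aemeasurable (ε := ENNReal.ofReal y) (by simpa using hy0) (by simp)
  have hM0 : 0 ≤ M := by rw [← hFM]; positivity
  calc _ ≤ _ := measure_mono fun G hG => ?_
    _ ≤ _ := hmarkov
    _ ≤ ENNReal.ofReal (Real.exp (-((1 - Real.exp (-a)) * (p * M)))) / ENNReal.ofReal y :=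
        ENNReal.div_le_div_right hlap _
    _ ≤ _ := by
        rw [← ENNReal.ofReal_div_of_pos hy0, hy, ← Real.exp_sub]
        refine ENNReal.ofReal_le_ofReal ?_
        have h1 := mul_one_sub_le_one_sub_exp_neg ha0.le
        have hp0 := p.2.1
        have h2 : -((1 - Real.exp (-a)) * (p * M)) - -(a * ((1 - δ) * p * M)) ≤
            -(δ ^ 2 / 4) * (p * M) := by
          have h3 := mul_le_mul_of_nonneg_right h1 (mul_nonneg hp0 hM0)
          have h4 : a * (1 - a) * (p * M) - a * ((1 - δ) * p * M) = δ ^ 2 / 4 * (p * M) := by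
            rw [ha]; ring
          linarith
        have h5 : (S.card : ℝ) * n / 2 ≤ M := by
          have : (2 * S.card : ℝ) ≤ n := by exact_mod_cast hS
          rw [hM]
          have h0 : (0 : ℝ) ≤ S.card := Nat.cast_nonneg _
          nlinarith
        have h6 : S.card * (2 * Real.log n) ≤ δ ^ 2 / 4 * (p * M) := by
          have h7 := mul_le_mul_of_nonneg_left h5 (mul_nonneg (by positivity : 0 ≤ δ ^ 2 / 4) hp0)
          have h8 := mul_le_mul_of_nonneg_left hpn (by positivity : 0 ≤ δ ^ 2 / 8 * S.card)
          have h9 : δ ^ 2 / 8 * S.card * (16 / δ ^ 2 * Real.log n) = S.card * (2 * Real.log n) := by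
            field_simp; ring
          nlinarith
        have h10 : (1 / (n : ℝ) ^ 2) ^ S.card = Real.exp (-(S.card * (2 * Real.log n))) := by
          have hn' : (0 : ℝ) < n := by exact_mod_cast hn
          have h11 : Real.exp (-(2 * Real.log n)) = 1 / (n : ℝ) ^ 2 := by
            rw [Real.exp_neg, one_div]
            congr 1
            rw [show 2 * Real.log n = Real.log ((n : ℝ) ^ 2) by rw [Real.log_pow]; norm_num,
              Real.exp_log (by positivity)]
          rw [← h11, ← Real.exp_nat_mul]
          congr 1; ring
        rw [h10, Real.exp_le_exp]
        linarith
  rw [Set.mem_ofPred_eq] at hG ⊢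
  refine ENNReal.ofReal_le_ofReal ?_
  rw [hy, Real.exp_le_exp, neg_le_neg_iff]
  refine mul_le_mul_of_nonneg_left ?_ ha0.le
  rw [edgeBoundary_eq_filter_top] at hG
  exact hG.le

/-- A set and its complement have the same boundary, so sets of at most `n / 2` vertices suffice.
The union bound is at most `∑ |S|≥1, n ^ (-2 |S|) = (1 + n⁻²) ^ n - 1 ≤ exp(1 / n) - 1`. -/
theorem tendsto_goodCuts_compl
    (hp : Tendsto (fun n : ℕ => n * (p n : ℝ) / Real.log n) atTop atTop) {δ : ℝ} (hδ0 : 0 < δ)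
    (hδ1 : δ < 1) :
    Tendsto (fun n => SimpleGraph.binomialRandom (Fin n) (p n) (goodCuts n (p n) δ)ᶜ) atTop
      (𝓝 0) := by
  classical
  have hlim : Tendsto (fun n : ℕ => ENNReal.ofReal (Real.exp (1 / (n : ℝ)) - 1)) atTop (𝓝 0) := by
    rw [← ENNReal.ofReal_zero]
    refine ENNReal.tendsto_ofReal ?_
    have h1 := (Real.continuous_exp.tendsto 0).comp (tendsto_one_div_atTop_nhds_zero_nat (𝕜 := ℝ))
    simpa using h1.sub_const 1
  refine tendsto_of_tendsto_of_tendsto_of_le_of_le' tendsto_const_nhds hlim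
    (Eventually.of_forall fun _ => zero_le) ?_
  filter_upwards [(isModel_binomialRandom hp).eventually_pos,
    hp.eventually_ge_atTop (16 / δ ^ 2)] with n ⟨hd, hlog, hn⟩ hpn
  rw [le_div_iff₀ (by linarith), mul_comm (n : ℝ)] at hpn
  set T : Finset (Finset (Fin n)) := Finset.univ.filter fun S => S.Nonempty ∧ 2 * S.card ≤ n with hT
  have hcover : (goodCuts n (p n) δ)ᶜ ⊆ ⋃ S ∈ T, {G | (edgeBoundary G S).card <
      (1 - δ) * p n * (S.card * (n - S.card))} := by
    intro G hG
    simp only [goodCuts, Set.mem_compl_iff, Set.mem_ofPred_eq, not_forall, not_le] at hG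
    obtain ⟨S, hS⟩ := hG
    have hle : S.card ≤ n := by simpa using Finset.card_le_univ S
    have hcc : Sᶜ.card = n - S.card := by rw [Finset.card_compl, Fintype.card_fin]
    have hpos : 0 < S.card ∧ S.card < n := by
      by_contra hcon
      have : S.card = 0 ∨ S.card = n := by omega
      rcases this with h | h <;> rw [h] at hS <;> simp at hS <;>
        exact absurd hS (not_lt.2 (Nat.cast_nonneg _))
    simp only [Set.mem_iUnion]
    by_cases h2 : 2 * S.card ≤ n
    · exact ⟨S, by simp [hT, h2, ← Finset.card_pos, hpos.1], hS⟩
    · refine ⟨Sᶜ, ?_, ?_⟩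
      · simp only [hT, Finset.mem_filter, Finset.mem_univ, true_and, ← Finset.card_pos, hcc]
        omega
      · rw [Set.mem_ofPred_eq, edgeBoundary_compl, hcc, Nat.cast_sub hle]
        have hcomm : ((n : ℝ) - S.card) * (n - (n - S.card)) = S.card * (n - S.card) := by ring
        rw [hcomm]
        exact hS
  refine (measure_mono hcover).trans ((measure_biUnion_finset_le _ _).trans ?_)
  refine (Finset.sum_le_sum fun S hS => measure_cut_lt_le (p n) hδ0 hpn
    (Finset.mem_filter.1 hS).2.2 (Finset.mem_filter.1 hS).2.1).trans ?_
  rw [← ENNReal.ofReal_sum_of_nonneg fun S _ => by positivity]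
  refine ENNReal.ofReal_le_ofReal ?_
  have h1 : ∑ S ∈ T, (1 / (n : ℝ) ^ 2) ^ S.card ≤
      ∑ S ∈ (Finset.univ : Finset (Fin n)).powerset.erase ∅, (1 / (n : ℝ) ^ 2) ^ S.card := by
    refine Finset.sum_le_sum_of_subset_of_nonneg (fun S hS => ?_) fun _ _ _ => by positivity
    simp [(Finset.mem_filter.1 hS).2.1.ne_empty]
  have h2 : ∑ S ∈ (Finset.univ : Finset (Fin n)).powerset, (1 / (n : ℝ) ^ 2) ^ S.card =
      (1 + 1 / (n : ℝ) ^ 2) ^ n := by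
    have := Finset.sum_pow_mul_eq_add_pow (1 / (n : ℝ) ^ 2) 1 (Finset.univ : Finset (Fin n))
    simp only [one_pow, mul_one, Finset.card_univ, Fintype.card_fin] at this
    rw [this, add_comm]
  have h3 : (1 + 1 / (n : ℝ) ^ 2) ^ n ≤ Real.exp (1 / n) := by
    have := Real.add_one_le_exp (1 / (n : ℝ) ^ 2)
    refine (pow_le_pow_left₀ (by positivity) ((add_comm _ _).trans_le this) n).trans_eq ?_
    rw [← Real.exp_nat_mul]
    congr 1
    field_simp
  have h4 := Finset.add_sum_erase (Finset.univ : Finset (Fin n)).powerset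
    (fun S => (1 / (n : ℝ) ^ 2) ^ S.card) (Finset.empty_mem_powerset _)
  simp only [Finset.card_empty, pow_zero] at h4
  linarith

/-- Good cuts give the rates `(1 - δ) p k (n - k)`, whose reciprocals are summed using `1 / (k (n -
k)) = (1 / k + 1 / (n - k)) / n`. The first part is harmonic and yields `log n`; stopping about `ε
n` vertices early keeps the second part at most `1 / ε`. Up to half of the vertices, `n - k ≥ n / 2`
is enough. -/
theorem isExpanding_binomialRandom
    (hp : Tendsto (fun n : ℕ => n * (p n : ℝ) / Real.log n) atTop atTop) :
    IsExpanding (fun n => (p n : ℝ)) (fun n => SimpleGraph.binomialRandom (Fin n) (p n))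
      (fun n => binomialProb (p n)) where
  half := by
    refine ⟨8, 1 / 4, by norm_num, by norm_num,
      fun n k => (1 - 1 / 2) * p n * (k * (n - k)), ?_, ?_⟩
    · filter_upwards [(isModel_binomialRandom hp).eventually_pos] with n ⟨hd, hlog, hn⟩
      have hr : ∀ k : ℕ, 1 ≤ k → k < n / 2 + 1 →
          (k : ℝ) * (p n * n / 4) ≤ (1 - 1 / 2) * p n * (k * (n - k)) := by
        intro k h1 h2
        have h3 : (2 * k : ℝ) ≤ n := by exact_mod_cast (by omega : 2 * k ≤ n)
        have h4 : (1 : ℝ) ≤ k := by exact_mod_cast h1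
        have : 0 ≤ (p n : ℝ) * k * (n - 2 * k) := by
          have : (0 : ℝ) ≤ n - 2 * k := by linarith
          positivity
        nlinarith
      refine ⟨fun k h1 h2 => le_trans ?_ (hr k h1 h2), ?_⟩
      · have h4 : (1 : ℝ) ≤ k := by exact_mod_cast h1
        have : 0 < (p n : ℝ) * n := by positivity
        nlinarith
      · calc _ ≤ ∑ k ∈ Finset.Ico 1 (n / 2 + 1), 4 / ((p n : ℝ) * n) * (1 / (k : ℝ)) := by
              refine Finset.sum_le_sum fun k hk => ?_
              rw [Finset.mem_Ico] at hk
              have h4 : (0 : ℝ) < k := by exact_mod_cast hk.1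
              refine (one_div_le_one_div_of_le (by positivity) (hr k hk.1 hk.2)).trans_eq ?_
              field_simp
          _ ≤ 4 / ((p n : ℝ) * n) * (1 + Real.log n) := by
              rw [← Finset.mul_sum]
              exact mul_le_mul_of_nonneg_left (sum_Ico_one_div_le (by omega)) (by positivity)
          _ ≤ 4 / ((p n : ℝ) * n) * (2 * Real.log n) :=
              mul_le_mul_of_nonneg_left (by linarith) (by positivity)
          _ = _ := by ring
    · refine tendsto_of_tendsto_of_tendsto_of_le_of_le tendsto_const_nhds
        (tendsto_goodCuts_compl hp (δ := 1 / 2) (by norm_num) (by norm_num)) (fun _ => zero_le)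
        fun n => measure_mono (Set.compl_subset_compl.2 fun G hG => ?_)
      exact grows_univ_of_forall (G := G)
        (r := fun k => (1 - 1 / 2) * (p n : ℝ) * (k * (n - k))) fun S _ _ => hG S
  most := by
    intro ε hε
    -- Chosen so that `1 / (1 - δ) = 1 + ε / 2`; the rest of `1 + ε` absorbs the bounded terms next
    -- to `log n`.
    set δ := ε / (2 + ε) with hδ
    have hδ0 : 0 < δ := by positivity
    have hδ1 : δ < 1 := by rw [hδ, div_lt_one (by positivity)]; linarith
    have hδε : 1 / (1 - δ) = 1 + ε / 2 := by
      have : 1 - δ = 2 / (2 + ε) := by rw [hδ]; field_simp; ring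
      rw [this]; field_simp
    refine ⟨(1 - δ) / 2, by linarith, fun n => goodCuts n (p n) δ,
      tendsto_goodCuts_compl hp hδ0 hδ1, ?_⟩
    have hloglarge : ∀ᶠ n : ℕ in atTop, (1 + ε / 2) * (1 + 1 / ε) * (2 / ε) ≤ Real.log n :=
      (Real.tendsto_log_atTop.comp tendsto_natCast_atTop_atTop).eventually_ge_atTop _
    filter_upwards [(isModel_binomialRandom hp).eventually_pos, hloglarge, eventually_ge_atTop 2]
      with n ⟨hd, hlog, hn⟩ hlarge hn2
    refine ⟨∅, by simp; positivity, fun u _ => ⟨Finset.univ, n - ⌊ε * n⌋₊,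
      fun k => (1 - δ) * p n * (k * (n - k)), p n, Finset.mem_univ _, ?_,
      binomialProb_le (p n).2.1, ?_, ⟨?_, ?_⟩, fun G hG => grows_univ_of_forall fun S _ _ => hG S⟩⟩
    · simp; positivity
    · rw [Finset.card_univ, Fintype.card_fin]
      have h1 : (n : ℝ) ≤ ((n - ⌊ε * n⌋₊ : ℕ) : ℝ) + (⌊ε * n⌋₊ : ℕ) := by
        exact_mod_cast (by omega : n ≤ n - ⌊ε * n⌋₊ + ⌊ε * n⌋₊)
      have h2 : ((⌊ε * n⌋₊ : ℕ) : ℝ) ≤ ε * n := Nat.floor_le (by positivity)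
      calc _ ≤ (ε * n) * (p n : ℝ) := mul_le_mul_of_nonneg_right (by linarith) hd.le
        _ = _ := by ring
    · intro k h1 h2
      have h3 : (1 : ℝ) ≤ k := by exact_mod_cast h1
      have h4 : (k : ℝ) + 1 ≤ n := by exact_mod_cast (by omega : k + 1 ≤ n)
      have h5 : (2 : ℝ) ≤ n := by exact_mod_cast hn2
      have h6 : (n : ℝ) / 2 ≤ k * (n - k) := by
        nlinarith [mul_nonneg (by linarith : (0 : ℝ) ≤ k - 1) (by linarith : (0 : ℝ) ≤ n - 1 - k)]
      have h7 := mul_le_mul_of_nonneg_left h6 (mul_pos (by linarith : 0 < 1 - δ) hd).le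
      calc _ = (1 - δ) * p n * (n / 2) := by ring
        _ ≤ _ := h7
    · have hbound : ∀ k ∈ Finset.Ico 1 (n - ⌊ε * n⌋₊), 1 / ((1 - δ) * p n * (k * (n - k))) ≤
          (1 + ε / 2) / (p n * n) * (1 / (k : ℝ) + 1 / (ε * n)) := by
        intro k hk
        rw [Finset.mem_Ico] at hk
        have h3 : (0 : ℝ) < k := by exact_mod_cast hk.1
        have h4 : ε * n < ((⌊ε * n⌋₊ : ℕ) : ℝ) + 1 := Nat.lt_floor_add_one _
        have h5 : (k : ℝ) + (((⌊ε * n⌋₊ : ℕ) : ℝ) + 1) ≤ n := by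
          exact_mod_cast (by omega : k + (⌊ε * n⌋₊ + 1) ≤ n)
        have h6 : ε * n ≤ n - k := by linarith
        have hεn : 0 < ε * n := by positivity
        have h7 : (0 : ℝ) < n - k := by linarith
        have h8 : 1 / ((1 - δ) * p n * (k * (n - k))) =
            1 / (1 - δ) / (p n * n) * (1 / (k : ℝ) + 1 / (n - k)) := by
          have : (1 - δ) ≠ 0 := by linarith
          field_simp
          ring
        rw [h8, hδε]
        refine mul_le_mul_of_nonneg_left ?_ (by positivity)
        have := one_div_le_one_div_of_le hεn h6
        linarith
      refine (Finset.sum_le_sum hbound).trans ?_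
      rw [← Finset.mul_sum, Finset.sum_add_distrib, Finset.sum_const, nsmul_eq_mul, Nat.card_Ico]
      have h9 := sum_Ico_one_div_le (m := n - ⌊ε * n⌋₊) (n := n) (by omega)
      have h10 : ((n - ⌊ε * n⌋₊ - 1 : ℕ) : ℝ) * (1 / (ε * n)) ≤ 1 / ε := by
        have : ((n - ⌊ε * n⌋₊ - 1 : ℕ) : ℝ) ≤ n := by exact_mod_cast (by omega)
        calc _ ≤ (n : ℝ) * (1 / (ε * n)) := mul_le_mul_of_nonneg_right this (by positivity)
          _ = _ := by field_simp
      calc _ ≤ (1 + ε / 2) / (p n * n) * (1 + Real.log n + 1 / ε) :=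
            mul_le_mul_of_nonneg_left (add_le_add h9 h10) (by positivity)
        _ = ((1 + ε / 2) * (1 + Real.log n + 1 / ε)) / (p n * n) := by ring
        _ ≤ ((1 + ε) * Real.log n) / (p n * n) := by
            refine div_le_div_of_nonneg_right ?_ (by positivity)
            rw [← le_div_iff₀ (by positivity), div_div_eq_mul_div] at hlarge
            nlinarith
        _ = _ := by ring

end Binomial

/-! ### Fixed graphs: degrees and standard rates -/

section Deterministic

theorem tendsto_natCast_div_log_sq :
    Tendsto (fun n : ℕ => (n : ℝ) / Real.log n ^ 2) atTop atTop := by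
  have h1 := (Real.isLittleO_pow_log_id_atTop (n := 2)).tendsto_div_nhds_zero
  have h2 : Tendsto (fun x : ℝ => Real.log x ^ 2 / x) atTop (𝓝[>] 0) := by
    refine tendsto_nhdsWithin_iff.2 ⟨h1, ?_⟩
    filter_upwards [eventually_gt_atTop 1] with x hx
    have := Real.log_pos hx
    exact Set.mem_Ioi.2 (by positivity)
  refine (h2.inv_tendsto_nhdsGT_zero.comp tendsto_natCast_atTop_atTop).congr fun n => ?_
  simp

open Classical in
/-- The indicator of the edges of `G`. -/
noncomputable def edgeIndicator {V : Type*} (G : SimpleGraph V) (e : Sym2 V) : ℝ :=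
  if e ∈ G.edgeSet then 1 else 0

section Degree
variable {V : Type*}

open Classical in
theorem sum_edgeIndicator_mk (G : SimpleGraph V) (A : Finset V) (u : V) :
    ∑ v ∈ A, edgeIndicator G s(u, v) = (A.filter (G.Adj u)).card := by
  simp [edgeIndicator, Finset.sum_boole]

open Classical in
theorem sum_card_filter_adj (G : SimpleGraph V) (S T : Finset V) :
    ∑ v ∈ S, (T.filter (G.Adj v)).card = (G.interedges S T).card := by
  rw [SimpleGraph.interedges_def, Finset.card_filter, Finset.sum_product]
  simp only [Finset.card_filter]

-- A vertex of `S` has at most `|S| - 1` of its neighbours in `S`.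
open Classical in
theorem card_mul_le_card_interedges {G : SimpleGraph V} {A S : Finset V} {D : ℝ}
    (hD : ∀ v ∈ S, D ≤ (A.filter (G.Adj v)).card) :
    S.card * (D - S.card + 1) ≤ (G.interedges S (A \ S)).card := by
  rw [← sum_card_filter_adj, Nat.cast_sum, ← nsmul_eq_mul]
  refine Finset.card_nsmul_le_sum _ _ _ fun v hv => ?_
  have h1 : (A.filter (G.Adj v)).card ≤
      ((A \ S).filter (G.Adj v)).card + (S.erase v).card := by
    refine (Finset.card_le_card fun w hw => ?_).trans (Finset.card_union_le _ _)
    rw [Finset.mem_filter] at hw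
    rw [Finset.mem_union, Finset.mem_filter, Finset.mem_sdiff, Finset.mem_erase]
    by_cases hwS : w ∈ S
    · exact Or.inr ⟨hw.2.ne', hwS⟩
    · exact Or.inl ⟨⟨hw.1, hwS⟩, hw.2⟩
  have h2 : (S.erase v).card + 1 = S.card := Finset.card_erase_add_one hv
  have h3 : ((A.filter (G.Adj v)).card : ℝ) + 1 ≤
      ((A \ S).filter (G.Adj v)).card + S.card := by
    exact_mod_cast (by omega)
  linarith [hD v hv]

variable [Fintype V]

open Classical in
theorem two_mul_sum_edgeIndicator (G : SimpleGraph V) :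
    2 * ∑ e, edgeIndicator G e = ∑ v, (G.degree v : ℝ) := by
  have h1 : ∑ e, edgeIndicator G e = (G.edgeFinset.card : ℝ) := by
    simp only [edgeIndicator, Finset.sum_boole]
    congr 2
    ext e
    simp
  rw [h1]
  exact_mod_cast G.sum_degrees_eq_twice_card_edges.symm

open Classical in
theorem card_mul_le_card_edgeBoundary {G : SimpleGraph V} {S : Finset V} {D : ℝ}
    (hD : ∀ v, D ≤ G.degree v) : S.card * (D - S.card + 1) ≤ (edgeBoundary G S).card := by
  rw [card_edgeBoundary, Finset.compl_eq_univ_sdiff]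
  convert! card_mul_le_card_interedges (G := G) (A := Finset.univ) (S := S) fun v _ => ?_
  rw [← SimpleGraph.neighborFinset_eq_filter, SimpleGraph.card_neighborFinset_eq_degree]
  exact hD v

end Degree

variable {d : ℕ → ℝ} {G : ∀ n, SimpleGraph (Fin n)}

open Classical in
theorem isModel_dirac
    (hdeg : ∀ δ : ℝ, 0 < δ → ∀ᶠ n in atTop, ∀ v, |((G n).degree v : ℝ) - d n * n| ≤ δ * (d n * n))
    (hle : ∀ᶠ n : ℕ in atTop, 1 ≤ d n * Real.log n)
    (hdense : Tendsto (fun n => d n * n / Real.log n) atTop atTop) :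
    IsModel d (fun n => Measure.dirac (G n)) (fun n => edgeIndicator (G n)) where
  prob n := inferInstance
  indep n := edgeIndep_dirac (G n)
  row δ hδ := by
    filter_upwards [hdeg δ hδ] with n hn u
    rw [sum_edgeIndicator_mk, ← SimpleGraph.neighborFinset_eq_filter,
      SimpleGraph.card_neighborFinset_eq_degree]
    linarith [(abs_le.1 (hn u)).2]
  le := by
    filter_upwards [hle] with n hn e
    unfold edgeIndicator
    split_ifs <;> linarith
  sum δ hδ := by
    filter_upwards [hdeg δ hδ] with n hn
    have h1 := two_mul_sum_edgeIndicator (G n)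
    have h2 : |∑ v, (((G n).degree v : ℝ) - d n * n)| ≤ n * (δ * (d n * n)) := by
      refine (Finset.abs_sum_le_sum_abs _ _).trans ((Finset.sum_le_sum fun v _ => hn v).trans ?_)
      rw [Finset.sum_const, Finset.card_univ, Fintype.card_fin, nsmul_eq_mul]
    rw [Finset.sum_sub_distrib, ← h1, Finset.sum_const, Finset.card_univ, Fintype.card_fin,
      nsmul_eq_mul, abs_le] at h2
    rw [abs_le]
    constructor <;> nlinarith
  dense := hdense

open Classical in
theorem isExpanding_dirac
    (half : ∃ C c : ℝ, 0 < C ∧ 0 < c ∧ ∃ r : ∀ _ : ℕ, ℕ → ℝ, ∀ᶠ n : ℕ in atTop,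
      RateBound n (d n * n) c C (n / 2 + 1) (r n) ∧
        Grows (G n) Finset.univ (n / 2 + 1) (r n))
    (most : ∀ ε : ℝ, 0 < ε → ∃ c : ℝ, 0 < c ∧ ∀ᶠ n : ℕ in atTop, ∃ U : Finset (Fin n),
      (U.card : ℝ) ≤ ε * n ∧ ∀ u ∉ U, ∃ (A : Finset (Fin n)) (m : ℕ) (r : ℕ → ℝ), u ∈ A ∧
        ((Aᶜ.filter ((G n).Adj u)).card : ℝ) ≤ ε * (d n * n) ∧
        (A.card : ℝ) - m ≤ ε * (d n * n) ∧ RateBound n (d n * n) c (1 + ε) m r ∧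
        Grows (G n) A m r) :
    IsExpanding d (fun n => Measure.dirac (G n)) (fun n => edgeIndicator (G n)) where
  half := by
    obtain ⟨C, c, hC, hc, r, hr⟩ := half
    refine ⟨C, c, hC, hc, r, hr.mono fun n hn => hn.1, ?_⟩
    refine tendsto_const_nhds.congr' (hr.mono fun n hn => ?_)
    dsimp only
    rw [Measure.dirac_apply' _ MeasurableSet.of_discrete, Set.indicator_of_notMem]
    exact fun h => h hn.2
  most ε hε := by
    obtain ⟨c, hc, h⟩ := most ε hε
    refine ⟨c, hc, fun n => {G n}, ?_, h.mono fun n ⟨U, hU, hn⟩ => ⟨U, hU, fun u hu => ?_⟩⟩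
    · refine tendsto_const_nhds.congr fun n => ?_
      rw [Measure.dirac_apply' _ MeasurableSet.of_discrete, Set.indicator_of_notMem]
      exact fun h => h rfl
    · obtain ⟨A, m, r, h1, h2, h3, h4, h5⟩ := hn u hu
      refine ⟨A, m, r, 1, h1, ?_, fun e => ?_, by rwa [mul_one], h4, ?_⟩
      · rwa [sum_edgeIndicator_mk]
      · unfold edgeIndicator
        split_ifs <;> norm_num
      · rintro H rfl
        exact h5

/-- The rates whose reciprocals are `(1 + α) / (D k) + K / (D n)`. -/
noncomputable def standardRate (α K D n : ℝ) (k : ℕ) : ℝ := D * n * k / ((1 + α) * n + K * k)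

/-- The reciprocals sum to a harmonic sum times `(1 + α) / D` plus at most `K / D`, and `hlog`
absorbs `K` into the leading term. The lower bound on the rates uses `k ≥ 1` and `K ≤ n`. -/
theorem rateBound_standardRate {α K D ε : ℝ} {n m : ℕ} (hα : 0 ≤ α) (hK : 0 ≤ K) (hKn : K ≤ n)
    (hD : 0 < D) (hn : 1 ≤ n) (hm : m ≤ n + 1)
    (hlog : (1 + α) * (1 + Real.log n) + K ≤ (1 + ε) * Real.log n) :
    RateBound n D (1 / (2 + α)) (1 + ε) m (standardRate α K D n) := by
  have hn' : (1 : ℝ) ≤ n := by exact_mod_cast hn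
  constructor
  · intro k hk _
    have hk' : (1 : ℝ) ≤ k := by exact_mod_cast hk
    rw [standardRate, one_div_mul_eq_div, div_le_div_iff₀ (by positivity) (by positivity)]
    have h1 : (1 + α) * n + K * k ≤ n * k * (2 + α) := by
      have h2 : (1 + α) * n * 1 ≤ (1 + α) * n * k :=
        mul_le_mul_of_nonneg_left hk' (by positivity)
      have h3 : K * k ≤ n * k := mul_le_mul_of_nonneg_right hKn (by linarith)
      nlinarith
    calc _ ≤ D * (n * k * (2 + α)) := mul_le_mul_of_nonneg_left h1 hD.le
      _ = _ := by ring
  · have h1 : ∀ k ∈ Finset.Ico 1 m, 1 / standardRate α K D n k =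
        (1 + α) / D * (1 / (k : ℝ)) + K / (D * n) := by
      intro k hk
      have hk' : (0 : ℝ) < k := by exact_mod_cast (Finset.mem_Ico.1 hk).1
      have : (0 : ℝ) < n := by linarith
      rw [standardRate]
      field_simp
    rw [Finset.sum_congr rfl h1, Finset.sum_add_distrib, ← Finset.mul_sum, Finset.sum_const,
      nsmul_eq_mul, Nat.card_Ico]
    have h2 := sum_Ico_one_div_le hm
    have h3 : ((m - 1 : ℕ) : ℝ) * (K / (D * n)) ≤ K / D := by
      have : ((m - 1 : ℕ) : ℝ) ≤ n := by exact_mod_cast (by omega)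
      calc _ ≤ (n : ℝ) * (K / (D * n)) := mul_le_mul_of_nonneg_right this (by positivity)
        _ = _ := by field_simp
    calc _ ≤ (1 + α) / D * (1 + Real.log n) + K / D :=
          add_le_add (mul_le_mul_of_nonneg_left h2 (by positivity)) h3
      _ = ((1 + α) * (1 + Real.log n) + K) / D := by ring
      _ ≤ ((1 + ε) * Real.log n) / D := div_le_div_of_nonneg_right hlog hD.le
      _ = _ := by ring

section StandardRate
variable {α K D n x : ℝ} {k : ℕ}

/-- The reciprocal of the rate is a sum, so it suffices that `1 / x` is at most one of the summands:
here `(1 + α) / (D k)`, in the next lemma `K / (D n)`. -/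
theorem standardRate_le_of_mul_le (hα : 0 ≤ α) (hK : 0 ≤ K) (hn : 0 < n) (hx : 0 ≤ x)
    (h : D * k ≤ (1 + α) * x) : standardRate α K D n k ≤ x := by
  rw [standardRate, div_le_iff₀ (by positivity)]
  have := mul_le_mul_of_nonneg_left h hn.le
  have : 0 ≤ x * (K * k) := by positivity
  nlinarith

theorem standardRate_le_of_le_mul (hα : 0 ≤ α) (hK : 0 ≤ K) (hn : 0 < n) (hx : 0 ≤ x)
    (h : D * n ≤ K * x) : standardRate α K D n k ≤ x := by
  rw [standardRate, div_le_iff₀ (by positivity)]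
  have := mul_le_mul_of_nonneg_right h (Nat.cast_nonneg (α := ℝ) k)
  have : 0 ≤ x * ((1 + α) * n) := by positivity
  nlinarith

/-- For growth by degrees inside a set whose vertices lose up to `β` neighbours: in `D / (D - β - k)
= 1 + β / (D - β - k) + k / (D - β - k)` the second term is at most `α` and the third at most `K k /
n`. -/
theorem standardRate_le_of_sub {β : ℝ} (hα : 0 ≤ α) (hK : 0 ≤ K) (hn : 0 < n)
    (h1 : n ≤ K * (D - β - k)) (h2 : β ≤ α * (D - β - k)) (h : k * (D - β - k) ≤ x) :
    standardRate α K D n k ≤ x := by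
  refine le_trans ?_ h
  rw [standardRate, div_le_iff₀ (by positivity)]
  have h3 := mul_le_mul_of_nonneg_right h1 (Nat.cast_nonneg (α := ℝ) k)
  have h4 := mul_le_mul_of_nonneg_right h2 hn.le
  have h5 : D * n ≤ (D - β - k) * ((1 + α) * n + K * k) := by nlinarith
  have h6 := mul_le_mul_of_nonneg_right h5 (Nat.cast_nonneg (α := ℝ) k)
  nlinarith

end StandardRate

/-! ### Expansion in the class `𝒢(d)` -/

namespace InClass

/-- Everything follows from `threshold = log log n · θ`, `θ² log n = 1` and `ω → ∞`: in particular
`ψ θ log n = ω log log n`, and `d ≥ ω log log n · θ`. -/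
theorem eventually_bounds (h : InClass d G) {η : ℝ} (hη : 0 < η) :
    ∀ᶠ n : ℕ in atTop, 0 < theta n ∧ theta n ≤ η * d n ∧ d n ≤ 1 ∧ 1 ≤ d n * Real.log n ∧
      1 / η ≤ Real.log n ∧ AlmostRegular (d n) (G n) ∧
      ∃ ψ : ℝ, 0 < ψ ∧ 1 / η ≤ ψ * theta n * Real.log n ∧ Expanding ψ (G n) := by
  obtain ⟨hd, -, ω, hω, h⟩ := h
  have hlog := Real.tendsto_log_atTop.comp (tendsto_natCast_atTop_atTop (R := ℝ))
  have hlog2 := Real.tendsto_log_atTop.comp hlog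
  filter_upwards [hd, h, hω.eventually_ge_atTop (1 / η), hω.eventually_ge_atTop 1,
    hlog.eventually_ge_atTop (1 / η), hlog.eventually_ge_atTop 1, hlog2.eventually_ge_atTop 1]
    with n h1 ⟨h2, h3, h4⟩ h5 h6 h7 h8 h9
  simp only [Function.comp_apply] at h7 h8 h9
  set L := Real.log n with hL
  have hL0 : 0 < L := by linarith
  have hs : 1 ≤ √L := Real.one_le_sqrt.2 h8
  have hss : √L * √L = L := Real.mul_self_sqrt hL0.le
  have hθ : 0 < theta n := by unfold theta; positivity
  have hthr : threshold n = Real.log L * theta n := by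
    rw [threshold, theta, ← hL]; ring
  have hge : theta n ≤ threshold n := by
    rw [hthr]; nlinarith
  have hθd : ∀ W, 0 ≤ W → W ≤ ω n → W * theta n ≤ d n := fun W h0 hW =>
    (mul_le_mul hW hge hθ.le (by linarith)).trans h2
  refine ⟨hθ, ?_, h1, ?_, h7, h3, ω n * threshold n, by nlinarith, ?_, h4⟩
  · have := hθd _ (by positivity) h5
    rwa [one_div_mul_eq_div, div_le_iff₀ hη, mul_comm] at this
  · have h10 := mul_le_mul_of_nonneg_right (hθd 1 zero_le_one h6) hL0.le
    have h11 : 1 * theta n * L = √L := by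
      rw [theta, ← hL]; field_simp; rw [sq, hss]
    linarith
  · have h10 : theta n * theta n * L = 1 := by
      rw [theta, ← hL]; field_simp; rw [sq, hss]
    calc 1 / η ≤ ω n := h5
      _ ≤ ω n * Real.log L := le_mul_of_one_le_right (by linarith) h9
      _ = ω n * Real.log L * (theta n * theta n * L) := by rw [h10, mul_one]
      _ = _ := by rw [hthr]; ring

theorem isModel (h : InClass d G) :
    IsModel d (fun n => Measure.dirac (G n)) (fun n => edgeIndicator (G n)) := by
  refine isModel_dirac (fun δ hδ => ?_) ((h.eventually_bounds one_pos).mono fun n hn => hn.2.2.2.1) ?_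
  · filter_upwards [h.eventually_bounds hδ] with n ⟨hθ, hθd, hd, hdL, _, hreg, _⟩ v
    have hθδ : theta n ≤ δ := hθd.trans (mul_le_of_le_one_right hδ.le hd)
    have hD : 0 ≤ d n * n := by
      have : 0 ≤ d n := by
        by_contra hcon
        nlinarith
      positivity
    have := mul_le_mul_of_nonneg_right hθδ hD
    obtain ⟨h1, h2⟩ := hreg v
    rw [abs_le]
    constructor <;> linarith
  · refine tendsto_atTop_mono' _ ?_ tendsto_natCast_div_log_sq
    filter_upwards [h.eventually_bounds one_pos] with n ⟨_, _, _, hdL, hL, _⟩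
    rw [div_one] at hL
    rw [div_le_div_iff₀ (by positivity) (by linarith)]
    have : 0 ≤ (n : ℝ) * Real.log n := by positivity
    nlinarith

-- Sets with fewer than `θ n` vertices expand by their degrees. For the others the complement also
-- has at least `θ n` vertices, so the edge condition applies, and `|S| (n - |S|) ≥ θ n · n / 2`.
open Classical in
theorem grows_standardRate_of_expanding {n : ℕ} {H : SimpleGraph (Fin n)} {α K D ψ : ℝ} {m : ℕ}
    (hα : 0 ≤ α) (hK : 0 ≤ K) (hn : (0 : ℝ) < n) (hθ : 0 < theta n) (hψ : 0 ≤ ψ)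
    (hdeg : ∀ v, (1 - theta n) * D ≤ H.degree v) (hexp : Expanding ψ H)
    (hm : ∀ k : ℕ, k < m → (k : ℝ) + theta n * n ≤ n)
    (hsmall : D ≤ (1 + α) * ((1 - theta n) * D - theta n * n))
    (hlarge : D * n ≤ K * ψ * (theta n * n * (n / 2))) :
    Grows H Finset.univ m (standardRate α K D n) := by
  refine grows_univ_of_forall fun S _ hlt => ?_
  have hk := hm _ hlt
  rcases lt_or_ge (S.card : ℝ) (theta n * n) with hS | hS
  · have hb := card_mul_le_card_edgeBoundary (S := S) hdeg
    refine standardRate_le_of_mul_le hα hK hn (Nat.cast_nonneg _) ?_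
    refine le_trans ?_ (mul_le_mul_of_nonneg_left hb (by positivity))
    have h1 : (1 - theta n) * D - theta n * n ≤ (1 - theta n) * D - S.card + 1 := by linarith
    have h3 := mul_le_mul_of_nonneg_left h1 (by positivity : 0 ≤ 1 + α)
    calc D * S.card ≤ ((1 + α) * ((1 - theta n) * D - S.card + 1)) * S.card :=
          mul_le_mul_of_nonneg_right (hsmall.trans h3) (Nat.cast_nonneg _)
      _ = _ := by ring
  · have hcc : ((Sᶜ).card : ℝ) = n - S.card := by
      rw [Finset.card_compl, Fintype.card_fin, Nat.cast_sub]
      simpa using Finset.card_le_univ S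
    have hb := hexp S Sᶜ disjoint_compl_right hS (by rw [hcc]; linarith)
    rw [hcc] at hb
    have hb' : ψ * S.card * (n - S.card) ≤ (edgeBoundary H S).card := by
      rw [card_edgeBoundary]
      convert! hb
    refine standardRate_le_of_le_mul hα hK hn (Nat.cast_nonneg _) ?_
    refine hlarge.trans (le_trans ?_ (mul_le_mul_of_nonneg_left hb' hK))
    have h1 : theta n * n * (n / 2) ≤ S.card * (n - S.card) := by
      have hθn : 0 < theta n * n := by positivity
      rcases le_total (S.card : ℝ) (n / 2) with h2 | h2
      · exact mul_le_mul hS (by linarith) (by positivity) (by positivity)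
      · rw [mul_comm]
        exact mul_le_mul h2 (by linarith) hθn.le (by positivity)
    calc _ ≤ K * ψ * (S.card * (n - S.card)) := mul_le_mul_of_nonneg_left h1 (by positivity)
      _ = _ := by ring

theorem eventually_rates (h : InClass d G) {ε : ℝ} (hε : 0 < ε) :
    ∀ᶠ n : ℕ in atTop, ∃ m : ℕ, n / 2 + 1 ≤ m ∧ (n : ℝ) - m ≤ ε * (d n * n) ∧
      RateBound n (d n * n) (1 / (2 + ε / 4)) (1 + ε) m
        (standardRate (ε / 4) (ε / 4 * Real.log n) (d n * n) n) ∧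
      Grows (G n) Finset.univ m (standardRate (ε / 4) (ε / 4 * Real.log n) (d n * n) n) := by
  set α := ε / 4 with hα
  have hα0 : 0 < α := by positivity
  -- Both the deviation of the degrees and the size `θ n` of small sets cost at most `η D`, and `(1
  -- + α) (1 - 2 η) ≥ 1`. The choice `K = α log n` is large enough for `ψ θ K ≥ 2`, yet costs only
  -- `α log n / D` of waiting time.
  set η := α / (4 * (1 + α)) with hη
  have hη0 : 0 < η := by positivity
  have hη4 : η ≤ 1 / 4 := by
    rw [hη, div_le_div_iff₀ (by positivity) (by norm_num)]; linarith
  have hηε : η ≤ ε := by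
    rw [hη, div_le_iff₀ (by positivity)]; nlinarith
  have hηα : (1 + α) * (1 - 2 * η) = 1 + α / 2 := by
    rw [hη]; field_simp; ring
  have hηinv : 1 / η = 4 * (1 + α) / α := by rw [hη, one_div_div]
  filter_upwards [h.eventually_bounds hη0, h.isModel.eventually_pos,
    h.isModel.dense.eventually_ge_atTop α, eventually_ge_atTop 8]
    with n ⟨hθ, hθd, hd1, _, hL, hreg, ψ, hψ, hψL, hexp⟩ ⟨hd, hlog, hn⟩ hα' hn8
  set L := Real.log n with hLdef
  set D := d n * n with hD
  have hD0 : 0 < D := mul_pos hd hn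
  have hDn : D ≤ n := mul_le_of_le_one_left hn.le hd1
  have hθη : theta n ≤ η := hθd.trans (mul_le_of_le_one_right hη0.le hd1)
  have hθD : theta n * n ≤ η * D := by
    rw [hD, ← mul_assoc]; exact mul_le_mul_of_nonneg_right hθd hn.le
  have hαL : α * L ≤ n := by
    rw [le_div_iff₀ (by linarith)] at hα'
    exact hα'.trans hDn
  rw [hηinv, div_le_iff₀ hα0] at hL hψL
  have hfloor : ((⌊theta n * n⌋₊ : ℕ) : ℝ) ≤ theta n * n := Nat.floor_le (by positivity)
  refine ⟨n - ⌊theta n * n⌋₊, ?_, ?_, ?_, ?_⟩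
  · have : 4 * ⌊theta n * n⌋₊ ≤ n := by
      have : (4 : ℝ) * (⌊theta n * n⌋₊ : ℕ) ≤ n := by nlinarith
      exact_mod_cast this
    omega
  · have : (n : ℝ) ≤ ((n - ⌊theta n * n⌋₊ : ℕ) : ℝ) + (⌊theta n * n⌋₊ : ℕ) := by
      exact_mod_cast (by omega : n ≤ n - ⌊theta n * n⌋₊ + ⌊theta n * n⌋₊)
    have := mul_le_mul_of_nonneg_right hηε hD0.le
    linarith
  · refine rateBound_standardRate hα0.le (by positivity) hαL hD0 (by omega) (by omega) ?_
    have : ε = 4 * α := by rw [hα]; ring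
    rw [this]
    nlinarith
  · refine grows_standardRate_of_expanding hα0.le (by positivity) hn hθ hψ.le
      (fun v => (hreg v).1) hexp (fun k hk => ?_) ?_ ?_
    · have h1 : ((k + (⌊theta n * n⌋₊ + 1) : ℕ) : ℝ) ≤ n := by exact_mod_cast (by omega)
      have h2 := Nat.lt_floor_add_one (theta n * n)
      push_cast at h1
      linarith
    · have h1 : (1 - 2 * η) * D ≤ (1 - theta n) * D - theta n * n := by nlinarith
      have h3 := mul_le_mul_of_nonneg_left h1 (by positivity : 0 ≤ 1 + α)
      rw [← mul_assoc, hηα] at h3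
      nlinarith
    · calc D * n ≤ n * n := mul_le_mul_of_nonneg_right hDn hn.le
        _ ≤ (ψ * theta n * L * α) * (n * n / 2) := by
            have := mul_pos hn hn
            nlinarith
        _ = _ := by ring

theorem isExpanding (h : InClass d G) :
    IsExpanding d (fun n => Measure.dirac (G n)) (fun n => edgeIndicator (G n)) := by
  refine isExpanding_dirac ⟨2, 1 / (2 + 1 / 4), by norm_num, by norm_num,
    fun n => standardRate (1 / 4) (1 / 4 * Real.log n) (d n * n) n, ?_⟩ fun ε hε =>
      ⟨1 / (2 + ε / 4), by positivity, ?_⟩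
  · filter_upwards [h.eventually_rates one_pos, h.isModel.eventually_pos]
      with n ⟨m, hm, _, hr, hG⟩ ⟨hd, hlog, hn⟩
    refine ⟨⟨fun k h1 h2 => hr.1 k h1 (by omega), ?_⟩, fun S hS hne hlt => hG S hS hne (by omega)⟩
    have := hr.2
    norm_num at this
    norm_num
    refine le_trans (Finset.sum_le_sum_of_subset_of_nonneg
      (Finset.Ico_subset_Ico_right hm) fun k _ _ => ?_) this
    unfold standardRate
    positivity
  · filter_upwards [h.eventually_rates hε, h.isModel.eventually_pos]
      with n ⟨m, hm, hnm, hr, hG⟩ ⟨hd, hlog, hn⟩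
    refine ⟨∅, by simp; positivity, fun u _ => ⟨Finset.univ, m, _, Finset.mem_univ u, ?_, ?_,
      hr, hG⟩⟩
    · simp; positivity
    · simpa using hnm

end InClass

end Deterministic

/-! ### Sparse cuts in graphs of minimum degree at least half the order -/

section Cuts
variable {V : Type*} [Fintype V]

-- At most `t` vertices of `X` have more than `t` neighbours across the cut. Discarding them leaves
-- the others at most `t + t` neighbours outside.
open Classical in
theorem exists_subset_of_card_edgeBoundary_le {G : SimpleGraph V} {X : Finset V} {t : ℝ}
    (ht : 0 < t) (hX : ((edgeBoundary G X).card : ℝ) ≤ t * t) :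
    ∃ A ⊆ X, ((X \ A).card : ℝ) ≤ t ∧ ∀ v ∈ A, ((Aᶜ.filter (G.Adj v)).card : ℝ) ≤ 2 * t := by
  set A := X.filter fun v => ((Xᶜ.filter (G.Adj v)).card : ℝ) ≤ t with hA
  have hsub : A ⊆ X := Finset.filter_subset _ _
  have hcard : ((X \ A).card : ℝ) ≤ t := by
    have h1 : (X \ A).card • t ≤ ∑ v ∈ X \ A, ((Xᶜ.filter (G.Adj v)).card : ℝ) := by
      refine Finset.card_nsmul_le_sum _ _ _ fun v hv => ?_
      rw [Finset.mem_sdiff, hA, Finset.mem_filter] at hv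
      by_contra hcon
      exact hv.2 ⟨hv.1, (not_le.1 hcon).le⟩
    have h2 : ∑ v ∈ X \ A, ((Xᶜ.filter (G.Adj v)).card : ℝ) ≤
        ∑ v ∈ X, ((Xᶜ.filter (G.Adj v)).card : ℝ) :=
      Finset.sum_le_sum_of_subset_of_nonneg Finset.sdiff_subset fun _ _ _ => Nat.cast_nonneg _
    have h3 : ∑ v ∈ X, ((Xᶜ.filter (G.Adj v)).card : ℝ) = (edgeBoundary G X).card := by
      rw [← Nat.cast_sum, sum_card_filter_adj, card_edgeBoundary]
    rw [h3] at h2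
    rw [nsmul_eq_mul] at h1
    exact le_of_mul_le_mul_right (h1.trans (h2.trans hX)) ht
  refine ⟨A, hsub, hcard, fun v hv => ?_⟩
  have h1 : (Aᶜ.filter (G.Adj v)).card ≤ (Xᶜ.filter (G.Adj v)).card + (X \ A).card := by
    refine (Finset.card_le_card fun w hw => ?_).trans (Finset.card_union_le _ _)
    rw [Finset.mem_filter, Finset.mem_compl] at hw
    rw [Finset.mem_union, Finset.mem_filter, Finset.mem_sdiff, Finset.mem_compl]
    by_cases hwX : w ∈ X
    · exact Or.inr ⟨hwX, hw.1⟩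
    · exact Or.inl ⟨hwX, hw.2⟩
  have h2 : ((Xᶜ.filter (G.Adj v)).card : ℝ) ≤ t := by
    rw [hA, Finset.mem_filter] at hv
    exact hv.2
  have h3 : ((Aᶜ.filter (G.Adj v)).card : ℝ) ≤ (Xᶜ.filter (G.Adj v)).card + (X \ A).card := by
    exact_mod_cast h1
  linarith

open Classical in
theorem grows_standardRate_of_card_filter_compl_le {G : SimpleGraph V} {A : Finset V}
    {α K D β n : ℝ} {m : ℕ} (hα : 0 ≤ α) (hK : 0 ≤ K) (hn : 0 < n) (hdeg : ∀ v, D ≤ G.degree v)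
    (hA : ∀ v ∈ A, ((Aᶜ.filter (G.Adj v)).card : ℝ) ≤ β)
    (hm : ∀ k : ℕ, k < m → n ≤ K * (D - β - k) ∧ β ≤ α * (D - β - k)) :
    Grows G A m (standardRate α K D n) := by
  intro S hS _ hlt
  obtain ⟨h1, h2⟩ := hm _ hlt
  refine standardRate_le_of_sub hα hK hn h1 h2 ?_
  refine le_trans ?_ (card_mul_le_card_interedges (A := A) (D := D - β) fun v hv => ?_)
  · exact mul_le_mul_of_nonneg_left (by linarith) (Nat.cast_nonneg _)
  · have h3 : (A.filter (G.Adj v)).card + (Aᶜ.filter (G.Adj v)).card = G.degree v := by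
      rw [← Finset.card_union_of_disjoint, ← Finset.filter_union, Finset.union_compl,
        ← SimpleGraph.neighborFinset_eq_filter, SimpleGraph.card_neighborFinset_eq_degree]
      exact Finset.disjoint_filter_filter disjoint_compl_right
    have h4 : ((A.filter (G.Adj v)).card : ℝ) + (Aᶜ.filter (G.Adj v)).card = G.degree v := by
      exact_mod_cast h3
    linarith [hdeg v, hA v (hS hv)]

-- Sets below `(1/2 - η) n` expand by degrees, nearly balanced sets by the cut hypothesis. Larger
-- sets share their boundary with a complement of fewer than `(1/2 - η) n` vertices, which expands
-- by degrees.
open Classical in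
theorem grows_standardRate_of_le_card_edgeBoundary {G : SimpleGraph V} {α K D η c n : ℝ} {m : ℕ}
    (hα : 0 ≤ α) (hK : 0 ≤ K) (hη : 0 < η) (hn : n = Fintype.card V) (hn0 : 0 < n)
    (hD : n / 2 ≤ D) (hDn : D ≤ n)
    (hdeg : ∀ v, D ≤ G.degree v) (hKη : 1 ≤ K * η ^ 2) (hη1 : η ≤ 1) (hKc : 1 ≤ K * c)
    (hm : ∀ k : ℕ, k < m → (k : ℝ) + η * n ≤ n)
    (hcut : ∀ S : Finset V, (1 / 2 - η) * n ≤ S.card → S.card ≤ (1 / 2 + η) * n →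
      c * n ^ 2 ≤ (edgeBoundary G S).card) :
    Grows G Finset.univ m (standardRate α K D n) := by
  refine grows_univ_of_forall fun S _ hlt => ?_
  have hk := hm _ hlt
  have hbound : ∀ T : Finset V, (T.card : ℝ) * (D - T.card) ≤ (edgeBoundary G T).card := fun T =>
    (mul_le_mul_of_nonneg_left (by linarith) (Nat.cast_nonneg _)).trans
      (card_mul_le_card_edgeBoundary hdeg)
  rcases lt_or_ge (S.card : ℝ) ((1 / 2 - η) * n) with h1 | h1
  · refine standardRate_le_of_sub (β := 0) hα hK hn0 ?_ ?_ (by simpa using hbound S)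
    · have : K * η ^ 2 ≤ K * η := mul_le_mul_of_nonneg_left (by nlinarith) hK
      have : K * (η * n) ≤ K * (D - 0 - S.card) := mul_le_mul_of_nonneg_left (by linarith) hK
      nlinarith
    · have : 0 ≤ η * n := by positivity
      have : 0 ≤ D - 0 - S.card := by linarith
      positivity
  rcases le_or_gt (S.card : ℝ) ((1 / 2 + η) * n) with h2 | h2
  · refine standardRate_le_of_le_mul hα hK hn0 (Nat.cast_nonneg _) ?_
    refine le_trans ?_ (mul_le_mul_of_nonneg_left (hcut S h1 h2) hK)
    nlinarith [mul_pos hn0 hn0]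
  · have hcc : ((Sᶜ).card : ℝ) = n - S.card := by
      rw [Finset.card_compl, Nat.cast_sub (Finset.card_le_univ S), hn]
    have hb := hbound Sᶜ
    rw [edgeBoundary_compl, hcc] at hb
    refine standardRate_le_of_le_mul hα hK hn0 (Nat.cast_nonneg _) ?_
    have h3 : (η * n) * (η * n) ≤ (n - S.card) * (D - (n - S.card)) :=
      mul_le_mul (by linarith) (by linarith) (by positivity) (by nlinarith)
    refine le_trans ?_ (mul_le_mul_of_nonneg_left (h3.trans hb) hK)
    calc D * n ≤ n * n := mul_le_mul_of_nonneg_right hDn hn0.le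
      _ ≤ K * η ^ 2 * (n * n) := le_mul_of_one_le_left (by positivity) hKη
      _ = _ := by ring

-- If all nearly balanced cuts have at least `s² n²` edges, the whole graph expands. Otherwise a
-- sparse cut has two sides that, after discarding at most `2 s n` vertices, are nearly closed. As a
-- side has at most `(1/2 + η) n` vertices, expansion by degrees up to `(1/2 - 2 η) n` misses at
-- most `3 η n` of them, and few neighbours lie outside. The value of `s` makes the leak `2 s n`
-- equal to `α · η n`, a fraction `α` of the guaranteed surplus degree `η n`.
open Classical in
theorem exists_grows_standardRate {G : SimpleGraph V} {α D η s n : ℝ} (hα : 0 < α) (hα1 : α ≤ 1)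
    (hη : 0 < η) (hη1 : η ≤ 1 / 4) (hs : s = α * η / 2) (hn : n = Fintype.card V) (hn0 : 0 < n)
    (hD : n / 2 ≤ D) (hDn : D ≤ n) (hdeg : ∀ v, D ≤ G.degree v) :
    ∃ U : Finset V, (U.card : ℝ) ≤ 2 * (s * n) ∧ ∀ u ∉ U, ∃ (A : Finset V) (m : ℕ), u ∈ A ∧
      ((Aᶜ.filter (G.Adj u)).card : ℝ) ≤ 2 * (s * n) ∧ (A.card : ℝ) - m ≤ 3 * (η * n) ∧
      m ≤ Fintype.card V ∧ Grows G A m (standardRate α (1 / (η * s) ^ 2) D n) := by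
  have hs0 : 0 < s := by rw [hs]; positivity
  have hsη : 2 * s ≤ η := by rw [hs]; nlinarith
  have hs1 : s ≤ 1 := by linarith
  set K := 1 / (η * s) ^ 2 with hK
  have hK0 : 0 < K := by positivity
  have hKs : 1 ≤ K * s ^ 2 := by
    rw [hK, one_div_mul_eq_div, le_div_iff₀ (by positivity)]
    have : η ^ 2 ≤ 1 := by nlinarith
    nlinarith [sq_nonneg s]
  have hKη : 1 ≤ K * η ^ 2 := by
    rw [hK, one_div_mul_eq_div, le_div_iff₀ (by positivity)]
    have : s ^ 2 ≤ 1 := by nlinarith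
    nlinarith [sq_nonneg η]
  by_cases hcut : ∀ S : Finset V, (1 / 2 - η) * n ≤ S.card → S.card ≤ (1 / 2 + η) * n →
      s ^ 2 * n ^ 2 ≤ (edgeBoundary G S).card
  · refine ⟨∅, by simp; positivity, fun u _ => ⟨Finset.univ, Fintype.card V - ⌊η * n⌋₊,
      Finset.mem_univ u, by simp; positivity, ?_, by omega, ?_⟩⟩
    · rw [Finset.card_univ]
      have h1 : (Fintype.card V : ℝ) ≤ ((Fintype.card V - ⌊η * n⌋₊ : ℕ) : ℝ) + (⌊η * n⌋₊ : ℕ) := by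
        exact_mod_cast (by omega)
      have h2 : ((⌊η * n⌋₊ : ℕ) : ℝ) ≤ η * n := Nat.floor_le (by positivity)
      nlinarith [mul_pos hη hn0]
    · refine grows_standardRate_of_le_card_edgeBoundary hα.le hK0.le hη hn hn0 hD hDn hdeg hKη
        (by linarith) hKs (fun k hk => ?_) hcut
      have h1 : ((k + (⌊η * n⌋₊ + 1) : ℕ) : ℝ) ≤ Fintype.card V := by exact_mod_cast (by omega)
      have h2 := Nat.lt_floor_add_one (η * n)
      push_cast at h1
      linarith
  · push Not at hcut
    obtain ⟨X, hX1, hX2, hX3⟩ := hcut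
    have hpart : ∀ Y : Finset V, (Y.card : ℝ) ≤ (1 / 2 + η) * n →
        ((edgeBoundary G Y).card : ℝ) < s ^ 2 * n ^ 2 → ∃ A ⊆ Y, ((Y \ A).card : ℝ) ≤ s * n ∧
        ∀ u ∈ A, ∃ m : ℕ,
          ((Aᶜ.filter (G.Adj u)).card : ℝ) ≤ 2 * (s * n) ∧ (A.card : ℝ) - m ≤ 3 * (η * n) ∧
          m ≤ Fintype.card V ∧ Grows G A m (standardRate α K D n) := by
      intro Y hY hcut
      obtain ⟨A, hAY, hcard, hA⟩ := exists_subset_of_card_edgeBoundary_le (t := s * n)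
        (by positivity) (hcut.le.trans_eq (by ring))
      refine ⟨A, hAY, hcard, fun u hu => ⟨⌈(1 / 2 - 2 * η) * n⌉₊, hA u hu, ?_, ?_, ?_⟩⟩
      · have h1 : (A.card : ℝ) ≤ Y.card := by exact_mod_cast Finset.card_le_card hAY
        have h2 := Nat.le_ceil ((1 / 2 - 2 * η) * n)
        linarith
      · rw [Nat.ceil_le, ← hn]
        nlinarith
      · refine grows_standardRate_of_card_filter_compl_le hα.le hK0.le hn0 hdeg hA fun k hk => ?_
        have h1 := Nat.lt_ceil.1 hk
        have h2 : η * n ≤ D - 2 * (s * n) - k := by nlinarith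
        constructor
        · have h3 := mul_le_mul_of_nonneg_left h2 hK0.le
          have : K * η ^ 2 ≤ K * η := mul_le_mul_of_nonneg_left (by nlinarith) hK0.le
          nlinarith
        · have h3 := mul_le_mul_of_nonneg_left h2 hα.le
          refine le_trans (le_of_eq ?_) h3
          rw [hs]; ring
    have hcc : ((Xᶜ).card : ℝ) = n - X.card := by
      rw [Finset.card_compl, Nat.cast_sub (Finset.card_le_univ X), hn]
    obtain ⟨A, hA, hAc, hA'⟩ := hpart X hX2 hX3
    obtain ⟨B, hB, hBc, hB'⟩ := hpart Xᶜ (by rw [hcc]; linarith) (by rwa [edgeBoundary_compl])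
    refine ⟨(X \ A) ∪ (Xᶜ \ B), ?_, fun u hu => ?_⟩
    · have : (((X \ A) ∪ (Xᶜ \ B)).card : ℝ) ≤ (X \ A).card + (Xᶜ \ B).card := by
        exact_mod_cast Finset.card_union_le _ _
      linarith
    · simp only [Finset.mem_union, Finset.mem_sdiff, Finset.mem_compl, not_or, not_and,
        not_not] at hu
      by_cases huX : u ∈ X
      · obtain ⟨m, hm⟩ := hA' u (hu.1 huX)
        exact ⟨A, m, hu.1 huX, hm⟩
      · obtain ⟨m, hm⟩ := hB' u (hu.2 huX)
        exact ⟨B, m, hu.2 huX, hm⟩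

end Cuts

/-! ### Dense regular graphs -/

namespace DenseRegular
variable {d : ℕ → ℝ} {G : ∀ n, SimpleGraph (Fin n)}

theorem eventually_le_one (h : DenseRegular d G) : ∀ᶠ n in atTop, d n ≤ 1 := by
  filter_upwards [h, eventually_ge_atTop 1] with n ⟨_, hdeg⟩ hn
  have hn' : (0 : ℝ) < n := by exact_mod_cast hn
  classical
  have h1 : ((G n).degree ⟨0, hn⟩ : ℝ) ≤ n := by
    have := ((G n).degree_lt_card_verts ⟨0, hn⟩).le
    rw [Fintype.card_fin] at this
    exact_mod_cast this
  have h2 : d n * n ≤ n := by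
    rw [← hdeg ⟨0, hn⟩]
    convert! h1
  nlinarith

theorem isModel (h : DenseRegular d G) :
    IsModel d (fun n => Measure.dirac (G n)) (fun n => edgeIndicator (G n)) := by
  have hlog := Real.tendsto_log_atTop.comp (tendsto_natCast_atTop_atTop (R := ℝ))
  refine isModel_dirac (fun δ hδ => ?_) ?_ ?_
  · filter_upwards [h] with n ⟨hd, hdeg⟩ v
    rw [hdeg v, sub_self, abs_zero]
    positivity
  · filter_upwards [h, hlog.eventually_ge_atTop 2] with n ⟨hd, _⟩ hL
    simp only [Function.comp_apply] at hL
    nlinarith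
  · refine tendsto_atTop_mono' _ ?_ tendsto_natCast_div_log_sq
    filter_upwards [h, hlog.eventually_ge_atTop 2] with n ⟨hd, _⟩ hL
    simp only [Function.comp_apply] at hL
    rw [div_le_div_iff₀ (by positivity) (by linarith)]
    have h1 : 0 ≤ (n : ℝ) * Real.log n := by positivity
    have h2 : 1 ≤ d n * Real.log n := by nlinarith
    nlinarith

/-- Partial fractions split the reciprocal into `1 / k` and `1 / (D - k + 1)`. Since `D > n / 2`,
the second is at most the reflected term `1 / (⌊n/2⌋ + 1 - k)`, so there are two harmonic sums,
together at most `2 (1 + log n) ≤ 4 log n`. Degrees alone thus carry the exploration past half of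
the vertices, which gives the diameter bound even across a sparse cut. -/
theorem rateBound_mul_sub {n : ℕ} {D : ℝ} (hn : 2 ≤ n) (hD : (n : ℝ) / 2 < D)
    (hlog : 1 ≤ Real.log n) :
    RateBound n D 1 4 (n / 2 + 1) fun k => k * (D - k + 1) := by
  have hhalf : ((n / 2 : ℕ) : ℝ) ≤ n / 2 := Nat.cast_div_le
  have hn' : (2 : ℝ) ≤ n := by exact_mod_cast hn
  have hD0 : 0 < D := by linarith
  have hk' : ∀ k : ℕ, k < n / 2 + 1 → (k : ℝ) ≤ (n / 2 : ℕ) := fun k hk => by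
    exact_mod_cast (by omega)
  constructor
  · intro k h1 h2
    have h3 : (1 : ℝ) ≤ k := by exact_mod_cast h1
    have h4 := hk' k h2
    nlinarith [mul_nonneg (by linarith : (0 : ℝ) ≤ k - 1) (by linarith : 0 ≤ D - k)]
  · have h1 : ∀ k ∈ Finset.Ico 1 (n / 2 + 1), 1 / ((k : ℝ) * (D - k + 1)) ≤
        1 / D * (1 / (k : ℝ) + 1 / ((n / 2 + 1 - k : ℕ) : ℝ)) := by
      intro k hk
      rw [Finset.mem_Ico] at hk
      have h3 : (1 : ℝ) ≤ k := by exact_mod_cast hk.1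
      have h4 := hk' k hk.2
      have h5 : ((n / 2 + 1 - k : ℕ) : ℝ) = (n / 2 : ℕ) + 1 - k := by
        rw [Nat.cast_sub (by omega)]; push_cast; ring
      have h6 : 1 / (D - k + 1) ≤ 1 / ((n / 2 + 1 - k : ℕ) : ℝ) :=
        one_div_le_one_div_of_le (by rw [h5]; linarith) (by rw [h5]; linarith)
      have h7 : 0 < D - k + 1 := by linarith
      calc 1 / ((k : ℝ) * (D - k + 1)) = 1 / (D + 1) * (1 / (k : ℝ) + 1 / (D - k + 1)) := by
            field_simp; ring
        _ ≤ 1 / D * (1 / (k : ℝ) + 1 / (D - k + 1)) := by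
            refine mul_le_mul_of_nonneg_right ?_ (by positivity)
            exact one_div_le_one_div_of_le hD0 (by linarith)
        _ ≤ _ := mul_le_mul_of_nonneg_left (by linarith) (by positivity)
    refine (Finset.sum_le_sum h1).trans ?_
    rw [← Finset.mul_sum, Finset.sum_add_distrib]
    have h2 : ∑ k ∈ Finset.Ico 1 (n / 2 + 1), 1 / ((n / 2 + 1 - k : ℕ) : ℝ) =
        ∑ k ∈ Finset.Ico 1 (n / 2 + 1), 1 / (k : ℝ) := by
      have := Finset.sum_Ico_reflect (fun k : ℕ => 1 / (k : ℝ)) 1 (m := n / 2 + 1) (n := n / 2 + 1)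
        (by omega)
      simpa using this
    rw [h2]
    have h3 := sum_Ico_one_div_le (m := n / 2 + 1) (n := n) (by omega)
    calc _ ≤ 1 / D * (4 * Real.log n) :=
          mul_le_mul_of_nonneg_left (by linarith) (by positivity)
      _ = _ := by ring

theorem isExpanding (h : DenseRegular d G) :
    IsExpanding d (fun n => Measure.dirac (G n)) (fun n => edgeIndicator (G n)) := by
  have hlog := Real.tendsto_log_atTop.comp (tendsto_natCast_atTop_atTop (R := ℝ))
  refine isExpanding_dirac ⟨4, 1, by norm_num, by norm_num,
    fun n k => k * (d n * n - k + 1), ?_⟩ fun ε hε => ?_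
  · filter_upwards [h, hlog.eventually_ge_atTop 1, eventually_ge_atTop 2] with n ⟨hd, hdeg⟩ hL hn
    have hn' : (2 : ℝ) ≤ n := by exact_mod_cast hn
    refine ⟨rateBound_mul_sub hn (by nlinarith) hL, grows_univ_of_forall fun S _ _ => ?_⟩
    exact card_mul_le_card_edgeBoundary fun v => (hdeg v).ge
  -- Small enough that the losses `2 s n` and `3 (α / 2) n` are at most `ε n / 2 ≤ ε D`, and that `1
  -- + 2 α ≤ 1 + ε` leaves room for `K`.
  · set α := min ε 1 / 4 with hα
    have hmin : 0 < min ε 1 := lt_min hε one_pos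
    have hα0 : 0 < α := by positivity
    have hαε : 4 * α ≤ ε := by rw [hα]; linarith [min_le_left ε 1]
    have hα1 : 4 * α ≤ 1 := by rw [hα]; linarith [min_le_right ε 1]
    set s := α * (α / 2) / 2 with hs
    have hs0 : 0 < s := by positivity
    have hsα : 4 * s ≤ α := by rw [hs]; nlinarith
    set K := 1 / (α / 2 * s) ^ 2 with hK
    have hK0 : 0 < K := by positivity
    refine ⟨1 / (2 + α), by positivity, ?_⟩
    filter_upwards [h, h.eventually_le_one, hlog.eventually_ge_atTop ((1 + α + K) / α),
      eventually_ge_atTop 1, tendsto_natCast_atTop_atTop.eventually_ge_atTop K]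
      with n ⟨hd, hdeg⟩ hd1 hL hn hKn
    have hn' : (1 : ℝ) ≤ n := by exact_mod_cast hn
    have hn0 : (0 : ℝ) < n := by linarith
    rw [Function.comp_apply, div_le_iff₀ hα0] at hL
    obtain ⟨U, hU, hUA⟩ := exists_grows_standardRate (G := G n) (D := d n * n) (n := n) hα0
      (by linarith) (η := α / 2) (by positivity) (by linarith) hs (by simp) hn0 (by nlinarith)
      (by nlinarith) fun v => (hdeg v).ge
    have hsn := mul_le_mul_of_nonneg_right hsα hn0.le
    have hαn := mul_le_mul_of_nonneg_right hαε hn0.le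
    refine ⟨U, hU.trans (by linarith), fun u hu => ?_⟩
    obtain ⟨A, m, huA, h1, h2, h3, h4⟩ := hUA u hu
    rw [Fintype.card_fin] at h3
    have hD : n / 2 ≤ d n * n := by nlinarith
    have hεD := mul_le_mul_of_nonneg_left hD hε.le
    have h1' : 2 * (s * n) ≤ ε * (d n * n) := by linarith
    have h2' : 3 * (α / 2 * n) ≤ ε * (d n * n) := by nlinarith
    refine ⟨A, m, _, huA, le_trans ?_ h1', h2.trans h2',
      rateBound_standardRate hα0.le hK0.le hKn (by linarith) hn (by omega) ?_, h4⟩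
    · convert! h1
    · nlinarith [Real.log_nonneg hn']

end DenseRegular

/-- Valid for arbitrary sets, because `b ↦ (a, b)` is a measurable embedding; measurability of the
spanner events is never needed. -/
theorem dirac_prod_apply {α β : Type*} [MeasurableSpace α] [MeasurableSingletonClass α]
    [MeasurableSpace β] (μ : Measure β) [SFinite μ] (a : α) (s : Set (α × β)) :
    ((Measure.dirac a).prod μ) s = μ {b | (a, b) ∈ s} := by
  rw [Measure.dirac_prod, (measurableEmbedding_prodMk_left a).map_apply]
  rfl

end RandomSpanner

theorem theorem1 :
    (∀ (d : ℕ → ℝ) (G : ∀ n : ℕ, SimpleGraph (Fin n)),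
      RandomSpanner.InClass d G ∨ RandomSpanner.DenseRegular d G →
      (∀ ε : ℝ, 0 < ε →
        Tendsto (fun n => RandomSpanner.lengthLaw n
          {len | RandomSpanner.OneSpannerNear ε (G n) len}) atTop (𝓝 1)) ∧
      (∀ (lam : ℕ → ℝ) (C : ℝ), (∀ᶠ n in atTop, 2 ≤ lam n ∧ lam n ≤ C) →
        Tendsto (fun n => RandomSpanner.lengthLaw n
          {len | RandomSpanner.SpannersLarge (d n) (lam n) (G n) len}) atTop (𝓝 1))) ∧
    (∀ p : ℕ → I, Tendsto (fun n : ℕ => n * (p n : ℝ) / Real.log n) atTop atTop →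
      (∀ ε : ℝ, 0 < ε →
        Tendsto (fun n =>
          ((SimpleGraph.binomialRandom (Fin n) (p n)).prod (RandomSpanner.lengthLaw n))
            {x | RandomSpanner.OneSpannerNear ε x.1 x.2}) atTop (𝓝 1)) ∧
      (∀ (lam : ℕ → ℝ) (C : ℝ), (∀ᶠ n in atTop, 2 ≤ lam n ∧ lam n ≤ C) →
        Tendsto (fun n =>
          ((SimpleGraph.binomialRandom (Fin n) (p n)).prod (RandomSpanner.lengthLaw n))
            {x | RandomSpanner.SpannersLarge (p n : ℝ) (lam n) x.1 x.2}) atTop (𝓝 1))) := by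
  refine ⟨fun d G h => ?_, fun p hp => ?_⟩
  · have hmodel : RandomSpanner.IsModel d (fun n => Measure.dirac (G n))
        (fun n => RandomSpanner.edgeIndicator (G n)) := h.elim (fun h => h.isModel) fun h => h.isModel
    have hexp : RandomSpanner.IsExpanding d (fun n => Measure.dirac (G n))
        (fun n => RandomSpanner.edgeIndicator (G n)) :=
      h.elim (fun h => h.isExpanding) fun h => h.isExpanding
    refine ⟨fun ε hε => ?_, fun lam C hlam => ?_⟩
    · simpa only [RandomSpanner.dirac_prod_apply, Set.mem_ofPred_eq] using hmodel.tendsto_oneSpannerNear hexp hε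
    · simpa only [RandomSpanner.dirac_prod_apply, Set.mem_ofPred_eq] using hmodel.tendsto_spannersLarge hlam
  · have hmodel := RandomSpanner.isModel_binomialRandom hp
    exact ⟨fun ε hε => hmodel.tendsto_oneSpannerNear (RandomSpanner.isExpanding_binomialRandom hp) hε,
      fun lam C hlam => hmodel.tendsto_spannersLarge hlam⟩
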